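/- **Theorem 2.1 (Pohozaev-type identity).** Let $N\ge 3$, $a<\frac{N-2}{2}$, $a\le b<a+1$ and $p=\frac{2N}{N-2(1+a-b)}$. Let $\Omega\subset\mathbb R^N$ be a bounded domain with smooth boundary, let $K\in C^1(\overline\Omega)$, and let $\mathcal D^{1,2}_a(\mathbb R^N)$ be the completion of $C_c^\infty(\mathbb R^N)$ with respect to the norm $\big(\int_{\mathbb R^N}|x|^{-2a}|\nabla \varphi|^2\,dx\big)^{1/2}$. Let $u\in\mathcal D^{1,2}_a(\mathbb R^N)$ be a positive weak solution of $$-\operatorname{div}(|x|^{-2a}\nabla u)=K(x)\,\frac{u^{p-1}}{|x|^{bp}}\qquad\text{in }\Omega,$$ that is, $u>0$ a.e. in $\Omega$ and $\int_\Omega|x|^{-2a}\nabla u\cdot\nabla\varphi\,dx=\int_\Omega K\frac{u^{p-1}}{|x|^{bp}}\varphi\,dx$ for all $\varphi\in C_c^\infty(\Omega)$. So that the boundary integrals below make sense, suppose that near $\partial\Omega\setminus\{0\}$ the function $u$ is of class $C^1$ up to the boundary of $\Omega$ (that is, there is an open set $U\supseteq\partial\Omega\setminus\{0\}$ such that $u$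 is $C^1$ in $\Omega\cap U$ and $u$, $\nabla u$ extend continuously to $\overline\Omega\cap U$) and, in case $0\in\partial\Omega$, that the four boundary integrals below converge absolutely. Then all integrals below converge absolutely and $$\frac1p\int_\Omega(\nabla K\cdot x)\frac{u^p}{|x|^{bp}}\,dx-\frac1p\int_{\partial\Omega}K\frac{u^p}{|x|^{bp}}\,x\cdot\nu\,d\sigma=\frac{N-2-2a}{2}\int_{\partial\Omega}|x|^{-2a}u\,\nabla u\cdot\nu\,d\sigma-\frac12\int_{\partial\Omega}|x|^{-2a}|\nabla u|^2\,x\cdot\nu\,d\sigma+\int_{\partial\Omega}|x|^{-2a}(x\cdot\nabla u)(\nabla u\cdot\nu)\,d\sigma,$$ where $\nu$ is the outer unit normal of $\partial\Omega$ and $\sigma$ the surface measure. -/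

import Mathlib

open MeasureTheory Filter Topology
open scoped ContDiff ENNReal

noncomputable section

/-- `ρ` is a smooth defining function of `Ω` near `x`: on the open neighbourhood `V` of `x` it is
smooth with nonvanishing gradient, and `Ω` is the set where `ρ` is negative. -/
structure IsLocalDefiningFunction {N : ℕ} (Ω : Set (EuclideanSpace ℝ (Fin N)))
    (x : EuclideanSpace ℝ (Fin N)) (V : Set (EuclideanSpace ℝ (Fin N)))
    (ρ : EuclideanSpace ℝ (Fin N) → ℝ) : Prop where
  isOpen : IsOpen V
  mem : x ∈ V
  smooth : ContDiffOn ℝ ∞ ρ V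
  gradient_ne_zero : ∀ y ∈ V, gradient ρ y ≠ 0
  mem_iff : ∀ y ∈ V, y ∈ Ω ↔ ρ y < 0

/-- The boundary of `Ω` is a smooth hypersurface with `Ω` locally on one side of it. -/
def HasSmoothBoundary {N : ℕ} (Ω : Set (EuclideanSpace ℝ (Fin N))) : Prop :=
  ∀ x ∈ frontier Ω, ∃ V ρ, IsLocalDefiningFunction Ω x V ρ

open Classical in
/-- The outer unit normal of `Ω` at a boundary point: the normalized gradient of a local defining
function (it does not depend on the choice of that function); `0` where there is none. -/
def outerUnitNormal {N : ℕ} (Ω : Set (EuclideanSpace ℝ (Fin N)))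
    (x : EuclideanSpace ℝ (Fin N)) : EuclideanSpace ℝ (Fin N) :=
  if h : ∃ ρ V, x ∈ frontier Ω ∧ IsLocalDefiningFunction Ω x V ρ then
    ‖gradient h.choose x‖⁻¹ • gradient h.choose x
  else 0

/-- Surface measure on the boundary of `Ω`: the `(N-1)`-dimensional Hausdorff measure, in the
normalization that agrees with Lebesgue measure on hyperplanes. -/
def surfaceMeasure {N : ℕ} (Ω : Set (EuclideanSpace ℝ (Fin N))) :
    Measure (EuclideanSpace ℝ (Fin N)) :=
  (Measure.euclideanHausdorffMeasure (N - 1)).restrict (frontier Ω)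

/-- `f` is `C¹` in `Ω ∩ U` with gradient `F`, and `f` and `F` are continuous up to the part of the
boundary of `Ω` that lies in `U`. -/
structure IsC1UpToBoundary {N : ℕ} (Ω U : Set (EuclideanSpace ℝ (Fin N)))
    (f : EuclideanSpace ℝ (Fin N) → ℝ)
    (F : EuclideanSpace ℝ (Fin N) → EuclideanSpace ℝ (Fin N)) : Prop where
  continuousOn : ContinuousOn f (closure Ω ∩ U)
  continuousOn_gradient : ContinuousOn F (closure Ω ∩ U)
  hasGradientAt : ∀ x ∈ Ω ∩ U, HasGradientAt f (F x) x

/-- The space `C¹(Ω̄)`. -/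
def IsC1OnClosure {N : ℕ} (Ω : Set (EuclideanSpace ℝ (Fin N)))
    (f : EuclideanSpace ℝ (Fin N) → ℝ) : Prop :=
  ∃ F, IsC1UpToBoundary Ω Set.univ f F

/-- `u` belongs to the space `𝒟^{1,2}_a(ℝᴺ)`, the completion of `C_c^∞(ℝᴺ)` in the norm
`(∫ |x|^{-2a} |∇φ|²)^{1/2}`, and `g` is its gradient: `u` is the a.e. limit of test functions whose
gradients converge to `g` in `L²(|x|^{-2a} dx)`. -/
structure MemD12 {N : ℕ} (a : ℝ) (u : EuclideanSpace ℝ (Fin N) → ℝ)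
    (g : EuclideanSpace ℝ (Fin N) → EuclideanSpace ℝ (Fin N)) : Prop where
  aestronglyMeasurable_gradient : AEStronglyMeasurable g volume
  exists_approx : ∃ φ : ℕ → EuclideanSpace ℝ (Fin N) → ℝ,
    (∀ n, ContDiff ℝ ∞ (φ n) ∧ HasCompactSupport (φ n)) ∧
    (∀ᵐ x, Tendsto (fun n => φ n x) atTop (𝓝 (u x))) ∧
    Tendsto (fun n => ∫⁻ x, ENNReal.ofReal (‖x‖ ^ (-2 * a) * ‖gradient (φ n) x - g x‖ ^ 2))
      atTop (𝓝 0)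

/-- `u`, with gradient `g`, is a positive weak solution in `Ω` of
`-div (|x|^{-2a} ∇u) = K u^{p-1} / |x|^{bp}`. -/
structure IsPositiveWeakSolution {N : ℕ} (Ω : Set (EuclideanSpace ℝ (Fin N))) (a b p : ℝ)
    (K u : EuclideanSpace ℝ (Fin N) → ℝ)
    (g : EuclideanSpace ℝ (Fin N) → EuclideanSpace ℝ (Fin N)) : Prop where
  pos : ∀ᵐ x ∂volume.restrict Ω, 0 < u x
  weak_eq : ∀ φ : EuclideanSpace ℝ (Fin N) → ℝ,
    ContDiff ℝ ∞ φ → HasCompactSupport φ → tsupport φ ⊆ Ω →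
      ∫ x in Ω, ‖x‖ ^ (-2 * a) * inner ℝ (g x) (gradient φ x) =
        ∫ x in Ω, K x * (u x ^ (p - 1) / ‖x‖ ^ (b * p)) * φ x

/-- `u` is `C¹`, with gradient `g`, up to the boundary of `Ω` near each boundary point other than
the origin (nothing is asked away from the boundary). -/
def IsC1NearBoundary {N : ℕ} (Ω : Set (EuclideanSpace ℝ (Fin N)))
    (u : EuclideanSpace ℝ (Fin N) → ℝ)
    (g : EuclideanSpace ℝ (Fin N) → EuclideanSpace ℝ (Fin N)) : Prop :=
  ∃ U, IsOpen U ∧ frontier Ω \ {0} ⊆ U ∧ IsC1UpToBoundary Ω U u g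

/-- The four boundary integrals of the identity converge absolutely. -/
structure BoundaryTermsIntegrable {N : ℕ} (Ω : Set (EuclideanSpace ℝ (Fin N))) (a b p : ℝ)
    (K u : EuclideanSpace ℝ (Fin N) → ℝ)
    (g : EuclideanSpace ℝ (Fin N) → EuclideanSpace ℝ (Fin N)) : Prop where
  potential : Integrable
    (fun x => K x * (u x ^ p / ‖x‖ ^ (b * p)) * inner ℝ x (outerUnitNormal Ω x)) (surfaceMeasure Ω)
  flux : Integrable
    (fun x => ‖x‖ ^ (-2 * a) * u x * inner ℝ (g x) (outerUnitNormal Ω x)) (surfaceMeasure Ω)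
  energy : Integrable
    (fun x => ‖x‖ ^ (-2 * a) * ‖g x‖ ^ 2 * inner ℝ x (outerUnitNormal Ω x)) (surfaceMeasure Ω)
  radial : Integrable
    (fun x => ‖x‖ ^ (-2 * a) * inner ℝ x (g x) * inner ℝ (g x) (outerUnitNormal Ω x))
    (surfaceMeasure Ω)

end

noncomputable section

/-! The identity is the divergence theorem for a single field. With w = |x|^{-2a}, let Y = w (x·∇u)
∇u - (1/2) w |∇u|² x + (1/p) K u^p |x|^{-bp} x + ((N-2-2a)/2) w u ∇u (`pohozaevField`). Multiplying
the equation by x·∇u accounts for the first three terms and multiplying it by u for the last. The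
leftover bulk terms cancel because N/p = (N-2-2a)/2 + b, so that div Y = (1/p) (∇K·x) u^p |x|^{-bp}
(`pohozaevSource`).

Second derivatives of u are not at hand, so div Y is computed weakly, by inner variations. Let v be
u composed with the shear x ↦ x + t ζ(x) e, with ζ supported in Ω away from 0. Then v - u is an
admissible test function, and the weak equation gives E(v) - E(u) = (1/2) ∫ w |d|² - ∫ K r, where d
is the increment of the gradient and r the weighted second order remainder of u^p / p. Nothing says
that d is O(t). Still, ∫ K r is at most (1/2) ∫ w |d|² + C t²
(`MemD12On.exists_lintegral_remainder_le`): large values of |x|^{-b} u carry little L^p mass and are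
handled by the Caffarelli-Kohn-Nirenberg inequality, the rest by an L² difference bound. Hence E(v)
≥ E(u) - C t² for t of both signs. A change of variables moves the t-dependence onto smooth weights,
so E(v) is differentiable in t and its derivative at 0 vanishes
(`IsPositiveWeakSolution.inner_variation`). Summing over the directions e_i with cutoffs ζ x_i gives
the dilation field, hence div Y.

The Gauss-Green formula `integral_inner_gradient_add_mul_eq` holds for fields that are merely
continuous up to a smooth boundary and have a weak divergence. In a chart one tests with a boundary
layer cutoff; the error is proportional to the oscillation of the normal, and a partition of unity
makes it as small as desired.

The origin is removed by cutoffs: |Y| ≤ |x| Q with Q integrable, by Hardy and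
Caffarelli-Kohn-Nirenberg, while |x| |∇cutoff| stays bounded. -/

/-! ### Preliminaries on gradients and norms -/

theorem norm_gradient_eq {E : Type*} [NormedAddCommGroup E] [InnerProductSpace ℝ E]
    [CompleteSpace E] (φ : E → ℝ) (x : E) : ‖gradient φ x‖ = ‖fderiv ℝ φ x‖ :=
  LinearIsometryEquiv.norm_map _ _

theorem inner_gradient_eq {E : Type*} [NormedAddCommGroup E] [InnerProductSpace ℝ E]
    [CompleteSpace E] (φ : E → ℝ) (x v : E) : inner ℝ (gradient φ x) v = fderiv ℝ φ x v := by
  simp [gradient]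

theorem eLpNorm_two_sq {α F : Type*} [MeasurableSpace α] [NormedAddCommGroup F] (μ : Measure α)
    (f : α → F) : eLpNorm f 2 μ ^ 2 = ∫⁻ x, ‖f x‖ₑ ^ 2 ∂μ := by
  have := eLpNorm_nnreal_pow_eq_lintegral (μ := μ) (f := f) (p := 2) (by norm_num)
  simpa using this

/-- The fundamental theorem of calculus from infinity, where f vanishes. Reflection reduces it to
the version on a left half line. -/
theorem enorm_le_lintegral_Ioi_deriv {f : ℝ → ℝ} (hf : ContDiff ℝ 1 f) (hc : HasCompactSupport f) :
    ‖f 1‖ₑ ≤ ∫⁻ s in Set.Ioi (1 : ℝ), ‖deriv f s‖ₑ := by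
  have h1 : ContDiff ℝ 1 (fun s => f (-s)) := hf.comp contDiff_neg
  have h2 : HasCompactSupport (fun s => f (-s)) := hc.comp_homeomorph (Homeomorph.neg ℝ)
  have := h2.enorm_le_lintegral_Ici_deriv h1 (-1)
  simp only [neg_neg, deriv_comp_neg, enorm_neg] at this
  refine this.trans (le_of_eq ?_)
  rw [← lintegral_indicator measurableSet_Iic, ← lintegral_indicator measurableSet_Ioi,
    ← lintegral_neg_eq_self]
  refine lintegral_congr_ae ?_
  filter_upwards [compl_mem_ae_iff.2 (measure_singleton (1 : ℝ))] with s hs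
  have : s ≠ 1 := hs
  by_cases h : 1 < s
  · simp [Set.indicator, h, h.le]
  · simp [Set.indicator, h, (lt_of_le_of_ne (not_lt.1 h) this)]

/-! ### The weighted Hardy inequality -/

section Hardy

set_option linter.unusedSectionVars false

variable {E : Type*} [NormedAddCommGroup E] [InnerProductSpace ℝ E] [FiniteDimensional ℝ E]
  [MeasurableSpace E] [BorelSpace E]

theorem lintegral_comp_pos_smul (G : E → ℝ≥0∞) {s : ℝ} (hs : 0 < s) :
    ∫⁻ x, G (s • x) = ENNReal.ofReal (s ^ (-(Module.finrank ℝ E : ℝ))) * ∫⁻ x, G x := by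
  have h := Measure.map_addHaar_smul (volume : Measure E) hs.ne'
  have e : MeasurableEmbedding (fun x : E => s • x) :=
    (Homeomorph.smulOfNeZero s hs.ne').measurableEmbedding
  rw [← e.lintegral_map, h, lintegral_smul_measure, smul_eq_mul, Real.rpow_neg hs.le,
    Real.rpow_natCast, abs_of_pos (by positivity)]

/-- Integrate the radial derivative along the ray s ↦ s x from s = 1 to infinity, where φ vanishes.
-/
theorem hardy_pointwise {φ : E → ℝ} (hφ : ContDiff ℝ 1 φ) (hc : HasCompactSupport φ) {x : E}
    (hx : x ≠ 0) : ‖φ x‖ₑ ≤ ∫⁻ s in Set.Ioi (1 : ℝ), ‖x‖ₑ * ‖fderiv ℝ φ (s • x)‖ₑ := by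
  have h1 : ContDiff ℝ 1 (fun s : ℝ => φ (s • x)) := hφ.comp (by fun_prop)
  have h2 : HasCompactSupport (fun s : ℝ => φ (s • x)) :=
    hc.comp_isClosedEmbedding (isClosedEmbedding_smul_left hx)
  have h3 := enorm_le_lintegral_Ioi_deriv h1 h2
  simp only [one_smul] at h3
  refine h3.trans (lintegral_mono fun s => ?_)
  have hd : HasDerivAt (fun s : ℝ => φ (s • x)) (fderiv ℝ φ (s • x) x) s := by
    have := ((hφ.differentiable one_ne_zero (s • x)).hasFDerivAt).comp_hasDerivAt s
      ((hasDerivAt_id s).smul_const x)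
    rw [one_smul] at this
    exact this
  rw [hd.deriv, mul_comm]
  exact ContinuousLinearMap.le_opENorm _ _

/-- Cauchy-Schwarz on the ray after splitting off the factor s^{(-1-α)/2}. The exponent 2a comes
from |s x|^{-a} = s^{-a} |x|^{-a}. The parameter α is free and is fixed in `hardy`. -/
theorem hardy_pointwise_sq {a α : ℝ} {φ : E → ℝ} (hφ : ContDiff ℝ 1 φ)
    (hc : HasCompactSupport φ) {x : E} (hx : x ≠ 0) :
    ‖‖x‖ ^ (-a - 1) * φ x‖ₑ ^ 2 ≤ (∫⁻ s in Set.Ioi (1 : ℝ), ENNReal.ofReal (s ^ (-1 - α))) *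
      ∫⁻ s in Set.Ioi (1 : ℝ), ENNReal.ofReal (s ^ (1 + α + 2 * a)) *
        ‖‖s • x‖ ^ (-a) * ‖fderiv ℝ φ (s • x)‖‖ₑ ^ 2 := by
  have hx' : 0 < ‖x‖ := norm_pos_iff.2 hx
  have hcont : Continuous (fun s : ℝ => ‖fderiv ℝ φ (s • x)‖) :=
    ((hφ.continuous_fderiv one_ne_zero).comp (by fun_prop)).norm
  have key : ‖‖x‖ ^ (-a - 1) * φ x‖ₑ ≤ ∫⁻ s in Set.Ioi (1 : ℝ),
      ENNReal.ofReal (s ^ ((-1 - α) / 2)) *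
        ENNReal.ofReal (s ^ ((1 + α + 2 * a) / 2) * (‖s • x‖ ^ (-a) * ‖fderiv ℝ φ (s • x)‖)) := by
    rw [enorm_mul]
    refine (mul_le_mul_right (hardy_pointwise hφ hc hx) _).trans ?_
    rw [← lintegral_const_mul' _ _ enorm_ne_top]
    refine (setLIntegral_congr_fun measurableSet_Ioi fun s hs => ?_).le
    have hs0 : (0 : ℝ) < s := lt_trans one_pos hs
    rw [← ENNReal.ofReal_mul (by positivity), ← enorm_norm x, ← enorm_norm (fderiv ℝ φ (s • x)),
      ← enorm_mul, ← enorm_mul, Real.enorm_of_nonneg (by positivity)]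
    congr 1
    rw [norm_smul, Real.norm_of_nonneg hs0.le, Real.mul_rpow hs0.le hx'.le, ← mul_assoc, ← mul_assoc,
      ← mul_assoc, ← mul_assoc, ← Real.rpow_add hs0, ← Real.rpow_add hs0]
    have e1 : (-1 - α) / 2 + (1 + α + 2 * a) / 2 + -a = 0 := by ring
    rw [e1, Real.rpow_zero, one_mul]
    congr 1
    nth_rewrite 2 [← Real.rpow_one ‖x‖]
    rw [← Real.rpow_add hx']
    ring_nf
  have cs := ENNReal.lintegral_mul_le_Lp_mul_Lq (volume.restrict (Set.Ioi (1 : ℝ)))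
    Real.HolderConjugate.two_two
    (f := fun s => ENNReal.ofReal (s ^ ((-1 - α) / 2)))
    (g := fun s => ENNReal.ofReal
      (s ^ ((1 + α + 2 * a) / 2) * (‖s • x‖ ^ (-a) * ‖fderiv ℝ φ (s • x)‖)))
    (by fun_prop) (by
      have := hcont.measurable
      fun_prop)
  have := pow_le_pow_left₀ (zero_le) (key.trans cs) 2
  refine this.trans (le_of_eq ?_)
  rw [mul_pow, ← ENNReal.rpow_natCast, ← ENNReal.rpow_natCast, ← ENNReal.rpow_mul,
    ← ENNReal.rpow_mul]
  norm_num
  congr 1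
  · refine setLIntegral_congr_fun measurableSet_Ioi fun s hs => ?_
    have hs0 : (0 : ℝ) < s := lt_trans one_pos hs
    rw [← ENNReal.ofReal_pow (by positivity), ← Real.rpow_natCast, ← Real.rpow_mul hs0.le]
    norm_num
  · refine setLIntegral_congr_fun measurableSet_Ioi fun s hs => ?_
    have hs0 : (0 : ℝ) < s := lt_trans one_pos hs
    rw [ENNReal.ofReal_mul (by positivity), mul_pow, ← ENNReal.ofReal_pow (by positivity),
      ← Real.rpow_natCast, ← Real.rpow_mul hs0.le,
      ← Real.enorm_of_nonneg (by positivity : 0 ≤ ‖s • x‖ ^ (-a) * ‖fderiv ℝ φ (s • x)‖),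
      enorm_mul, enorm_norm]
    norm_num

theorem hardy [Nontrivial E] {a : ℝ} (ha : 2 * a + 2 < Module.finrank ℝ E) :
    ∃ C : ℝ≥0∞, C ≠ ⊤ ∧ ∀ φ : E → ℝ, ContDiff ℝ 1 φ → HasCompactSupport φ →
      eLpNorm (fun x => ‖x‖ ^ (-a - 1) * φ x) 2 volume ≤
        C * eLpNorm (fun x => ‖x‖ ^ (-a) * ‖fderiv ℝ φ x‖) 2 volume := by
  set d : ℝ := (Module.finrank ℝ E : ℝ) with hd
  -- Convergence of the integral of s^{-1-α} at infinity needs α > 0, and that of s^{1+α+2a-d} needs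
  -- α < d - 2 - 2a. The midpoint serves both.
  set α : ℝ := (d - 2 - 2 * a) / 2 with hα
  have hα0 : 0 < α := by rw [hα]; linarith
  have fin : ∀ β : ℝ, β < -1 → ∫⁻ s in Set.Ioi (1 : ℝ), ENNReal.ofReal (s ^ β) ≠ ⊤ := by
    intro β hβ
    have := (integrableOn_Ioi_rpow_of_lt hβ one_pos).2
    rw [hasFiniteIntegral_iff_ofReal] at this
    · exact this.ne
    · exact (ae_restrict_iff' measurableSet_Ioi).2 (Eventually.of_forall fun s hs =>
        Real.rpow_nonneg (zero_le_one.trans (le_of_lt hs)) _)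
  set c1 := ∫⁻ s in Set.Ioi (1 : ℝ), ENNReal.ofReal (s ^ (-1 - α))
  set c2 := ∫⁻ s in Set.Ioi (1 : ℝ), ENNReal.ofReal (s ^ (1 + α + 2 * a - d))
  have hc1 : c1 ≠ ⊤ := fin _ (by linarith)
  have hc2 : c2 ≠ ⊤ := fin _ (by rw [hα]; linarith)
  refine ⟨(c1 * c2) ^ (1 / 2 : ℝ), by finiteness, fun φ hφ hc => ?_⟩
  set G : E → ℝ≥0∞ := fun x => ‖‖x‖ ^ (-a) * ‖fderiv ℝ φ x‖‖ₑ ^ 2 with hG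
  have hGm : Measurable G := by
    have := (hφ.continuous_fderiv one_ne_zero).norm.measurable
    fun_prop
  have sq : eLpNorm (fun x => ‖x‖ ^ (-a - 1) * φ x) 2 volume ^ 2 ≤
      c1 * c2 * eLpNorm (fun x => ‖x‖ ^ (-a) * ‖fderiv ℝ φ x‖) 2 volume ^ 2 := by
    rw [eLpNorm_two_sq, eLpNorm_two_sq]
    calc ∫⁻ x, ‖‖x‖ ^ (-a - 1) * φ x‖ₑ ^ 2
        ≤ ∫⁻ x, c1 * ∫⁻ s in Set.Ioi (1 : ℝ), ENNReal.ofReal (s ^ (1 + α + 2 * a)) * G (s • x) := by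
          refine lintegral_mono_ae ?_
          filter_upwards [compl_mem_ae_iff.2 (measure_singleton (0 : E))] with x hx
          exact hardy_pointwise_sq hφ hc hx
      -- Tonelli; the inner integral over x then scales by s^{-d}.
      _ = c1 * ∫⁻ s in Set.Ioi (1 : ℝ),
            ∫⁻ x, ENNReal.ofReal (s ^ (1 + α + 2 * a)) * G (s • x) := by
          rw [lintegral_const_mul' _ _ hc1, lintegral_lintegral_swap]
          have : Measurable (fun q : E × ℝ => G (q.2 • q.1)) := hGm.comp (by fun_prop)
          fun_prop
      _ = c1 * ∫⁻ s in Set.Ioi (1 : ℝ), ENNReal.ofReal (s ^ (1 + α + 2 * a - d)) * ∫⁻ x, G x := by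
          congr 1
          refine setLIntegral_congr_fun measurableSet_Ioi fun s hs => ?_
          have hs0 : (0 : ℝ) < s := lt_trans one_pos hs
          rw [lintegral_const_mul' _ _ ENNReal.ofReal_ne_top, lintegral_comp_pos_smul _ hs0,
            ← mul_assoc, ← ENNReal.ofReal_mul (by positivity), ← Real.rpow_add hs0]
          rfl
      _ = c1 * c2 * ∫⁻ x, G x := by
          rw [lintegral_mul_const _ (by fun_prop), mul_assoc]
  have := ENNReal.rpow_le_rpow sq (z := 1 / 2) (by norm_num)
  rw [ENNReal.mul_rpow_of_nonneg _ _ (by norm_num), ← ENNReal.rpow_natCast, ← ENNReal.rpow_natCast,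
    ← ENNReal.rpow_mul, ← ENNReal.rpow_mul] at this
  norm_num at this ⊢
  exact this

end Hardy

/-! ### Powers of the norm and cutoffs at the origin -/

section OriginCutoff

set_option linter.unusedSectionVars false

variable {E : Type*} [NormedAddCommGroup E] [InnerProductSpace ℝ E]

theorem hasFDerivAt_norm_rpow_of_ne_zero (s : ℝ) {x : E} (hx : x ≠ 0) :
    HasFDerivAt (fun y : E => ‖y‖ ^ s) ((s * ‖x‖ ^ (s - 2)) • innerSL ℝ x) x := by
  have hx' : 0 < ‖x‖ := norm_pos_iff.2 hx
  have h1 : HasFDerivAt (fun y : E => ‖y‖ ^ 2) ((2 : ℕ) • innerSL ℝ x) x :=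
    (hasStrictFDerivAt_norm_sq x).hasFDerivAt
  have h2 := h1.rpow_const (p := s / 2) (Or.inl (by positivity))
  have e : (fun y : E => (‖y‖ ^ 2) ^ (s / 2)) = fun y => ‖y‖ ^ s := by
    ext y
    rw [← Real.rpow_natCast, ← Real.rpow_mul (norm_nonneg y)]
    congr 1
    push_cast
    ring
  rw [e] at h2
  convert h2 using 1
  rw [← Real.rpow_natCast, ← Real.rpow_mul hx'.le, ← Nat.cast_smul_eq_nsmul ℝ, smul_smul]
  congr 1
  push_cast
  rw [show (2 : ℝ) * (s / 2 - 1) = s - 2 by ring]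
  ring

theorem norm_fderiv_norm_rpow_le_of_ne_zero (s : ℝ) {x : E} (hx : x ≠ 0) :
    ‖fderiv ℝ (fun y : E => ‖y‖ ^ s) x‖ ≤ |s| * ‖x‖ ^ (s - 1) := by
  have hx' : 0 < ‖x‖ := norm_pos_iff.2 hx
  rw [(hasFDerivAt_norm_rpow_of_ne_zero s hx).fderiv, norm_smul, innerSL_apply_norm, norm_mul,
    Real.norm_of_nonneg (by positivity : 0 ≤ ‖x‖ ^ (s - 2)), mul_assoc, Real.norm_eq_abs]
  gcongr
  nth_rewrite 2 [← Real.rpow_one ‖x‖]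
  rw [← Real.rpow_add hx']
  ring_nf
  rfl

theorem contDiffAt_norm_rpow (s : ℝ) {x : E} (hx : x ≠ 0) {n : WithTop ℕ∞} :
    ContDiffAt ℝ n (fun y : E => ‖y‖ ^ s) x :=
  (contDiffAt_norm ℝ hx).rpow_const_of_ne (norm_ne_zero_iff.2 hx)

/-- A smooth function that vanishes on the ball of radius `ε` about the origin and is equal to `1`
outside the ball of radius `2 * ε`. -/
def originCutoff (ε : ℝ) (x : E) : ℝ := Real.smoothTransition (‖x‖ ^ 2 / ε ^ 2 - 1)

theorem contDiff_originCutoff (ε : ℝ) {n : ℕ∞} : ContDiff ℝ n (originCutoff ε : E → ℝ) :=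
  Real.smoothTransition.contDiff.comp (((contDiff_norm_sq ℝ).div_const _).sub contDiff_const)

theorem originCutoff_nonneg (ε : ℝ) (x : E) : 0 ≤ originCutoff ε x :=
  Real.smoothTransition.nonneg _

theorem originCutoff_le_one (ε : ℝ) (x : E) : originCutoff ε x ≤ 1 :=
  Real.smoothTransition.le_one _

theorem originCutoff_eq_zero {ε : ℝ} (hε : 0 < ε) {x : E} (hx : ‖x‖ ≤ ε) :
    originCutoff ε x = 0 := by
  refine Real.smoothTransition.zero_of_nonpos ?_
  rw [sub_nonpos, div_le_one (by positivity)]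
  gcongr

theorem originCutoff_eq_one {ε : ℝ} (hε : 0 < ε) {x : E} (hx : 2 * ε ≤ ‖x‖) :
    originCutoff ε x = 1 := by
  refine Real.smoothTransition.one_of_one_le ?_
  rw [le_sub_iff_add_le, le_div_iff₀ (by positivity)]
  nlinarith [norm_nonneg x]

theorem zero_notMem_tsupport_originCutoff {ε : ℝ} (hε : 0 < ε) :
    (0 : E) ∉ tsupport (originCutoff ε : E → ℝ) := by
  rw [notMem_tsupport_iff_eventuallyEq]
  filter_upwards [Metric.ball_mem_nhds (0 : E) hε] with x hx
  exact originCutoff_eq_zero hε (by simpa using (mem_ball_zero_iff.1 hx).le)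

theorem tendsto_originCutoff {x : E} (hx : x ≠ 0) {ε : ℕ → ℝ} (hε : ∀ n, 0 < ε n)
    (h0 : Tendsto ε atTop (𝓝 0)) : ∀ᶠ n in atTop, originCutoff (ε n) x = 1 := by
  have hx' : 0 < ‖x‖ / 2 := by
    have := norm_pos_iff.2 hx
    positivity
  filter_upwards [h0.eventually (gt_mem_nhds hx')] with n hn
  exact originCutoff_eq_one (hε n) (by linarith)

theorem exists_norm_deriv_smoothTransition_le :
    ∃ C : ℝ, 0 ≤ C ∧ ∀ s, ‖deriv Real.smoothTransition s‖ ≤ C := by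
  have hcd : ContDiff ℝ 1 Real.smoothTransition := Real.smoothTransition.contDiff (n := 1)
  have hc : Continuous (deriv Real.smoothTransition) := hcd.continuous_deriv le_rfl
  have hs : HasCompactSupport (deriv Real.smoothTransition) := by
    refine HasCompactSupport.of_support_subset_isCompact (isCompact_Icc (a := (0 : ℝ)) (b := 1)) ?_
    intro s hs
    by_contra h
    rw [Set.mem_Icc, not_and_or, not_le, not_le] at h
    refine hs ?_
    rcases h with h | h
    · have : Real.smoothTransition =ᶠ[𝓝 s] fun _ => 0 := by
        filter_upwards [gt_mem_nhds h] with y hy using Real.smoothTransition.zero_of_nonpos hy.le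
      simpa using this.deriv_eq
    · have : Real.smoothTransition =ᶠ[𝓝 s] fun _ => 1 := by
        filter_upwards [lt_mem_nhds h] with y hy using Real.smoothTransition.one_of_one_le hy.le
      simpa using this.deriv_eq
  obtain ⟨C, hC⟩ := hs.exists_bound_of_continuous hc
  exact ⟨C, (norm_nonneg _).trans (hC 0), hC⟩

theorem deriv_smoothTransition_eq_zero {s : ℝ} (hs : 1 ≤ s) :
    deriv Real.smoothTransition s = 0 := by
  have hcd : ContDiff ℝ 1 Real.smoothTransition := Real.smoothTransition.contDiff (n := 1)
  have : IsLocalMax Real.smoothTransition s := by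
    refine Eventually.of_forall fun y => ?_
    rw [Real.smoothTransition.one_of_one_le hs]
    exact Real.smoothTransition.le_one y
  exact this.deriv_eq_zero

/-- The quantity is scale invariant: the gradient is at most a constant times |x| / ε², and it
vanishes unless |x|² ≤ 2 ε². The bound is uniform in ε, which is what allows the origin to be
removed in the limit. -/
theorem exists_norm_fderiv_originCutoff_le (E : Type*) [NormedAddCommGroup E]
    [InnerProductSpace ℝ E] :
    ∃ C : ℝ, 0 ≤ C ∧ ∀ ε : ℝ, 0 < ε → ∀ x : E, ‖fderiv ℝ (originCutoff ε) x‖ * ‖x‖ ≤ C := by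
  obtain ⟨C, hC0, hC⟩ := exists_norm_deriv_smoothTransition_le
  refine ⟨4 * C, by positivity, fun ε hε x => ?_⟩
  have hcd : ContDiff ℝ 1 Real.smoothTransition := Real.smoothTransition.contDiff (n := 1)
  have h1 : HasFDerivAt (fun y : E => ‖y‖ ^ 2 / ε ^ 2 - 1)
      ((ε ^ 2)⁻¹ • ((2 : ℕ) • innerSL ℝ x)) x := by
    have := ((hasStrictFDerivAt_norm_sq x).hasFDerivAt.const_smul ((ε ^ 2)⁻¹)).sub_const 1
    refine this.congr_of_eventuallyEq (Eventually.of_forall fun y => ?_)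
    simp [div_eq_inv_mul]
  have h2 := ((hcd.differentiable one_ne_zero (‖x‖ ^ 2 / ε ^ 2 - 1)).hasDerivAt).comp_hasFDerivAt x h1
  have h3 : fderiv ℝ (originCutoff ε) x = deriv Real.smoothTransition (‖x‖ ^ 2 / ε ^ 2 - 1) •
      ((ε ^ 2)⁻¹ • ((2 : ℕ) • innerSL ℝ x)) := h2.fderiv
  rw [h3, norm_smul, norm_smul, ← Nat.cast_smul_eq_nsmul ℝ, norm_smul, innerSL_apply_norm,
    Real.norm_of_nonneg (by positivity : 0 ≤ (ε ^ 2)⁻¹)]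
  by_cases h : 1 ≤ ‖x‖ ^ 2 / ε ^ 2 - 1
  · rw [deriv_smoothTransition_eq_zero h]
    simp
    positivity
  · have h' : ‖x‖ ^ 2 / ε ^ 2 ≤ 2 := by linarith
    have : ‖deriv Real.smoothTransition (‖x‖ ^ 2 / ε ^ 2 - 1)‖ *
      ((ε ^ 2)⁻¹ * (‖((2 : ℕ) : ℝ)‖ * ‖x‖)) * ‖x‖ =
      ‖deriv Real.smoothTransition (‖x‖ ^ 2 / ε ^ 2 - 1)‖ * (2 * (‖x‖ ^ 2 / ε ^ 2)) := by
      norm_num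
      ring
    rw [this]
    have := mul_le_mul (hC (‖x‖ ^ 2 / ε ^ 2 - 1))
      (by linarith : 2 * (‖x‖ ^ 2 / ε ^ 2) ≤ 4) (by positivity) hC0
    linarith

end OriginCutoff

/-! ### The Caffarelli-Kohn-Nirenberg inequality -/

section CaffarelliKohnNirenberg

set_option linter.unusedSectionVars false

variable {E : Type*} [NormedAddCommGroup E] [InnerProductSpace ℝ E] [FiniteDimensional ℝ E]
  [MeasurableSpace E] [BorelSpace E]

theorem contDiff_norm_rpow_mul (s : ℝ) {n : WithTop ℕ∞} {φ : E → ℝ} (hφ : ContDiff ℝ n φ)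
    (h0 : (0 : E) ∉ tsupport φ) : ContDiff ℝ n (fun x => ‖x‖ ^ s * φ x) := by
  rw [contDiff_iff_contDiffAt]
  intro x
  by_cases hx : x = 0
  · subst hx
    rw [notMem_tsupport_iff_eventuallyEq] at h0
    refine (contDiffAt_const (c := (0 : ℝ))).congr_of_eventuallyEq ?_
    filter_upwards [h0] with y hy
    simp [hy]
  · exact (contDiffAt_norm_rpow s hx).mul hφ.contDiffAt

theorem measurable_norm_rpow (s : ℝ) : Measurable (fun x : E => ‖x‖ ^ s) := by fun_prop

/-- Apply the unweighted Sobolev inequality to |x|^{-a} φ, which is C¹ because φ vanishes near 0.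
The extra term |x|^{-a-1} φ of the product rule is controlled by Hardy. -/
theorem sobolev_away [Nontrivial E] {a : ℝ} (ha : 2 * a + 2 < Module.finrank ℝ E)
    (hd : 3 ≤ Module.finrank ℝ E) {q : ℝ}
    (hq : q = 2 * Module.finrank ℝ E / (Module.finrank ℝ E - 2)) :
    ∃ C : ℝ≥0∞, C ≠ ⊤ ∧ ∀ φ : E → ℝ, ContDiff ℝ 1 φ → HasCompactSupport φ → (0 : E) ∉ tsupport φ →
      eLpNorm (fun x => ‖x‖ ^ (-a) * φ x) (ENNReal.ofReal q) volume ≤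
        C * eLpNorm (fun x => ‖x‖ ^ (-a) * ‖fderiv ℝ φ x‖) 2 volume := by
  obtain ⟨C, hC, hardy⟩ := hardy (E := E) ha
  have hd' : (3 : ℝ) ≤ Module.finrank ℝ E := by exact_mod_cast hd
  have hq0 : 0 < q := by
    rw [hq]
    apply div_pos <;> linarith
  set S : NNReal := SNormLESNormFDerivOfEqConst ℝ (volume : Measure E) 2
  refine ⟨S * (1 + ENNReal.ofReal |a| * C), by finiteness, fun φ hφ hc h0 => ?_⟩
  have hv := contDiff_norm_rpow_mul (-a) hφ h0
  have hvc : HasCompactSupport (fun x => ‖x‖ ^ (-a) * φ x) := hc.mul_left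
  have gns := eLpNorm_le_eLpNorm_fderiv_of_eq (volume : Measure E) hv hvc (p := 2)
    (p' := q.toNNReal) (by norm_num) (by omega) (by
      rw [Real.coe_toNNReal _ hq0.le, hq]
      have : (Module.finrank ℝ E : ℝ) - 2 ≠ 0 := by linarith
      have : (Module.finrank ℝ E : ℝ) ≠ 0 := by linarith
      push_cast
      field_simp)
  simp only [ENNReal.coe_ofNat] at gns
  refine gns.trans ?_
  rw [mul_assoc]
  refine mul_le_mul' le_rfl ?_
  have hm : AEStronglyMeasurable (fun x => ‖x‖ ^ (-a) * ‖fderiv ℝ φ x‖) (volume : Measure E) :=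
    ((measurable_norm_rpow _).mul
      (hφ.continuous_fderiv one_ne_zero).norm.measurable).aestronglyMeasurable
  have hm2 : AEStronglyMeasurable (fun x => ‖x‖ ^ (-a - 1) * φ x) (volume : Measure E) :=
    ((measurable_norm_rpow _).mul hφ.continuous.measurable).aestronglyMeasurable
  have pt : ∀ x, ‖fderiv ℝ (fun x => ‖x‖ ^ (-a) * φ x) x‖ ≤
      ‖‖x‖ ^ (-a) * ‖fderiv ℝ φ x‖ + |a| * |‖x‖ ^ (-a - 1) * φ x|‖ := by
    intro x
    by_cases hx : x = 0
    · subst hx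
      rw [notMem_tsupport_iff_eventuallyEq] at h0
      have : (fun x => ‖x‖ ^ (-a) * φ x) =ᶠ[𝓝 0] fun _ => 0 := by
        filter_upwards [h0] with y hy
        simp [hy]
      rw [this.fderiv_eq]
      simp
    · rw [fderiv_fun_mul ((contDiffAt_norm_rpow (n := 1) (-a) hx).differentiableAt one_ne_zero)
        (hφ.differentiable one_ne_zero x)]
      rw [Real.norm_of_nonneg (by positivity)]
      refine (norm_add_le _ _).trans ?_
      rw [norm_smul, norm_smul, Real.norm_of_nonneg (by positivity), abs_mul,
        abs_of_nonneg (by positivity : 0 ≤ ‖x‖ ^ (-a - 1)), Real.norm_eq_abs]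
      have := mul_le_mul_of_nonneg_left (norm_fderiv_norm_rpow_le_of_ne_zero (-a) hx) (abs_nonneg (φ x))
      rw [abs_neg] at this
      linarith
  refine (eLpNorm_mono pt).trans ((eLpNorm_add_le hm (hm2.norm.const_mul _)
    (one_le_two : (1 : ℝ≥0∞) ≤ 2)).trans ?_)
  rw [add_mul, one_mul]
  gcongr
  change eLpNorm (fun x => |a| * ‖‖x‖ ^ (-a - 1) * φ x‖) 2 volume ≤ _
  have := eLpNorm_const_smul (|a|) (fun x : E => ‖‖x‖ ^ (-a - 1) * φ x‖) 2 volume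
  simp only [Pi.smul_def, smul_eq_mul] at this
  rw [this, eLpNorm_norm, mul_assoc]
  gcongr
  · rw [Real.enorm_of_nonneg (abs_nonneg a)]
  · exact hardy φ hφ hc

theorem rpow_interpolation {a b p q θ r c : ℝ} (hr : 0 < r) (hc : 0 < c)
    (h1 : q * θ + 2 * (1 - θ) = p) (h2 : b * p = a * (q * θ) + 2 * (a + 1) * (1 - θ)) :
    (r ^ (-b) * c) ^ p = ((r ^ (-a) * c) ^ q) ^ θ * ((r ^ (-a - 1) * c) ^ (2 : ℝ)) ^ (1 - θ) := by
  have pos : ∀ s : ℝ, 0 < r ^ s := fun s => Real.rpow_pos_of_pos hr s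
  rw [← Real.rpow_mul (mul_pos (pos _) hc).le, ← Real.rpow_mul (mul_pos (pos _) hc).le,
    Real.mul_rpow (pos _).le hc.le, Real.mul_rpow (pos _).le hc.le,
    Real.mul_rpow (pos _).le hc.le, ← Real.rpow_mul hr.le, ← Real.rpow_mul hr.le,
    ← Real.rpow_mul hr.le]
  rw [show ∀ A B C D : ℝ, A * B * (C * D) = (A * C) * (B * D) by intros; ring,
    ← Real.rpow_add hr, ← Real.rpow_add hc, h1]
  congr 2
  linarith

/-- By the two relations on θ the integrand on the left is the product of the θ-th power of the
Sobolev integrand and the (1-θ)-th power of the Hardy integrand. Hölder applies, and the powers of B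
add up to qθ + 2(1-θ) = p. -/
theorem eLpNorm_interpolation {a b p q θ : ℝ} (hθ0 : 0 < θ) (hθ1 : θ ≤ 1) (hp : 0 < p) (hq : 0 < q)
    (h1 : q * θ + 2 * (1 - θ) = p) (h2 : b * p = a * (q * θ) + 2 * (a + 1) * (1 - θ))
    {φ : E → ℝ} (hφ : Measurable φ) (h0 : φ 0 = 0) {B : ℝ≥0∞}
    (hS : eLpNorm (fun x => ‖x‖ ^ (-a) * φ x) (ENNReal.ofReal q) volume ≤ B)
    (hH : eLpNorm (fun x => ‖x‖ ^ (-a - 1) * φ x) 2 volume ≤ B) :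
    eLpNorm (fun x => ‖x‖ ^ (-b) * φ x) (ENNReal.ofReal p) volume ≤ B := by
  have hS' : ∫⁻ x, ‖‖x‖ ^ (-a) * φ x‖ₑ ^ q ≤ B ^ q := by
    rw [eLpNorm_eq_lintegral_rpow_enorm_toReal (by simpa using hq) (by simp),
      ENNReal.toReal_ofReal hq.le] at hS
    have := ENNReal.rpow_le_rpow hS hq.le
    rwa [← ENNReal.rpow_mul, one_div_mul_cancel hq.ne', ENNReal.rpow_one] at this
  have hH' : ∫⁻ x, ‖‖x‖ ^ (-a - 1) * φ x‖ₑ ^ (2 : ℝ) ≤ B ^ (2 : ℝ) := by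
    have := pow_le_pow_left₀ (zero_le) hH 2
    rw [eLpNorm_two_sq] at this
    simpa using this
  have hp' : ∫⁻ x, ‖‖x‖ ^ (-b) * φ x‖ₑ ^ p ≤ B ^ p := by
    have : ∀ x : E, ‖‖x‖ ^ (-b) * φ x‖ₑ ^ p =
        (‖‖x‖ ^ (-a) * φ x‖ₑ ^ q) ^ θ * (‖‖x‖ ^ (-a - 1) * φ x‖ₑ ^ (2 : ℝ)) ^ (1 - θ) := by
      intro x
      by_cases hx : φ x = 0
      · simp only [hx, mul_zero, enorm_zero]
        rw [ENNReal.zero_rpow_of_pos hp, ENNReal.zero_rpow_of_pos hq, ENNReal.zero_rpow_of_pos hθ0,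
          zero_mul]
      · have hx0 : x ≠ 0 := fun h => hx (h ▸ h0)
        have hr : 0 < ‖x‖ := norm_pos_iff.2 hx0
        have hc : 0 < |φ x| := abs_pos.2 hx
        have e : ∀ s : ℝ, ‖‖x‖ ^ s * φ x‖ₑ = ENNReal.ofReal (‖x‖ ^ s * |φ x|) := by
          intro s
          rw [← Real.enorm_of_nonneg (by positivity), enorm_mul, enorm_mul, ← Real.norm_eq_abs, enorm_norm]
        rw [e, e, e, ENNReal.ofReal_rpow_of_pos (by positivity),
          ENNReal.ofReal_rpow_of_pos (by positivity), ENNReal.ofReal_rpow_of_pos (by positivity),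
          ENNReal.ofReal_rpow_of_pos (by positivity), ENNReal.ofReal_rpow_of_pos (by positivity),
          ← ENNReal.ofReal_mul (by positivity), rpow_interpolation hr hc h1 h2]
    simp_rw [this]
    refine (ENNReal.lintegral_mul_norm_pow_le (by fun_prop) (by fun_prop) hθ0.le
      (sub_nonneg.2 hθ1) (by ring)).trans ?_
    refine (mul_le_mul' (ENNReal.rpow_le_rpow hS' hθ0.le)
      (ENNReal.rpow_le_rpow hH' (sub_nonneg.2 hθ1))).trans (le_of_eq ?_)
    rw [← ENNReal.rpow_mul, ← ENNReal.rpow_mul, ← ENNReal.rpow_add_of_nonneg, h1]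
    · positivity
    · have := sub_nonneg.2 hθ1
      positivity
  rw [eLpNorm_eq_lintegral_rpow_enorm_toReal (by simpa using hp) (by simp),
    ENNReal.toReal_ofReal hp.le]
  have := ENNReal.rpow_le_rpow hp' (z := 1 / p) (by positivity)
  rwa [← ENNReal.rpow_mul, mul_one_div_cancel hp.ne', ENNReal.rpow_one] at this

theorem eLpNorm_le_of_tendsto_ae {p : ℝ≥0∞} {F : Type*} [NormedAddCommGroup F] {μ : Measure E}
    {f : ℕ → E → F} {g : E → F} {B : ℝ≥0∞} (hf : ∀ n, AEStronglyMeasurable (f n) μ)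
    (h : ∀ᵐ x ∂μ, Tendsto (fun n => f n x) atTop (𝓝 (g x))) (hB : ∀ n, eLpNorm (f n) p μ ≤ B) :
    eLpNorm g p μ ≤ B := by
  refine (Lp.eLpNorm_lim_le_liminf_eLpNorm hf g h).trans ?_
  exact liminf_le_of_le (by isBoundedDefault) fun b hb => by
    obtain ⟨n, hn⟩ := hb.exists
    exact hn.trans (hB n)

/-- Cut φ off near the origin. By Hardy and the scale invariant gradient bound the energy of the cut
function stays below a fixed multiple of the original. Interpolate between Sobolev and Hardy, then
let the cutoff radius tend to 0 with Fatou. -/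
theorem caffarelli_kohn_nirenberg [Nontrivial E] {a b p : ℝ} (ha : 2 * a + 2 < Module.finrank ℝ E)
    (hd : 3 ≤ Module.finrank ℝ E) (hab : a ≤ b) (hba : b < a + 1)
    (hp : p = 2 * Module.finrank ℝ E / (Module.finrank ℝ E - 2 * (1 + a - b))) :
    ∃ C : ℝ≥0∞, C ≠ ⊤ ∧ ∀ φ : E → ℝ, ContDiff ℝ 1 φ → HasCompactSupport φ →
      eLpNorm (fun x => ‖x‖ ^ (-b) * φ x) (ENNReal.ofReal p) volume ≤
        C * eLpNorm (fun x => ‖x‖ ^ (-a) * ‖fderiv ℝ φ x‖) 2 volume := by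
  set d : ℝ := (Module.finrank ℝ E : ℝ) with hdd
  have hd' : (3 : ℝ) ≤ d := by rw [hdd]; exact_mod_cast hd
  obtain ⟨C1, hC1, hardy⟩ := hardy (E := E) ha
  obtain ⟨C2, hC2, sob⟩ := sobolev_away (E := E) ha hd (q := 2 * d / (d - 2)) rfl
  obtain ⟨c, hc0, hcut⟩ := exists_norm_fderiv_originCutoff_le E
  set K : ℝ≥0∞ := 1 + ENNReal.ofReal c * C1
  have hq : 0 < 2 * d / (d - 2) := by apply div_pos <;> linarith
  have hs : 0 < d - 2 * (1 + a - b) := by linarith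
  have hs2 : 0 < d - 2 := by linarith
  have hp0 : 0 < p := by rw [hp]; apply div_pos <;> linarith
  refine ⟨(C1 + C2) * K, by finiteness, fun φ hφ hc => ?_⟩
  set A := eLpNorm (fun x => ‖x‖ ^ (-a) * ‖fderiv ℝ φ x‖) 2 volume with hA
  set ε : ℕ → ℝ := fun n => 1 / ((n : ℝ) + 1)
  have hε : ∀ n, 0 < ε n := fun n => by positivity
  have hε0 : Tendsto ε atTop (𝓝 0) := tendsto_one_div_add_atTop_nhds_zero_nat
  set ψ : ℕ → E → ℝ := fun n x => originCutoff (ε n) x * φ x with hψ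
  have hψd : ∀ n, ContDiff ℝ 1 (ψ n) := fun n => (contDiff_originCutoff (n := 1) (ε n)).mul hφ
  have hψc : ∀ n, HasCompactSupport (ψ n) := fun n => hc.mul_left
  have hψ0 : ∀ n, (0 : E) ∉ tsupport (ψ n) := fun n h =>
    zero_notMem_tsupport_originCutoff (hε n) (tsupport_mul_subset_left h)
  have energy : ∀ n, eLpNorm (fun x => ‖x‖ ^ (-a) * ‖fderiv ℝ (ψ n) x‖) 2 volume ≤ K * A := by
    intro n
    have hm : AEStronglyMeasurable (fun x => ‖x‖ ^ (-a) * ‖fderiv ℝ φ x‖) (volume : Measure E) :=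
      ((measurable_norm_rpow _).mul
        (hφ.continuous_fderiv one_ne_zero).norm.measurable).aestronglyMeasurable
    have hm2 : AEStronglyMeasurable (fun x => ‖x‖ ^ (-a - 1) * φ x) (volume : Measure E) :=
      ((measurable_norm_rpow _).mul hφ.continuous.measurable).aestronglyMeasurable
    have pt : ∀ᵐ x : E, ‖‖x‖ ^ (-a) * ‖fderiv ℝ (ψ n) x‖‖ ≤
        ‖‖x‖ ^ (-a) * ‖fderiv ℝ φ x‖ + c * |‖x‖ ^ (-a - 1) * φ x|‖ := by
      filter_upwards [compl_mem_ae_iff.2 (measure_singleton (0 : E))] with x hx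
      have hx' : 0 < ‖x‖ := norm_pos_iff.2 hx
      rw [fderiv_fun_mul ((contDiff_originCutoff (n := 1) (ε n)).differentiable one_ne_zero x)
        (hφ.differentiable one_ne_zero x), Real.norm_of_nonneg (by positivity),
        Real.norm_of_nonneg (by positivity), abs_mul,
        abs_of_nonneg (by positivity : 0 ≤ ‖x‖ ^ (-a - 1))]
      have e : ‖x‖ ^ (-a) = ‖x‖ ^ (-a - 1) * ‖x‖ := by
        nth_rewrite 3 [← Real.rpow_one ‖x‖]
        rw [← Real.rpow_add hx']
        ring_nf
      have t1 : ‖originCutoff (ε n) x • fderiv ℝ φ x‖ ≤ ‖fderiv ℝ φ x‖ := by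
        rw [norm_smul, Real.norm_of_nonneg (originCutoff_nonneg _ _)]
        exact mul_le_of_le_one_left (norm_nonneg _) (originCutoff_le_one _ _)
      have t2 : ‖x‖ ^ (-a) * ‖φ x • fderiv ℝ (originCutoff (ε n)) x‖ ≤
          c * (‖x‖ ^ (-a - 1) * |φ x|) := by
        rw [norm_smul, Real.norm_eq_abs, e]
        have := mul_le_mul_of_nonneg_left (hcut (ε n) (hε n) x)
          (by positivity : 0 ≤ ‖x‖ ^ (-a - 1) * |φ x|)
        linarith
      have t3 := mul_le_mul_of_nonneg_left
        ((norm_add_le (originCutoff (ε n) x • fderiv ℝ φ x)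
          (φ x • fderiv ℝ (originCutoff (ε n)) x)).trans (add_le_add_left t1 _))
        (by positivity : 0 ≤ ‖x‖ ^ (-a))
      rw [mul_add] at t3
      linarith
    refine (eLpNorm_mono_ae pt).trans
      ((eLpNorm_add_le hm (hm2.norm.const_mul _)
    (one_le_two : (1 : ℝ≥0∞) ≤ 2)).trans ?_)
    rw [add_mul, one_mul]
    gcongr
    change eLpNorm (fun x => c * ‖‖x‖ ^ (-a - 1) * φ x‖) 2 volume ≤ _
    have := eLpNorm_const_smul c (fun x : E => ‖‖x‖ ^ (-a - 1) * φ x‖) 2 volume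
    simp only [Pi.smul_def, smul_eq_mul] at this
    rw [this, eLpNorm_norm, mul_assoc]
    gcongr
    · rw [Real.enorm_of_nonneg hc0]
    · exact hardy φ hφ hc
  set s := 1 + a - b with hs'
  -- This is (p - 2) / (q - 2) for q = 2d / (d - 2). It is positive because b < a + 1, and at most 1
  -- because a ≤ b.
  set θ := s * (d - 2) / (d - 2 * s) with hθ
  have hspos : 0 < s := by linarith
  have hs1 : s ≤ 1 := by linarith
  refine eLpNorm_le_of_tendsto_ae (f := fun n x => ‖x‖ ^ (-b) * ψ n x)
    (fun n => ((measurable_norm_rpow _).mul (hψd n).continuous.measurable).aestronglyMeasurable)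
    ?_ fun n => ?_
  · filter_upwards [compl_mem_ae_iff.2 (measure_singleton (0 : E))] with x hx
    refine tendsto_const_nhds.congr' ?_
    filter_upwards [tendsto_originCutoff hx hε hε0] with n hn
    simp [hψ, hn]
  · refine eLpNorm_interpolation (a := a) (θ := θ) (by positivity) ?_ hp0 hq ?_ ?_
      (hψd n).continuous.measurable (image_eq_zero_of_notMem_tsupport (hψ0 n)) ?_ ?_
    · rw [hθ, div_le_one hs]
      nlinarith
    · rw [hθ, hp]
      field_simp
      ring
    · have hb : b = 1 + a - s := by rw [hs']; ring
      have hne : d - 2 * s ≠ 0 := hs.ne'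
      have e : 1 - θ = d * (1 - s) / (d - 2 * s) := by
        rw [hθ, eq_div_iff hne, sub_mul, div_mul_cancel₀ _ hne]
        ring
      have e2 : 2 * d / (d - 2) * θ = 2 * d * s / (d - 2 * s) := by
        rw [hθ]
        field_simp
      rw [e, e2, hp, hb]
      ring
    · refine (sob _ (hψd n) (hψc n) (hψ0 n)).trans ?_
      rw [mul_assoc]
      exact mul_le_mul' le_add_self (energy n)
    · refine (hardy _ (hψd n) (hψc n)).trans ?_
      rw [mul_assoc]
      exact mul_le_mul' le_self_add (energy n)

end CaffarelliKohnNirenberg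

/-! ### Hölder pairings and their limits -/

section HolderLimits

variable {α F : Type*} [MeasurableSpace α] {μ : Measure α} [NormedAddCommGroup F]
  [InnerProductSpace ℝ F]

theorem integrable_inner_of_memLp {p q : ℝ≥0∞} [ENNReal.HolderTriple p q 1] {f g : α → F}
    (hf : MemLp f p μ) (hg : MemLp g q μ) : Integrable (fun x => inner ℝ (f x) (g x)) μ := by
  rw [← memLp_one_iff_integrable]
  refine MemLp.of_bilin (p := p) (q := q) (fun y z => inner ℝ y z) 1 hf hg (hf.1.inner hg.1)
    (Eventually.of_forall fun x => ?_)
  rw [one_mul]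
  exact nnnorm_inner_le_nnnorm _ _

theorem tendsto_integral_inner {p q : ℝ≥0∞} [ENNReal.HolderTriple p q 1] {f g : α → F}
    {G : ℕ → α → F} (hf : MemLp f p μ) (hg : MemLp g q μ) (hG : ∀ n, MemLp (G n) q μ)
    (h : Tendsto (fun n => eLpNorm (fun x => G n x - g x) q μ) atTop (𝓝 0)) :
    Tendsto (fun n => ∫ x, inner ℝ (f x) (G n x) ∂μ) atTop (𝓝 (∫ x, inner ℝ (f x) (g x) ∂μ)) := by
  refine tendsto_integral_of_L1' _ (hf.1.inner hg.1)
    (Eventually.of_forall fun n => integrable_inner_of_memLp (p := p) (q := q) hf (hG n)) ?_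
  have h1 : Tendsto (fun n => 1 * eLpNorm f p μ * eLpNorm (fun x => G n x - g x) q μ)
      atTop (𝓝 0) := by
    rw [← mul_zero (1 * eLpNorm f p μ)]
    refine ENNReal.Tendsto.const_mul h (Or.inr ?_)
    rw [one_mul]
    exact hf.2.ne
  refine tendsto_of_tendsto_of_tendsto_of_le_of_le tendsto_const_nhds h1 (fun _ => zero_le) ?_
  intro n
  have e : (fun x => inner ℝ (f x) (G n x)) - (fun x => inner ℝ (f x) (g x)) =
      fun x => inner ℝ (f x) (G n x - g x) := by
    ext x
    simp [inner_sub_right]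
  simp only
  rw [e]
  exact eLpNorm_le_eLpNorm_mul_eLpNorm'_of_norm (p := p) (q := q) hf.1 ((hG n).1.sub hg.1)
    (fun y z => inner ℝ y z) 1 (Eventually.of_forall fun x => by
      simpa using norm_inner_le_norm (𝕜 := ℝ) (f x) (G n x - g x))

end HolderLimits

theorem eLpNorm_le_of_tendsto_ae_of_tendsto {α F : Type*} [MeasurableSpace α] {μ : Measure α}
    [NormedAddCommGroup F] {p : ℝ≥0∞} {f : ℕ → α → F} {g : α → F} {B : ℕ → ℝ≥0∞} {b : ℝ≥0∞}
    (hf : ∀ n, AEStronglyMeasurable (f n) μ)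
    (h : ∀ᵐ x ∂μ, Tendsto (fun n => f n x) atTop (𝓝 (g x)))
    (hB : ∀ n, eLpNorm (f n) p μ ≤ B n) (hb : Tendsto B atTop (𝓝 b)) : eLpNorm g p μ ≤ b := by
  refine (Lp.eLpNorm_lim_le_liminf_eLpNorm hf g h).trans ?_
  rw [← hb.liminf_eq]
  exact liminf_le_liminf (Eventually.of_forall hB)

/-- The parameters of the Caffarelli-Kohn-Nirenberg inequality. -/
structure CKNParams (N : ℕ) (a b p : ℝ) : Prop where
  three_le : 3 ≤ N
  lt : 2 * a + 2 < N
  le : a ≤ b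
  lt_add_one : b < a + 1
  eq : p = 2 * N / (N - 2 * (1 + a - b))

theorem CKNParams.two_lt {N : ℕ} {a b p : ℝ} (h : CKNParams N a b p) : 2 < p := by
  have h1 : (3 : ℝ) ≤ N := by exact_mod_cast h.three_le
  have h2 := h.le
  have h3 := h.lt_add_one
  rw [h.eq, lt_div_iff₀ (by linarith)]
  linarith

/-! ### Limits of test functions in the weighted energy norm -/

section MemD12On

variable {N : ℕ}

/-- `v`, with gradient `h`, is a limit of test functions supported in `Ω`, with respect to the norm
of `𝒟^{1,2}_a`. -/
structure MemD12On (Ω : Set (EuclideanSpace ℝ (Fin N))) (a : ℝ) (v : EuclideanSpace ℝ (Fin N) → ℝ)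
    (h : EuclideanSpace ℝ (Fin N) → EuclideanSpace ℝ (Fin N))
    (ψ : ℕ → EuclideanSpace ℝ (Fin N) → ℝ) : Prop where
  measurable_gradient : AEStronglyMeasurable h volume
  contDiff : ∀ n, ContDiff ℝ ∞ (ψ n)
  hasCompactSupport : ∀ n, HasCompactSupport (ψ n)
  tsupport_subset : ∀ n, tsupport (ψ n) ⊆ Ω
  tendsto_ae : ∀ᵐ x, Tendsto (fun n => ψ n x) atTop (𝓝 (v x))
  tendsto_gradient : Tendsto (fun n => eLpNorm (fun x => ‖x‖ ^ (-a) • (gradient (ψ n) x - h x)) 2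
    volume) atTop (𝓝 0)

theorem MemD12.exists_memD12On {a : ℝ} {u : EuclideanSpace ℝ (Fin N) → ℝ}
    {g : EuclideanSpace ℝ (Fin N) → EuclideanSpace ℝ (Fin N)} (h : MemD12 a u g) :
    ∃ φ, MemD12On Set.univ a u g φ := by
  obtain ⟨φ, h1, h2, h3⟩ := h.exists_approx
  refine ⟨φ, h.aestronglyMeasurable_gradient, fun n => (h1 n).1, fun n => (h1 n).2,
    fun n => Set.subset_univ _, h2, ?_⟩
  have e : ∀ n, eLpNorm (fun x => ‖x‖ ^ (-a) • (gradient (φ n) x - g x)) 2 volume =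
      (∫⁻ x, ENNReal.ofReal (‖x‖ ^ (-2 * a) * ‖gradient (φ n) x - g x‖ ^ 2)) ^ (1 / 2 : ℝ) := by
    intro n
    have := eLpNorm_two_sq volume (fun x => ‖x‖ ^ (-a) • (gradient (φ n) x - g x))
    have e2 : ∀ x, ‖‖x‖ ^ (-a) • (gradient (φ n) x - g x)‖ₑ ^ 2 =
        ENNReal.ofReal (‖x‖ ^ (-2 * a) * ‖gradient (φ n) x - g x‖ ^ 2) := by
      intro x
      rw [← ofReal_norm, ← ENNReal.ofReal_pow (norm_nonneg _), norm_smul, mul_pow,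
        Real.norm_of_nonneg (by positivity), ← Real.rpow_natCast, ← Real.rpow_mul (norm_nonneg x)]
      congr 3
      push_cast
      ring
    simp_rw [e2] at this
    rw [← this, ← ENNReal.rpow_natCast, ← ENNReal.rpow_mul]
    norm_num
  simp_rw [e]
  have := h3.ennrpow_const (1 / 2)
  rwa [ENNReal.zero_rpow_of_pos (by norm_num)] at this

theorem memLp_norm_rpow_smul_of_continuous {a : ℝ} {F : Type*} [NormedAddCommGroup F]
    [NormedSpace ℝ F] (hN : 0 < N) (ha : 2 * a < N) {f : EuclideanSpace ℝ (Fin N) → F}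
    (hf : Continuous f) (hc : HasCompactSupport f) : MemLp (fun x => ‖x‖ ^ (-a) • f x) 2 volume := by
  have : Nonempty (Fin N) := ⟨⟨0, hN⟩⟩
  obtain ⟨C, hC⟩ := hc.exists_bound_of_continuous hf
  obtain ⟨R, hR0, hR⟩ := hc.isCompact.isBounded.subset_ball_lt 0 0
  -- In polar coordinates the density is r^{N-1-2a}, integrable at 0 because 2a < N.
  have hint : IntegrableOn (fun x : EuclideanSpace ℝ (Fin N) => ‖x‖ ^ (-(2 * a)))
      (Metric.ball 0 R) volume := by
    have := integrableOn_fun_norm_addHaar (E := EuclideanSpace ℝ (Fin N)) volume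
      (f := fun r : ℝ => r ^ (-(2 * a))) (r := R)
    rw [this, finrank_euclideanSpace, Fintype.card_fin]
    have h1 := (intervalIntegral.intervalIntegrable_rpow' (a := 0) (b := R)
      (r := (N : ℝ) - 1 - 2 * a) (by linarith))
    rw [intervalIntegrable_iff_integrableOn_Ioo_of_le hR0.le] at h1
    refine h1.congr_fun (fun y hy => ?_) measurableSet_Ioo
    simp only [smul_eq_mul]
    rw [← Real.rpow_natCast, ← Real.rpow_add hy.1, Nat.cast_sub hN]
    congr 1
    push_cast
    ring
  have hm : AEStronglyMeasurable (fun x => ‖x‖ ^ (-a) • f x) volume := by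
    exact (measurable_norm_rpow (-a)).aestronglyMeasurable.smul hf.aestronglyMeasurable
  rw [memLp_two_iff_integrable_sq_norm hm]
  have h2 : IntegrableOn (fun x => ‖‖x‖ ^ (-a) • f x‖ ^ 2) (Metric.ball 0 R) volume := by
    refine (hint.mul_const (C ^ 2)).mono' (hm.norm.pow 2).restrict
      (Eventually.of_forall fun x => ?_)
    rw [norm_pow, norm_norm, norm_smul, mul_pow,
      Real.norm_of_nonneg (by positivity : 0 ≤ ‖x‖ ^ (-a)),
      ← Real.rpow_natCast, ← Real.rpow_mul (norm_nonneg x)]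
    have := hC x
    rw [show -a * ((2 : ℕ) : ℝ) = -(2 * a) by push_cast; ring]
    gcongr
  refine (integrableOn_iff_integrable_of_support_subset ?_).1 h2
  intro x hx
  refine hR (subset_tsupport _ ?_)
  intro h0
  exact hx (by simp [h0])

variable {Ω : Set (EuclideanSpace ℝ (Fin N))} {a b p : ℝ} {v : EuclideanSpace ℝ (Fin N) → ℝ}
  {h : EuclideanSpace ℝ (Fin N) → EuclideanSpace ℝ (Fin N)}
  {ψ : ℕ → EuclideanSpace ℝ (Fin N) → ℝ}

theorem continuous_gradient {φ : EuclideanSpace ℝ (Fin N) → ℝ} (hφ : ContDiff ℝ 1 φ) :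
    Continuous (gradient φ) :=
  (LinearIsometryEquiv.continuous _).comp (hφ.continuous_fderiv one_ne_zero)

theorem hasCompactSupport_gradient {φ : EuclideanSpace ℝ (Fin N) → ℝ} (hφ : HasCompactSupport φ) :
    HasCompactSupport (gradient φ) :=
  (hφ.fderiv (𝕜 := ℝ)).comp_left (map_zero _)

theorem tsupport_gradient_subset (φ : EuclideanSpace ℝ (Fin N) → ℝ) :
    tsupport (gradient φ) ⊆ tsupport φ := by
  refine closure_minimal (fun x hx => ?_) (isClosed_tsupport _)
  by_contra h
  refine hx ?_
  have : fderiv ℝ φ x = 0 := by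
    rw [notMem_tsupport_iff_eventuallyEq] at h
    rw [h.fderiv_eq]
    simp
  simp [gradient, this]

theorem gradient_sub {φ χ : EuclideanSpace ℝ (Fin N) → ℝ} {x : EuclideanSpace ℝ (Fin N)}
    (hφ : DifferentiableAt ℝ φ x) (hχ : DifferentiableAt ℝ χ x) :
    gradient (fun y => φ y - χ y) x = gradient φ x - gradient χ x := by
  simp [gradient, fderiv_fun_sub hφ hχ]

theorem gradient_mul {φ χ : EuclideanSpace ℝ (Fin N) → ℝ} {x : EuclideanSpace ℝ (Fin N)}
    (hφ : DifferentiableAt ℝ φ x) (hχ : DifferentiableAt ℝ χ x) :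
    gradient (fun y => φ y * χ y) x = φ x • gradient χ x + χ x • gradient φ x := by
  simp [gradient, fderiv_fun_mul hφ hχ]

theorem MemD12On.memLp_approx (H : MemD12On Ω a v h ψ) (hN : 0 < N) (ha : 2 * a < N) (n : ℕ) :
    MemLp (fun x => ‖x‖ ^ (-a) • gradient (ψ n) x) 2 volume :=
  memLp_norm_rpow_smul_of_continuous hN ha
    (continuous_gradient ((H.contDiff n).of_le (by exact_mod_cast le_top)))
    (hasCompactSupport_gradient (H.hasCompactSupport n))

theorem MemD12On.measurable_weighted (H : MemD12On Ω a v h ψ) :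
    AEStronglyMeasurable (fun x => ‖x‖ ^ (-a) • h x) volume :=
  (measurable_norm_rpow (-a)).aestronglyMeasurable.smul H.measurable_gradient

theorem MemD12On.memLp_gradient (H : MemD12On Ω a v h ψ) (hN : 0 < N) (ha : 2 * a < N) :
    MemLp (fun x => ‖x‖ ^ (-a) • h x) 2 volume := by
  obtain ⟨n, hn⟩ := (H.tendsto_gradient.eventually (gt_mem_nhds ENNReal.zero_lt_top)).exists
  have h1 := H.memLp_approx hN ha n
  have h2 : MemLp (fun x => ‖x‖ ^ (-a) • (gradient (ψ n) x - h x)) 2 volume := by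
    refine ⟨?_, hn⟩
    simp_rw [smul_sub]
    exact h1.1.sub H.measurable_weighted
  have := h1.sub h2
  refine this.ae_eq (Eventually.of_forall fun x => ?_)
  simp [smul_sub]

theorem MemD12On.aestronglyMeasurable (H : MemD12On Ω a v h ψ) : AEStronglyMeasurable v volume :=
  aestronglyMeasurable_of_tendsto_ae atTop
    (fun n => (H.contDiff n).continuous.aestronglyMeasurable) H.tendsto_ae

/-- An inequality that holds for all test functions extends to the limits of test functions. -/
theorem MemD12On.of_inequality (H : MemD12On Ω a v h ψ) (hN : 0 < N) (ha : 2 * a < N) {s : ℝ}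
    {q : ℝ≥0∞} {C : ℝ≥0∞} (hC : C ≠ ⊤)
    (ineq : ∀ φ : EuclideanSpace ℝ (Fin N) → ℝ, ContDiff ℝ 1 φ → HasCompactSupport φ →
      eLpNorm (fun x => ‖x‖ ^ s * φ x) q volume ≤
        C * eLpNorm (fun x => ‖x‖ ^ (-a) * ‖fderiv ℝ φ x‖) 2 volume) :
    Tendsto (fun n => eLpNorm (fun x => ‖x‖ ^ s * (ψ n x - v x)) q volume) atTop (𝓝 0) ∧
    eLpNorm (fun x => ‖x‖ ^ s * v x) q volume ≤
      C * eLpNorm (fun x => ‖x‖ ^ (-a) • h x) 2 volume := by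
  have hψ1 : ∀ n, ContDiff ℝ 1 (ψ n) := fun n => (H.contDiff n).of_le (by exact_mod_cast le_top)
  have ineq' : ∀ φ : EuclideanSpace ℝ (Fin N) → ℝ, ContDiff ℝ 1 φ → HasCompactSupport φ →
      eLpNorm (fun x => ‖x‖ ^ s * φ x) q volume ≤
        C * eLpNorm (fun x => ‖x‖ ^ (-a) • gradient φ x) 2 volume := by
    intro φ h1 h2
    refine (ineq φ h1 h2).trans (le_of_eq ?_)
    congr 1
    refine eLpNorm_congr_norm_ae (Eventually.of_forall fun x => ?_)
    simp [norm_smul, norm_gradient_eq]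
  set D : ℕ → ℝ≥0∞ := fun n =>
    eLpNorm (fun x => ‖x‖ ^ (-a) • (gradient (ψ n) x - h x)) 2 volume with hD
  have hDm : ∀ n, AEStronglyMeasurable (fun x => ‖x‖ ^ (-a) • (gradient (ψ n) x - h x)) volume := by
    intro n
    simp_rw [smul_sub]
    exact (H.memLp_approx hN ha n).1.sub H.measurable_weighted
  have hD0 : Tendsto D atTop (𝓝 0) := H.tendsto_gradient
  have hm : ∀ n, AEStronglyMeasurable (fun x => ‖x‖ ^ s * ψ n x) volume := fun n =>
    (measurable_norm_rpow s).aestronglyMeasurable.mul (hψ1 n).continuous.aestronglyMeasurable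
  refine ⟨?_, ?_⟩
  -- For fixed n the function ψ n - v is the almost everywhere limit of the test functions ψ n - ψ
  -- m, to which the inequality applies. Fatou in m turns the Cauchy property of the gradients into
  -- convergence in the weighted L^q norm.
  · have key : ∀ n, eLpNorm (fun x => ‖x‖ ^ s * (ψ n x - v x)) q volume ≤ C * (D n + 0) := by
      intro n
      refine eLpNorm_le_of_tendsto_ae_of_tendsto
        (f := fun m x => ‖x‖ ^ s * (ψ n x - ψ m x)) (B := fun m => C * (D n + D m)) ?_ ?_ ?_ ?_
      · intro m
        simp_rw [mul_sub]
        exact (hm n).sub (hm m)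
      · filter_upwards [H.tendsto_ae] with x hx
        exact (tendsto_const_nhds.sub hx).const_mul _
      · intro m
        refine (ineq' _ ((hψ1 n).sub (hψ1 m))
          ((H.hasCompactSupport n).sub (H.hasCompactSupport m))).trans ?_
        gcongr
        refine le_trans (le_of_eq ?_) (eLpNorm_sub_le (hDm n) (hDm m) one_le_two)
        congr 1
        ext1 x
        rw [gradient_sub ((hψ1 n).differentiable one_ne_zero x)
          ((hψ1 m).differentiable one_ne_zero x)]
        simp only [Pi.sub_apply, ← smul_sub]
        congr 1
        abel
      · exact ENNReal.Tendsto.const_mul (tendsto_const_nhds.add hD0) (Or.inr hC)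
    have lim : Tendsto (fun n => C * (D n + 0)) atTop (𝓝 0) := by
      simp only [add_zero]
      rw [← mul_zero C]
      exact ENNReal.Tendsto.const_mul hD0 (Or.inr hC)
    exact tendsto_of_tendsto_of_tendsto_of_le_of_le tendsto_const_nhds lim (fun _ => zero_le) key
  · have := eLpNorm_le_of_tendsto_ae_of_tendsto (μ := volume) (p := q)
      (f := fun n x => ‖x‖ ^ s * ψ n x)
      (g := fun x => ‖x‖ ^ s * v x)
      (B := fun n => C * (D n + eLpNorm (fun x => ‖x‖ ^ (-a) • h x) 2 volume))
      (b := C * (0 + eLpNorm (fun x => ‖x‖ ^ (-a) • h x) 2 volume)) hm ?_ ?_ ?_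
    · simpa using this
    · filter_upwards [H.tendsto_ae] with x hx
      exact hx.const_mul _
    · intro n
      refine (ineq' _ (hψ1 n) (H.hasCompactSupport n)).trans ?_
      gcongr
      refine le_trans (le_of_eq ?_) (eLpNorm_add_le (hDm n) H.measurable_weighted one_le_two)
      congr 1
      ext1 x
      simp [smul_sub]
    · exact ENNReal.Tendsto.const_mul (hD0.add tendsto_const_nhds) (Or.inr hC)

theorem MemD12On.hardy (H : MemD12On Ω a v h ψ) (hN : 0 < N) (ha : 2 * a + 2 < N) :
    Tendsto (fun n => eLpNorm (fun x => ‖x‖ ^ (-a - 1) * (ψ n x - v x)) 2 volume) atTop (𝓝 0) ∧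
    MemLp (fun x => ‖x‖ ^ (-a - 1) * v x) 2 volume := by
  have : Nonempty (Fin N) := ⟨⟨0, hN⟩⟩
  obtain ⟨C, hC, ineq⟩ := _root_.hardy (E := EuclideanSpace ℝ (Fin N)) (a := a) (by simpa using ha)
  obtain ⟨h1, h2⟩ := H.of_inequality hN (by linarith) hC ineq
  refine ⟨h1, (measurable_norm_rpow _).aestronglyMeasurable.mul H.aestronglyMeasurable,
    h2.trans_lt (ENNReal.mul_lt_top hC.lt_top (H.memLp_gradient hN (by linarith)).2)⟩

/-- The constant is chosen before the function. This uniformity matters later, where the function is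
the increment along a shear and varies with t. -/
theorem exists_ckn_constant (hP : CKNParams N a b p) : ∃ C : ℝ≥0∞, C ≠ ⊤ ∧
    ∀ (Ω : Set (EuclideanSpace ℝ (Fin N))) (v : EuclideanSpace ℝ (Fin N) → ℝ)
      (h : EuclideanSpace ℝ (Fin N) → EuclideanSpace ℝ (Fin N))
      (ψ : ℕ → EuclideanSpace ℝ (Fin N) → ℝ), MemD12On Ω a v h ψ →
    Tendsto (fun n => eLpNorm (fun x => ‖x‖ ^ (-b) * (ψ n x - v x)) (ENNReal.ofReal p) volume)
      atTop (𝓝 0) ∧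
    eLpNorm (fun x => ‖x‖ ^ (-b) * v x) (ENNReal.ofReal p) volume ≤
      C * eLpNorm (fun x => ‖x‖ ^ (-a) • h x) 2 volume := by
  have hN : 0 < N := by have := hP.three_le; omega
  have : Nonempty (Fin N) := ⟨⟨0, hN⟩⟩
  obtain ⟨C, hC, ineq⟩ := caffarelli_kohn_nirenberg (E := EuclideanSpace ℝ (Fin N)) (a := a)
    (b := b) (p := p) (by simpa using hP.lt) (by simpa using hP.three_le) hP.le hP.lt_add_one
    (by simpa using hP.eq)
  refine ⟨C, hC, fun Ω v h ψ H => H.of_inequality hN ?_ hC ineq⟩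
  have := hP.lt
  linarith

theorem MemD12On.ckn (H : MemD12On Ω a v h ψ) (hP : CKNParams N a b p) :
    Tendsto (fun n => eLpNorm (fun x => ‖x‖ ^ (-b) * (ψ n x - v x)) (ENNReal.ofReal p) volume)
      atTop (𝓝 0) ∧
    MemLp (fun x => ‖x‖ ^ (-b) * v x) (ENNReal.ofReal p) volume := by
  obtain ⟨C, hC, ineq⟩ := exists_ckn_constant hP
  obtain ⟨h1, h2⟩ := ineq Ω v h ψ H
  refine ⟨h1, (measurable_norm_rpow _).aestronglyMeasurable.mul H.aestronglyMeasurable,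
    h2.trans_lt (ENNReal.mul_lt_top hC.lt_top (H.memLp_gradient ?_ ?_).2)⟩
  · have := hP.three_le
    omega
  · have := hP.lt
    linarith

end MemD12On

/-! ### Extending the weak formulation to limits of test functions -/

section WeakFormulation

variable {N : ℕ} {Ω : Set (EuclideanSpace ℝ (Fin N))} {a b p : ℝ}
  {K u v : EuclideanSpace ℝ (Fin N) → ℝ}
  {g h : EuclideanSpace ℝ (Fin N) → EuclideanSpace ℝ (Fin N)}
  {φ ψ : ℕ → EuclideanSpace ℝ (Fin N) → ℝ}

theorem ae_ne_zero (hN : 0 < N) (μ : Measure (EuclideanSpace ℝ (Fin N))) (hμ : μ ≪ volume) :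
    ∀ᵐ x ∂μ, x ≠ 0 := by
  have : Nonempty (Fin N) := ⟨⟨0, hN⟩⟩
  exact hμ.ae_le (compl_mem_ae_iff.2 (measure_singleton _))

theorem rpow_sub_one_div_eq {r c b p : ℝ} (hr : 0 < r) (hc : 0 ≤ c) :
    c ^ (p - 1) / r ^ (b * p) = (r ^ (-b) * c) ^ (p - 1) * r ^ (-b) := by
  rw [Real.mul_rpow (by positivity) hc, ← Real.rpow_mul hr.le, div_eq_mul_inv, ← Real.rpow_neg hr.le,
    mul_right_comm, ← Real.rpow_add hr, mul_comm]
  ring_nf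

theorem rpow_div_eq {r c b p : ℝ} (hr : 0 < r) (hc : 0 ≤ c) :
    c ^ p / r ^ (b * p) = (r ^ (-b) * c) ^ p := by
  rw [Real.mul_rpow (by positivity) hc, ← Real.rpow_mul hr.le, div_eq_mul_inv, ← Real.rpow_neg hr.le,
    mul_comm]
  ring_nf

theorem norm_rpow_neg_mul_self (x : EuclideanSpace ℝ (Fin N)) (a : ℝ) :
    ‖x‖ ^ (-2 * a) = ‖x‖ ^ (-a) * ‖x‖ ^ (-a) := by
  rw [← sq, ← Real.rpow_natCast, ← Real.rpow_mul (norm_nonneg x)]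
  push_cast
  ring_nf

theorem CKNParams.pos {N : ℕ} {a b p : ℝ} (h : CKNParams N a b p) : 0 < N := by
  have := h.three_le
  omega

theorem CKNParams.two_mul_lt {N : ℕ} {a b p : ℝ} (h : CKNParams N a b p) : 2 * a < N := by
  have := h.lt
  linarith

/-- Both sides of the weak formulation converge absolutely for limits of test functions, and they
are equal. -/
theorem IsPositiveWeakSolution.weak_eq_memD12On (hP : CKNParams N a b p)
    (hu : MemD12On Set.univ a u g φ) (hsol : IsPositiveWeakSolution Ω a b p K u g)
    (hΩ : MeasurableSet Ω) (hK : AEStronglyMeasurable K (volume.restrict Ω)) {M : ℝ}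
    (hM : ∀ x ∈ Ω, |K x| ≤ M) (hv : MemD12On Ω a v h ψ) :
    IntegrableOn (fun x => ‖x‖ ^ (-2 * a) * inner ℝ (g x) (h x)) Ω volume ∧
    IntegrableOn (fun x => K x * (u x ^ (p - 1) / ‖x‖ ^ (b * p)) * v x) Ω volume ∧
    ∫ x in Ω, ‖x‖ ^ (-2 * a) * inner ℝ (g x) (h x) =
      ∫ x in Ω, K x * (u x ^ (p - 1) / ‖x‖ ^ (b * p)) * v x := by
  have hN := hP.pos
  have ha := hP.two_mul_lt
  have hp := hP.two_lt
  have e1 : ∀ (x y : EuclideanSpace ℝ (Fin N)) , ‖x‖ ^ (-2 * a) * inner ℝ (g x) y =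
      inner ℝ (‖x‖ ^ (-a) • g x) (‖x‖ ^ (-a) • y) := by
    intro x y
    rw [real_inner_smul_left, real_inner_smul_right, norm_rpow_neg_mul_self, mul_assoc]
  -- As |x|^{-b} u lies in L^p, its (p-1)-st power lies in the dual space L^{p/(p-1)}, and the
  -- right-hand side becomes the pairing of F with |x|^{-b} v in L^p.
  set F : EuclideanSpace ℝ (Fin N) → ℝ := fun x => K x * ‖‖x‖ ^ (-b) * u x‖ ^ (p - 1) with hF
  have e2 : ∀ y : EuclideanSpace ℝ (Fin N) → ℝ, ∀ᵐ x ∂volume.restrict Ω,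
      K x * (u x ^ (p - 1) / ‖x‖ ^ (b * p)) * y x = inner ℝ (F x) (‖x‖ ^ (-b) * y x) := by
    intro y
    filter_upwards [hsol.pos, ae_ne_zero hN _ Measure.absolutelyContinuous_restrict] with x h1 h2
    have hr : 0 < ‖x‖ := norm_pos_iff.2 h2
    rw [rpow_sub_one_div_eq hr h1.le, hF]
    simp only [RCLike.inner_apply, conj_trivial]
    rw [Real.norm_of_nonneg (by positivity)]
    ring
  have hG : MemLp (fun x => ‖x‖ ^ (-a) • g x) 2 (volume.restrict Ω) :=
    (hu.memLp_gradient hN ha).restrict Ω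
  have hH : MemLp (fun x => ‖x‖ ^ (-a) • h x) 2 (volume.restrict Ω) :=
    (hv.memLp_gradient hN ha).restrict Ω
  have hconj : Real.HolderConjugate (p / (p - 1)) p :=
    (Real.HolderConjugate.conjExponent (by linarith : 1 < p)).symm
  have hconj' : ENNReal.HolderTriple (ENNReal.ofReal (p / (p - 1))) (ENNReal.ofReal p) 1 :=
    hconj.ennrealOfReal
  have hFm : MemLp F (ENNReal.ofReal (p / (p - 1))) (volume.restrict Ω) := by
    have h1 := ((hu.ckn hP).2.restrict Ω).norm_rpow_div (ENNReal.ofReal (p - 1))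
    rw [ENNReal.toReal_ofReal (by linarith), ← ENNReal.ofReal_div_of_pos (by linarith)] at h1
    refine h1.of_le_mul (c := M) (hK.mul h1.1) ?_
    filter_upwards [ae_restrict_mem hΩ] with x hx
    rw [hF, norm_mul]
    exact mul_le_mul_of_nonneg_right (hM x hx) (norm_nonneg _)
  have hV : MemLp (fun x => ‖x‖ ^ (-b) * v x) (ENNReal.ofReal p) (volume.restrict Ω) :=
    (hv.ckn hP).2.restrict Ω
  have hVn : ∀ n, MemLp (fun x => ‖x‖ ^ (-b) * (ψ n x - v x)) (ENNReal.ofReal p) volume → 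
      MemLp (fun x => ‖x‖ ^ (-b) * ψ n x) (ENNReal.ofReal p) (volume.restrict Ω) := by
    intro n hn
    refine (((hn.restrict Ω).add hV)).ae_eq (Eventually.of_forall fun x => ?_)
    simp only [Pi.add_apply]
    ring
  refine ⟨?_, ?_, ?_⟩
  · simp_rw [e1]
    exact integrable_inner_of_memLp (p := 2) (q := 2) hG hH
  · exact (integrable_inner_of_memLp hFm hV).congr ((e2 v).mono fun x hx => hx.symm)
  -- The distance of ψ n to v in the weighted L^p norm is known to be finite only from some index
  -- on, so the sequence is shifted by n0.
  · obtain ⟨n0, hn0⟩ := eventually_atTop.1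
      ((hv.ckn hP).1.eventually (gt_mem_nhds ENNReal.zero_lt_top))
    have hψL : ∀ n, MemLp (fun x => ‖x‖ ^ (-b) * ψ (n + n0) x) (ENNReal.ofReal p)
        (volume.restrict Ω) := fun n => hVn _ ⟨(measurable_norm_rpow _).aestronglyMeasurable.mul
          ((hv.contDiff _).continuous.aestronglyMeasurable.sub hv.aestronglyMeasurable),
          hn0 _ (Nat.le_add_left _ _)⟩
    have t1 := tendsto_integral_inner (p := 2) (q := 2)
      (G := fun n x => ‖x‖ ^ (-a) • gradient (ψ (n + n0)) x) hG hH
      (fun n => (hv.memLp_approx hN ha (n + n0)).restrict Ω) (by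
        have := (tendsto_add_atTop_iff_nat n0).2 hv.tendsto_gradient
        refine tendsto_of_tendsto_of_tendsto_of_le_of_le tendsto_const_nhds this
          (fun _ => zero_le) fun n => ?_
        simp only [← smul_sub]
        exact eLpNorm_restrict_le _ _ _ _)
    have t2 := tendsto_integral_inner
      (G := fun n x => ‖x‖ ^ (-b) * ψ (n + n0) x) hFm hV hψL (by
        have := (tendsto_add_atTop_iff_nat n0).2 (hv.ckn hP).1
        refine tendsto_of_tendsto_of_tendsto_of_le_of_le tendsto_const_nhds this
          (fun _ => zero_le) fun n => ?_
        simp only [← mul_sub]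
        exact eLpNorm_restrict_le _ _ _ _)
    simp_rw [← e1] at t1
    rw [integral_congr_ae (e2 v)]
    refine tendsto_nhds_unique t1 (t2.congr fun n => ?_)
    rw [← integral_congr_ae (e2 (ψ (n + n0)))]
    exact (hsol.weak_eq _ (hv.contDiff _) (hv.hasCompactSupport _) (hv.tsupport_subset _)).symm

theorem exists_bound_gradient_mul_norm {ζ : EuclideanSpace ℝ (Fin N) → ℝ} (hζ : ContDiff ℝ ∞ ζ)
    (hc : HasCompactSupport ζ) : ∃ C : ℝ, 0 ≤ C ∧ ∀ x, |ζ x| ≤ C ∧ ‖gradient ζ x‖ ≤ C ∧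
      ‖gradient ζ x‖ * ‖x‖ ≤ C := by
  have hζ1 : ContDiff ℝ 1 ζ := hζ.of_le (by exact_mod_cast le_top)
  obtain ⟨A, hA⟩ := hc.exists_bound_of_continuous hζ.continuous
  obtain ⟨B, hB⟩ := (hasCompactSupport_gradient hc).exists_bound_of_continuous
    (continuous_gradient hζ1)
  obtain ⟨C, hC⟩ := ((hasCompactSupport_gradient hc).norm.mul_right
    (f' := fun x => ‖x‖)).exists_bound_of_continuous
    ((continuous_gradient hζ1).norm.mul continuous_norm)
  refine ⟨max A (max B C), ?_, fun x => ⟨?_, ?_, ?_⟩⟩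
  · exact ((norm_nonneg _).trans (hA 0)).trans (le_max_left _ _)
  · exact (hA x).trans (le_max_left _ _)
  · exact (hB x).trans ((le_max_left _ _).trans (le_max_right _ _))
  · have := hC x
    simp only [Pi.mul_apply, norm_mul, norm_norm] at this
    exact this.trans ((le_max_right _ _).trans (le_max_right _ _))

/-- The product rule leaves the error |x|^{-a} (φ_n - u) ∇ζ. Written as |x|^{-a-1} (φ_n - u) times
|x| ∇ζ, it tends to 0 in L² by Hardy. This makes ζ u an admissible test function. -/
theorem MemD12On.mul (hN : 0 < N) (ha : 2 * a + 2 < N) (hu : MemD12On Set.univ a u g φ)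
    {ζ : EuclideanSpace ℝ (Fin N) → ℝ}
    (hζ : ContDiff ℝ ∞ ζ) (hc : HasCompactSupport ζ) (hs : tsupport ζ ⊆ Ω) :
    MemD12On Ω a (fun x => ζ x * u x) (fun x => ζ x • g x + u x • gradient ζ x)
      (fun n x => ζ x * φ n x) := by
  have hζ1 : ContDiff ℝ 1 ζ := hζ.of_le (by exact_mod_cast le_top)
  have hφ1 : ∀ n, ContDiff ℝ 1 (φ n) := fun n => (hu.contDiff n).of_le (by exact_mod_cast le_top)
  refine ⟨?_, fun n => hζ.mul (hu.contDiff n), fun n => hc.mul_right,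
    fun n => tsupport_mul_subset_left.trans hs, ?_, ?_⟩
  · exact (hζ.continuous.aestronglyMeasurable.smul hu.measurable_gradient).add
      (hu.aestronglyMeasurable.smul (continuous_gradient hζ1).aestronglyMeasurable)
  · filter_upwards [hu.tendsto_ae] with x hx
    exact hx.const_mul _
  · obtain ⟨C, hC0, hC⟩ := exists_bound_gradient_mul_norm hζ hc
    have t1 := hu.tendsto_gradient
    have t2 := (hu.hardy hN ha).1
    have t3 : Tendsto (fun n => ENNReal.ofReal C *
        eLpNorm (fun x => ‖x‖ ^ (-a) • (gradient (φ n) x - g x)) 2 volume + ENNReal.ofReal C *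
        eLpNorm (fun x => ‖x‖ ^ (-a - 1) * (φ n x - u x)) 2 volume) atTop (𝓝 0) := by
      have := (ENNReal.Tendsto.const_mul t1 (Or.inr (ENNReal.ofReal_ne_top (r := C)))).add
        (ENNReal.Tendsto.const_mul t2 (Or.inr (ENNReal.ofReal_ne_top (r := C))))
      simpa using this
    refine tendsto_of_tendsto_of_tendsto_of_le_of_le tendsto_const_nhds t3 (fun _ => zero_le) ?_
    intro n
    have hm1 : AEStronglyMeasurable (fun x => ‖x‖ ^ (-a) • (gradient (φ n) x - g x)) volume :=
      (measurable_norm_rpow _).aestronglyMeasurable.smul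
        ((continuous_gradient (hφ1 n)).aestronglyMeasurable.sub hu.measurable_gradient)
    have hm2 : AEStronglyMeasurable (fun x => ‖x‖ ^ (-a - 1) * (φ n x - u x)) volume :=
      (measurable_norm_rpow _).aestronglyMeasurable.mul
        ((hφ1 n).continuous.aestronglyMeasurable.sub hu.aestronglyMeasurable)
    have pt : ∀ᵐ x : EuclideanSpace ℝ (Fin N),
        ‖‖x‖ ^ (-a) • (gradient (fun y => ζ y * φ n y) x - (ζ x • g x + u x • gradient ζ x))‖ ≤
        ‖C * ‖‖x‖ ^ (-a) • (gradient (φ n) x - g x)‖ +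
          C * ‖‖x‖ ^ (-a - 1) * (φ n x - u x)‖‖ := by
      filter_upwards [ae_ne_zero hN volume (Measure.AbsolutelyContinuous.refl _)] with x hx
      have hx' : 0 < ‖x‖ := norm_pos_iff.2 hx
      obtain ⟨c1, -, c2⟩ := hC x
      rw [gradient_mul (hζ1.differentiable one_ne_zero x) ((hφ1 n).differentiable one_ne_zero x),
        Real.norm_of_nonneg (by positivity)]
      have e : ‖x‖ ^ (-a) • (ζ x • gradient (φ n) x + φ n x • gradient ζ x -
          (ζ x • g x + u x • gradient ζ x)) = ζ x • (‖x‖ ^ (-a) • (gradient (φ n) x - g x)) +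
          (‖x‖ ^ (-a - 1) * (φ n x - u x)) • (‖x‖ • gradient ζ x) := by
        have e : ‖x‖ ^ (-a) = ‖x‖ ^ (-a - 1) * ‖x‖ := by
          nth_rewrite 3 [← Real.rpow_one ‖x‖]
          rw [← Real.rpow_add hx']
          ring_nf
        rw [e]
        module
      rw [e]
      refine (norm_add_le _ _).trans ?_
      rw [norm_smul (ζ x), norm_smul _ (‖x‖ • gradient ζ x), norm_smul ‖x‖, norm_norm]
      refine add_le_add (mul_le_mul_of_nonneg_right c1 (norm_nonneg _)) ?_
      rw [mul_comm C, mul_comm ‖x‖ ‖gradient ζ x‖]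
      exact mul_le_mul_of_nonneg_left c2 (norm_nonneg _)
    refine (eLpNorm_mono_ae pt).trans
      ((eLpNorm_add_le (hm1.norm.const_mul C) (hm2.norm.const_mul C) one_le_two).trans ?_)
    have c1 := eLpNorm_const_smul C
      (fun x : EuclideanSpace ℝ (Fin N) => ‖‖x‖ ^ (-a) • (gradient (φ n) x - g x)‖) 2 volume
    have c2 := eLpNorm_const_smul C
      (fun x : EuclideanSpace ℝ (Fin N) => ‖‖x‖ ^ (-a - 1) * (φ n x - u x)‖) 2 volume
    rw [eLpNorm_norm, Real.enorm_of_nonneg hC0] at c1 c2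
    exact add_le_add c1.le c2.le

theorem rpow_eq_rpow_sub_one_mul {c p : ℝ} (hc : 0 < c) : c ^ p = c ^ (p - 1) * c := by
  nth_rewrite 3 [← Real.rpow_one c]
  rw [← Real.rpow_add hc]
  ring_nf

end WeakFormulation

/-! ### Shears: perturbations of the identity in a fixed direction -/

section Shear

set_option linter.unusedSectionVars false

variable {E : Type*} [NormedAddCommGroup E] [InnerProductSpace ℝ E] [FiniteDimensional ℝ E]
  [MeasurableSpace E] [BorelSpace E] {ζ : E → ℝ} {e : E} {t c : ℝ}

/-- The perturbation `x ↦ x + t ζ(x) e` of the identity. -/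
def shear (ζ : E → ℝ) (e : E) (t : ℝ) (x : E) : E := x + (t * ζ x) • e

theorem hasFDerivAt_shear (hζ : ContDiff ℝ 1 ζ) (x : E) :
    HasFDerivAt (shear ζ e t)
      (ContinuousLinearMap.id ℝ E + (t • fderiv ℝ ζ x).smulRight e) x := by
  have h1 := ((hζ.differentiable one_ne_zero x).hasFDerivAt.const_mul t).smul_const e
  exact (hasFDerivAt_id x).add h1

/-- The derivative is a transvection, that is, the identity plus a rank one map. -/
theorem det_fderiv_shear (x : E) :
    (ContinuousLinearMap.id ℝ E + (t • fderiv ℝ ζ x).smulRight e).det =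
      1 + t * fderiv ℝ ζ x e := by
  have := LinearMap.transvection.det (t • fderiv ℝ ζ x : E →L[ℝ] ℝ).toLinearMap e
  rw [ContinuousLinearMap.det]
  exact (congrArg LinearMap.det (LinearMap.ext fun y => rfl)).trans this

theorem contDiff_shear {n : WithTop ℕ∞} (hζ : ContDiff ℝ n ζ) : ContDiff ℝ n (shear ζ e t) :=
  contDiff_id.add ((contDiff_const.mul hζ).smul contDiff_const)

theorem shear_eq_self {x : E} (hx : x ∉ tsupport ζ) : shear ζ e t x = x := by
  simp [shear, image_eq_zero_of_notMem_tsupport hx]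

theorem lipschitzWith_shear_sub (hζ : ContDiff ℝ 1 ζ) (hb : ∀ x, ‖fderiv ℝ ζ x‖ * ‖e‖ ≤ c)
    (ht : |t| * c ≤ 1 / 2) : LipschitzWith (1 / 2) (fun x => (t * ζ x) • e) := by
  refine lipschitzWith_of_nnnorm_fderiv_le (𝕜 := ℝ)
    (((contDiff_const.mul hζ).smul contDiff_const).differentiable one_ne_zero) fun x => ?_
  have h1 : HasFDerivAt (fun x => (t * ζ x) • e) ((t • fderiv ℝ ζ x).smulRight e) x :=
    ((hζ.differentiable one_ne_zero x).hasFDerivAt.const_mul t).smul_const e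
  rw [h1.fderiv, ← NNReal.coe_le_coe, coe_nnnorm, ContinuousLinearMap.norm_smulRight_apply,
    norm_smul, mul_assoc, Real.norm_eq_abs]
  push_cast
  exact (mul_le_mul_of_nonneg_left (hb x) (abs_nonneg t)).trans ht

theorem approximatesLinearOn_shear (hζ : ContDiff ℝ 1 ζ) (hb : ∀ x, ‖fderiv ℝ ζ x‖ * ‖e‖ ≤ c)
    (ht : |t| * c ≤ 1 / 2) : ApproximatesLinearOn (shear ζ e t)
      (ContinuousLinearEquiv.refl ℝ E : E →L[ℝ] E) Set.univ (1 / 2) := by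
  rw [ApproximatesLinearOn.approximatesLinearOn_iff_lipschitzOnWith, lipschitzOnWith_univ]
  have := lipschitzWith_shear_sub hζ hb ht
  convert this using 1
  ext x
  simp [shear]

theorem half_lt_inv_norm_refl : Subsingleton E ∨
    (1 / 2 : NNReal) < ‖((ContinuousLinearEquiv.refl ℝ E).symm : E →L[ℝ] E)‖₊⁻¹ := by
  rcases subsingleton_or_nontrivial E with h | h
  · exact Or.inl h
  · right
    have : ‖((ContinuousLinearEquiv.refl ℝ E).symm : E →L[ℝ] E)‖₊ = 1 := by
      rw [← NNReal.coe_inj, coe_nnnorm]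
      exact ContinuousLinearMap.norm_id
    rw [this]
    norm_num

/-- For small `t` the perturbation `shear ζ e t` of the identity is a homeomorphism. -/
def shearHomeomorph (hζ : ContDiff ℝ 1 ζ) (hb : ∀ x, ‖fderiv ℝ ζ x‖ * ‖e‖ ≤ c)
    (ht : |t| * c ≤ 1 / 2) : E ≃ₜ E :=
  (approximatesLinearOn_shear hζ hb ht).toHomeomorph _ half_lt_inv_norm_refl

theorem shearHomeomorph_apply (hζ : ContDiff ℝ 1 ζ) (hb : ∀ x, ‖fderiv ℝ ζ x‖ * ‖e‖ ≤ c)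
    (ht : |t| * c ≤ 1 / 2) (x : E) : shearHomeomorph hζ hb ht x = shear ζ e t x := rfl

theorem shear_injective (hζ : ContDiff ℝ 1 ζ) (hb : ∀ x, ‖fderiv ℝ ζ x‖ * ‖e‖ ≤ c)
    (ht : |t| * c ≤ 1 / 2) : Function.Injective (shear ζ e t) :=
  (shearHomeomorph hζ hb ht).injective

theorem shear_surjective (hζ : ContDiff ℝ 1 ζ) (hb : ∀ x, ‖fderiv ℝ ζ x‖ * ‖e‖ ≤ c)
    (ht : |t| * c ≤ 1 / 2) : Function.Surjective (shear ζ e t) :=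
  (shearHomeomorph hζ hb ht).surjective

/-- The shear fixes every point off the support. If the image of x lies off the support it is itself
fixed, and injectivity forces it to equal x. -/
theorem shear_mem_tsupport_iff (hζ : ContDiff ℝ 1 ζ) (hb : ∀ x, ‖fderiv ℝ ζ x‖ * ‖e‖ ≤ c)
    (ht : |t| * c ≤ 1 / 2) (x : E) : shear ζ e t x ∈ tsupport ζ ↔ x ∈ tsupport ζ := by
  constructor
  · intro h
    by_contra hx
    rw [shear_eq_self hx] at h
    exact hx h
  · intro h
    by_contra hx
    have h1 : shear ζ e t (shear ζ e t x) = shear ζ e t x := shear_eq_self hx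
    rw [shear_injective hζ hb ht h1] at hx
    exact hx h

theorem abs_fderiv_apply_le (hb : ∀ x, ‖fderiv ℝ ζ x‖ * ‖e‖ ≤ c) (ht : |t| * c ≤ 1 / 2) (x : E) :
    |t * fderiv ℝ ζ x e| ≤ 1 / 2 := by
  rw [abs_mul]
  refine le_trans ?_ ht
  gcongr
  exact ((fderiv ℝ ζ x).le_opNorm e).trans (hb x)

theorem integral_comp_shear {G : Type*} [NormedAddCommGroup G] [NormedSpace ℝ G]
    (hζ : ContDiff ℝ 1 ζ) (hb : ∀ x, ‖fderiv ℝ ζ x‖ * ‖e‖ ≤ c)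
    (ht : |t| * c ≤ 1 / 2) (f : E → G) :
    ∫ x, (1 + t * fderiv ℝ ζ x e) • f (shear ζ e t x) = ∫ x, f x := by
  have := integral_image_eq_integral_abs_det_fderiv_smul (volume : Measure E)
    (s := Set.univ) MeasurableSet.univ
    (fun x _ => (hasFDerivAt_shear (e := e) (t := t) hζ x).hasFDerivWithinAt)
    (shear_injective hζ hb ht).injOn f
  rw [Set.image_univ, (shear_surjective hζ hb ht).range_eq] at this
  simp only [Measure.restrict_univ, det_fderiv_shear] at this
  rw [this]
  refine integral_congr_ae (Eventually.of_forall fun x => ?_)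
  have h := abs_le.1 (abs_fderiv_apply_le hb ht x)
  simp only
  rw [abs_of_nonneg (by linarith)]

/-- The Jacobian 1 + t ∂_e ζ is at least 1/2, which gives the factor 2. -/
theorem lintegral_comp_shear_le (hζ : ContDiff ℝ 1 ζ) (hb : ∀ x, ‖fderiv ℝ ζ x‖ * ‖e‖ ≤ c)
    (ht : |t| * c ≤ 1 / 2) (f : E → ℝ≥0∞) :
    ∫⁻ x, f (shear ζ e t x) ≤ 2 * ∫⁻ x, f x := by
  have := lintegral_image_eq_lintegral_abs_det_fderiv_mul (volume : Measure E)
    (s := Set.univ) MeasurableSet.univ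
    (fun x _ => (hasFDerivAt_shear (e := e) (t := t) hζ x).hasFDerivWithinAt)
    (shear_injective hζ hb ht).injOn f
  rw [Set.image_univ, (shear_surjective hζ hb ht).range_eq] at this
  simp only [Measure.restrict_univ, det_fderiv_shear] at this
  rw [this, ← lintegral_const_mul' _ _ (by norm_num)]
  refine lintegral_mono fun x => ?_
  rw [← mul_assoc]
  refine le_mul_of_one_le_left (zero_le) ?_
  have h := abs_le.1 (abs_fderiv_apply_le hb ht x)
  rw [← ENNReal.ofReal_ofNat 2, ← ENNReal.ofReal_mul (by norm_num), ← ENNReal.ofReal_one]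
  refine ENNReal.ofReal_le_ofReal ?_
  rw [abs_of_nonneg (by linarith)]
  linarith

theorem measurable_shear (hζ : ContDiff ℝ 1 ζ) : Measurable (shear ζ e t) :=
  (contDiff_shear hζ).continuous.measurable

theorem map_shear_le (hζ : ContDiff ℝ 1 ζ) (hb : ∀ x, ‖fderiv ℝ ζ x‖ * ‖e‖ ≤ c)
    (ht : |t| * c ≤ 1 / 2) :
    Measure.map (shear ζ e t) (volume : Measure E) ≤ (2 : ℝ≥0∞) • volume := by
  refine Measure.le_iff.2 fun s hs => ?_
  rw [← lintegral_indicator_one hs, lintegral_map (measurable_one.indicator hs)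
    (measurable_shear hζ), Measure.smul_apply, smul_eq_mul, ← lintegral_indicator_one hs]
  exact lintegral_comp_shear_le hζ hb ht _

theorem quasiMeasurePreserving_shear (hζ : ContDiff ℝ 1 ζ)
    (hb : ∀ x, ‖fderiv ℝ ζ x‖ * ‖e‖ ≤ c) (ht : |t| * c ≤ 1 / 2) :
    Measure.QuasiMeasurePreserving (shear ζ e t) (volume : Measure E) volume :=
  ⟨measurable_shear hζ, (Measure.absolutelyContinuous_of_le (map_shear_le hζ hb ht)).trans
    (Measure.smul_absolutelyContinuous)⟩

theorem eLpNorm_comp_shear_le {G : Type*} [NormedAddCommGroup G] (hζ : ContDiff ℝ 1 ζ)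
    (hb : ∀ x, ‖fderiv ℝ ζ x‖ * ‖e‖ ≤ c) (ht : |t| * c ≤ 1 / 2) {f : E → G}
    (hf : AEStronglyMeasurable f volume) {p : ℝ≥0∞} (hp : 1 ≤ p) :
    eLpNorm (fun x => f (shear ζ e t x)) p volume ≤ 2 * eLpNorm f p volume := by
  have hf' : AEStronglyMeasurable f (Measure.map (shear ζ e t) (volume : Measure E)) :=
    hf.mono_ac (quasiMeasurePreserving_shear hζ hb ht).absolutelyContinuous
  have h1 := eLpNorm_map_measure (p := p) hf' (measurable_shear hζ).aemeasurable
  change eLpNorm (f ∘ shear ζ e t) p volume ≤ _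
  rw [← h1]
  refine (eLpNorm_mono_measure f (map_shear_le hζ hb ht)).trans ?_
  have hp0 : p ≠ 0 := (zero_lt_one.trans_le hp).ne'
  refine (eLpNorm_smul_measure_of_ne_zero (by norm_num) f p volume).le.trans ?_
  rw [smul_eq_mul]
  gcongr
  calc (2 : ℝ≥0∞) ^ (1 / p).toReal ≤ 2 ^ (1 : ℝ) := by
        refine ENNReal.rpow_le_rpow_of_exponent_le (by norm_num) ?_
        rw [one_div, ← ENNReal.toReal_one]
        exact ENNReal.toReal_mono ENNReal.one_ne_top (ENNReal.inv_le_one.2 hp)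
    _ = 2 := ENNReal.rpow_one 2

/-- The derivative at `t = 0` of `∫ ⟪m(x), q(x + t ζ(x) e)⟫ dx`. -/
theorem hasDerivAt_integral_inner_comp_shear {F : Type*} [NormedAddCommGroup F]
    [InnerProductSpace ℝ F] (hζ : ContDiff ℝ 1 ζ)
    (hζc : HasCompactSupport ζ) {m q : E → F} (hm : ContDiff ℝ 1 m) (hmc : HasCompactSupport m)
    (hq : Integrable q volume) :
    HasDerivAt (fun t => ∫ x, inner ℝ (m x) (q (shear ζ e t x)))
      (-∫ x, inner ℝ (fderiv ℝ m x (ζ x • e) + fderiv ℝ ζ x e • m x) (q x)) 0 := by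
  obtain ⟨c1, hc1⟩ := (hζc.fderiv (𝕜 := ℝ)).exists_bound_of_continuous
    (hζ.continuous_fderiv one_ne_zero)
  obtain ⟨c2, hc2⟩ := hζc.exists_bound_of_continuous hζ.continuous
  obtain ⟨c3, hc3⟩ := hmc.exists_bound_of_continuous hm.continuous
  obtain ⟨L, hL⟩ := hm.lipschitzWith_of_hasCompactSupport hmc one_ne_zero
  have hc1' : 0 ≤ c1 := (norm_nonneg _).trans (hc1 0)
  have hc2' : 0 ≤ c2 := (norm_nonneg _).trans (hc2 0)
  have hc3' : 0 ≤ c3 := (norm_nonneg _).trans (hc3 0)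
  set c := c1 * ‖e‖ + 1 with hc
  have hcpos : 0 < c := by positivity
  have hb : ∀ x, ‖fderiv ℝ ζ x‖ * ‖e‖ ≤ c := fun x => by
    have := mul_le_mul_of_nonneg_right (hc1 x) (norm_nonneg e)
    linarith
  -- Substituting y = shear(x) moves all dependence on t from q, which is only integrable, to the C¹
  -- function m composed with the inverse Ψ of the shear. Dominated convergence then applies to the
  -- difference quotients.
  set Ψ : ℝ → E → E := fun t => Function.invFun (shear ζ e t) with hΨ
  have inv : ∀ t, |t| * c ≤ 1 / 2 → ∀ y, shear ζ e t (Ψ t y) = y := fun t ht y =>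
    Function.invFun_eq (shear_surjective hζ hb ht y)
  have inv' : ∀ t, |t| * c ≤ 1 / 2 → ∀ y, Ψ t (shear ζ e t y) = y := fun t ht y =>
    Function.leftInverse_invFun (shear_injective hζ hb ht) y
  have Ψm : ∀ t, |t| * c ≤ 1 / 2 → Measurable (Ψ t) := fun t ht => by
    have : Ψ t = (shearHomeomorph hζ hb ht).symm := by
      ext1 y
      apply (shearHomeomorph hζ hb ht).injective
      rw [Homeomorph.apply_symm_apply, shearHomeomorph_apply, inv t ht]
    rw [this]
    exact (shearHomeomorph hζ hb ht).symm.continuous.measurable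
  have Ψsub : ∀ t, |t| * c ≤ 1 / 2 → ∀ y, Ψ t y = y - (t * ζ (Ψ t y)) • e := fun t ht y => by
    have := inv t ht y
    rw [shear] at this
    exact eq_sub_of_add_eq this
  have small : ∀ᶠ t : ℝ in 𝓝 0, |t| * c ≤ 1 / 2 := by
    have : Tendsto (fun t : ℝ => |t| * c) (𝓝 0) (𝓝 (|0| * c)) := by
      exact (continuous_abs.mul continuous_const).tendsto 0
    rw [abs_zero, zero_mul] at this
    exact this.eventually (ge_mem_nhds (by norm_num))
  have Ψ0 : ∀ y, Ψ 0 y = y := fun y => by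
    rw [Ψsub 0 (by simp) y]
    simp
  set J : ℝ → E → ℝ := fun t y => 1 + t * fderiv ℝ ζ (Ψ t y) e with hJ
  have Jb : ∀ t, |t| * c ≤ 1 / 2 → ∀ y, 1 / 2 ≤ J t y := fun t ht y => by
    have := abs_le.1 (abs_fderiv_apply_le hb ht (Ψ t y))
    simp only [hJ]
    linarith
  have change : ∀ t, |t| * c ≤ 1 / 2 → ∫ x, inner ℝ (m x) (q (shear ζ e t x)) =
      ∫ y, inner ℝ ((J t y)⁻¹ • m (Ψ t y)) (q y) := by
    intro t ht
    rw [← integral_comp_shear hζ hb ht (fun y => inner ℝ ((J t y)⁻¹ • m (Ψ t y)) (q y))]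
    refine integral_congr_ae (Eventually.of_forall fun x => ?_)
    simp only [hJ]
    rw [inv' t ht, real_inner_smul_left, smul_eq_mul, ← mul_assoc, mul_inv_cancel₀, one_mul]
    have := Jb t ht (shear ζ e t x)
    simp only [hJ] at this
    rw [inv' t ht] at this
    linarith
  have hJm : ∀ t, |t| * c ≤ 1 / 2 → Measurable (J t) := fun t ht => by
    have h1 : Measurable fun y => fderiv ℝ ζ y e :=
      ((hζ.continuous_fderiv one_ne_zero).clm_apply continuous_const).measurable
    exact measurable_const.add (measurable_const.mul (h1.comp (Ψm t ht)))
  have Rm : ∀ t, |t| * c ≤ 1 / 2 →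
      AEStronglyMeasurable (fun y => (J t y)⁻¹ • m (Ψ t y)) (volume : Measure E) := fun t ht =>
    (hJm t ht).inv.aestronglyMeasurable.smul
      (hm.continuous.comp_aestronglyMeasurable (Ψm t ht).aestronglyMeasurable)
  set B : ℝ := 2 * (L * (c2 * ‖e‖)) + 2 * c * c3 with hB
  -- Uniform Lipschitz bound in t: the displacement of Ψ costs L c2 ‖e‖, the Jacobian costs c c3,
  -- and J⁻¹ ≤ 2 doubles both. It supplies the dominating function.
  have bound : ∀ t, |t| * c ≤ 1 / 2 → ∀ y, ‖(J t y)⁻¹ • m (Ψ t y) - m y‖ ≤ |t| * B := by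
    intro t ht y
    have hj := Jb t ht y
    have hjpos : 0 < J t y := by linarith
    have e1 : (J t y)⁻¹ • m (Ψ t y) - m y =
        (J t y)⁻¹ • ((m (Ψ t y) - m y) + (1 - J t y) • m y) := by
      rw [sub_smul, smul_add, smul_sub, smul_sub, smul_smul _ (J t y),
        inv_mul_cancel₀ hjpos.ne', one_smul]
      abel
    have h1 : ‖m (Ψ t y) - m y‖ ≤ L * (|t| * (c2 * ‖e‖)) := by
      rw [← dist_eq_norm]
      refine (hL.dist_le_mul _ _).trans ?_
      gcongr
      nth_rewrite 1 [Ψsub t ht y]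
      rw [dist_eq_norm, sub_sub_cancel_left, norm_neg, norm_smul, norm_mul, Real.norm_eq_abs,
        mul_assoc]
      gcongr
      exact hc2 _
    have h2 : ‖(1 - J t y) • m y‖ ≤ |t| * c * c3 := by
      rw [norm_smul]
      refine mul_le_mul ?_ (hc3 y) (norm_nonneg _) (by positivity)
      simp only [hJ]
      rw [sub_add_cancel_left, norm_neg, norm_mul, Real.norm_eq_abs]
      gcongr
      exact ((fderiv ℝ ζ _).le_opNorm e).trans (hb _)
    rw [e1, norm_smul, norm_inv, Real.norm_of_nonneg hjpos.le]
    have h3 : (J t y)⁻¹ ≤ 2 := by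
      rw [inv_le_comm₀ hjpos (by norm_num)]
      linarith
    calc (J t y)⁻¹ * ‖m (Ψ t y) - m y + (1 - J t y) • m y‖
        ≤ 2 * (L * (|t| * (c2 * ‖e‖)) + |t| * c * c3) :=
          mul_le_mul h3 ((norm_add_le _ _).trans (add_le_add h1 h2)) (norm_nonneg _) (by norm_num)
      _ = |t| * B := by rw [hB]; ring
  have intm : Integrable (fun y => inner ℝ (m y) (q y)) (volume : Measure E) := by
    refine (hq.norm.const_mul c3).mono' (hm.continuous.aestronglyMeasurable.inner hq.1)
      (Eventually.of_forall fun y => ?_)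
    exact (norm_inner_le_norm _ _).trans (mul_le_mul_of_nonneg_right (hc3 y) (norm_nonneg _))
  have intR : ∀ t, |t| * c ≤ 1 / 2 →
      Integrable (fun y => inner ℝ ((J t y)⁻¹ • m (Ψ t y) - m y) (q y)) (volume : Measure E) := by
    intro t ht
    refine (hq.norm.const_mul (|t| * B)).mono'
      (((Rm t ht).sub hm.continuous.aestronglyMeasurable).inner hq.1)
      (Eventually.of_forall fun y => ?_)
    exact (norm_inner_le_norm _ _).trans
      (mul_le_mul_of_nonneg_right (bound t ht y) (norm_nonneg _))
  rw [hasDerivAt_iff_tendsto_slope_zero]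
  have small' : ∀ᶠ t : ℝ in 𝓝[≠] 0, |t| * c ≤ 1 / 2 ∧ t ≠ 0 :=
    (small.filter_mono nhdsWithin_le_nhds).and self_mem_nhdsWithin
  have slope_eq : (fun t : ℝ => t⁻¹ • ((∫ x, inner ℝ (m x) (q (shear ζ e (0 + t) x))) -
      ∫ x, inner ℝ (m x) (q (shear ζ e 0 x)))) =ᶠ[𝓝[≠] 0]
      fun t => ∫ y, inner ℝ (t⁻¹ • ((J t y)⁻¹ • m (Ψ t y) - m y)) (q y) := by
    filter_upwards [small'] with t ht
    have e0 : ∀ x, shear ζ e 0 x = x := fun x => by simp [shear]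
    simp only [zero_add, e0]
    rw [change t ht.1]
    have hA : Integrable (fun y => inner ℝ ((J t y)⁻¹ • m (Ψ t y)) (q y)) (volume : Measure E) :=
      ((intR t ht.1).add intm).congr (Eventually.of_forall fun y => by simp [inner_sub_left])
    rw [← integral_sub hA intm, ← integral_smul]
    refine integral_congr_ae (Eventually.of_forall fun y => ?_)
    simp only [inner_sub_left, real_inner_smul_left, smul_eq_mul]
  rw [tendsto_congr' slope_eq, ← integral_neg]
  refine tendsto_integral_filter_of_dominated_convergence (fun y => B * ‖q y‖) ?_ ?_
    (hq.norm.const_mul B) ?_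
  · filter_upwards [small'] with t ht
    exact (((Rm t ht.1).sub hm.continuous.aestronglyMeasurable).const_smul t⁻¹).inner hq.1
  · filter_upwards [small'] with t ht
    refine Eventually.of_forall fun y => (norm_inner_le_norm _ _).trans
      (mul_le_mul_of_nonneg_right ?_ (norm_nonneg _))
    rw [norm_smul, norm_inv, Real.norm_eq_abs, inv_mul_le_iff₀ (abs_pos.2 ht.2)]
    exact bound t ht.1 y
  · refine Eventually.of_forall fun y => ?_
    rw [← inner_neg_left]
    refine Tendsto.inner ?_ tendsto_const_nhds
    have Ψlim : Tendsto (fun t => Ψ t y) (𝓝 0) (𝓝 y) := by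
      rw [tendsto_iff_norm_sub_tendsto_zero]
      have h0 : Tendsto (fun t : ℝ => |t| * (c2 * ‖e‖)) (𝓝 0) (𝓝 0) := by
        have : Tendsto (fun t : ℝ => |t| * (c2 * ‖e‖)) (𝓝 0) (𝓝 (|0| * (c2 * ‖e‖))) :=
          (continuous_abs.mul continuous_const).tendsto 0
        simpa using this
      refine squeeze_zero' (Eventually.of_forall fun _ => norm_nonneg _) ?_ h0
      filter_upwards [small] with t ht
      nth_rewrite 1 [Ψsub t ht y]
      rw [sub_sub_cancel_left, norm_neg, norm_smul, norm_mul, Real.norm_eq_abs, mul_assoc]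
      gcongr
      exact hc2 _
    -- The implicit relation Ψ_t y = y - t ζ(Ψ_t y) e makes the difference quotient equal to -ζ(Ψ_t
    -- y) e, so continuity of Ψ at t = 0 suffices.
    have Ψderiv : HasDerivAt (fun t => Ψ t y) (-(ζ y • e)) 0 := by
      rw [hasDerivAt_iff_tendsto_slope_zero]
      have h1 : Tendsto (fun t => -(ζ (Ψ t y) • e)) (𝓝[≠] 0) (𝓝 (-(ζ y • e))) :=
        (((hζ.continuous.tendsto y).comp (Ψlim.mono_left nhdsWithin_le_nhds)).smul_const e).neg
      refine h1.congr' ?_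
      filter_upwards [small'] with t ht
      rw [zero_add, Ψ0]
      nth_rewrite 2 [Ψsub t ht.1 y]
      rw [sub_sub_cancel_left, smul_neg, smul_smul, ← mul_assoc, inv_mul_cancel₀ ht.2, one_mul]
    have Jderiv : HasDerivAt (fun t => J t y) (fderiv ℝ ζ y e) 0 := by
      rw [hasDerivAt_iff_tendsto_slope_zero]
      have h1 : Tendsto (fun t => fderiv ℝ ζ (Ψ t y) e) (𝓝[≠] 0) (𝓝 (fderiv ℝ ζ y e)) :=
        (((hζ.continuous_fderiv one_ne_zero).clm_apply continuous_const).tendsto y).comp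
          (Ψlim.mono_left nhdsWithin_le_nhds)
      refine h1.congr' ?_
      filter_upwards [small'] with t ht
      simp only [hJ, zero_add, zero_mul, add_zero, add_sub_cancel_left, smul_eq_mul]
      rw [← mul_assoc, inv_mul_cancel₀ ht.2, one_mul]
    have J0 : J 0 y = 1 := by simp [hJ]
    have mderiv : HasDerivAt (fun t => m (Ψ t y)) (fderiv ℝ m y (-(ζ y • e))) 0 := by
      have h1 : HasFDerivAt m (fderiv ℝ m y) (Ψ 0 y) := by
        rw [Ψ0]
        exact (hm.differentiable one_ne_zero y).hasFDerivAt
      exact h1.comp_hasDerivAt 0 Ψderiv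
    have tot := (Jderiv.fun_inv (by rw [J0]; norm_num)).fun_smul mderiv
    rw [J0, Ψ0] at tot
    rw [hasDerivAt_iff_tendsto_slope_zero] at tot
    simp only [zero_add, J0, Ψ0, inv_one, one_smul] at tot
    convert tot using 2
    rw [map_neg, neg_add, one_pow, div_one, neg_smul]

end Shear

/-! ### Estimates for increments along shears -/

theorem enorm_sub_le_lintegral_deriv {f : ℝ → ℝ} (hf : ContDiff ℝ 1 f) :
    ‖f 1 - f 0‖ₑ ≤ ∫⁻ s in Set.Ioc (0 : ℝ) 1, ‖deriv f s‖ₑ := by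
  have hi : IntervalIntegrable (deriv f) volume 0 1 :=
    (hf.continuous_deriv le_rfl).intervalIntegrable _ _
  rw [← intervalIntegral.integral_deriv_eq_sub
    (fun x _ => hf.differentiable one_ne_zero x) hi, intervalIntegral.integral_of_le zero_le_one]
  exact enorm_integral_le_lintegral_enorm _

theorem sq_lintegral_Ioc_le {f : ℝ → ℝ≥0∞} (hf : Measurable f) :
    (∫⁻ s in Set.Ioc (0 : ℝ) 1, f s) ^ 2 ≤ ∫⁻ s in Set.Ioc (0 : ℝ) 1, f s ^ 2 := by
  have := ENNReal.lintegral_mul_le_Lp_mul_Lq (volume.restrict (Set.Ioc (0 : ℝ) 1))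
    Real.HolderConjugate.two_two hf.aemeasurable (aemeasurable_const (b := (1 : ℝ≥0∞)))
  simp only [Pi.mul_apply, mul_one, ENNReal.one_rpow, lintegral_const,
    Measure.restrict_apply MeasurableSet.univ, Set.univ_inter, Real.volume_Ioc, sub_zero,
    ENNReal.ofReal_one] at this
  have h2 := pow_le_pow_left₀ (zero_le) this 2
  refine h2.trans (le_of_eq ?_)
  rw [← ENNReal.rpow_natCast, ← ENNReal.rpow_mul]
  norm_num

section ShearEstimates

variable {N : ℕ} {Ω : Set (EuclideanSpace ℝ (Fin N))} {a c t : ℝ}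
  {u ζ : EuclideanSpace ℝ (Fin N) → ℝ} {e : EuclideanSpace ℝ (Fin N)}
  {g : EuclideanSpace ℝ (Fin N) → EuclideanSpace ℝ (Fin N)}
  {φ : ℕ → EuclideanSpace ℝ (Fin N) → ℝ}

theorem exists_norm_rpow_le {S : Set (EuclideanSpace ℝ (Fin N))} (hS : IsCompact S)
    (h0 : (0 : EuclideanSpace ℝ (Fin N)) ∉ S) (s : ℝ) :
    ∃ C : ℝ, 0 < C ∧ ∀ x ∈ S, ‖x‖ ^ s ≤ C := by
  have hc : ContinuousOn (fun x : EuclideanSpace ℝ (Fin N) => ‖x‖ ^ s) S := fun x hx =>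
    (contDiffAt_norm_rpow (n := 1) s (fun h => h0 (h ▸ hx))).continuousAt.continuousWithinAt
  obtain ⟨C, hC⟩ := hS.exists_bound_of_continuousOn hc
  refine ⟨max C 1, by positivity, fun x hx => ?_⟩
  exact ((le_abs_self _).trans (hC x hx)).trans (le_max_left _ _)

theorem exists_one_le_mul_norm_rpow {S : Set (EuclideanSpace ℝ (Fin N))} (hS : IsCompact S)
    (h0 : (0 : EuclideanSpace ℝ (Fin N)) ∉ S) (s : ℝ) :
    ∃ C : ℝ, 0 < C ∧ ∀ x ∈ S, 1 ≤ C * ‖x‖ ^ s := by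
  obtain ⟨C, hC, h⟩ := exists_norm_rpow_le hS h0 (-s)
  refine ⟨C, hC, fun x hx => ?_⟩
  have hx' : 0 < ‖x‖ := norm_pos_iff.2 (fun h => h0 (h ▸ hx))
  calc 1 = ‖x‖ ^ (-s) * ‖x‖ ^ s := by rw [← Real.rpow_add hx', neg_add_cancel, Real.rpow_zero]
    _ ≤ C * ‖x‖ ^ s := by
      have := h x hx
      gcongr

/-- The shear maps the support of ζ to itself, and on this compact set, which misses 0, the weight
is bounded above and below. Elsewhere the shear is the identity and `1 ≤ C` is enough. -/
theorem exists_norm_rpow_le_shear (hζ : ContDiff ℝ 1 ζ) (hc : HasCompactSupport ζ)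
    (h0 : (0 : EuclideanSpace ℝ (Fin N)) ∉ tsupport ζ) (hb : ∀ x, ‖fderiv ℝ ζ x‖ * ‖e‖ ≤ c)
    (s : ℝ) : ∃ C : ℝ, 1 ≤ C ∧ ∀ t, |t| * c ≤ 1 / 2 → ∀ x, ‖x‖ ^ s ≤ C * ‖shear ζ e t x‖ ^ s := by
  obtain ⟨A, hA0, hA⟩ := exists_norm_rpow_le hc.isCompact h0 s
  obtain ⟨B, hB0, hB⟩ := exists_one_le_mul_norm_rpow hc.isCompact h0 s
  refine ⟨max 1 (A * B), le_max_left _ _, fun t ht x => ?_⟩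
  by_cases hx : x ∈ tsupport ζ
  · have h1 := hA x hx
    have h2 := hB _ ((shear_mem_tsupport_iff hζ hb ht x).2 hx)
    calc ‖x‖ ^ s ≤ A * 1 := by linarith
      _ ≤ A * (B * ‖shear ζ e t x‖ ^ s) := by gcongr
      _ = (A * B) * ‖shear ζ e t x‖ ^ s := by ring
      _ ≤ _ := by
        gcongr
        exact le_max_right _ _
  · rw [shear_eq_self hx]
    exact le_mul_of_one_le_left (by positivity) (le_max_left _ _)

/-- The transposed derivative of `shear ζ e t`. -/
def shearPullback (ζ : EuclideanSpace ℝ (Fin N) → ℝ) (e : EuclideanSpace ℝ (Fin N)) (t : ℝ)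
    (x ξ : EuclideanSpace ℝ (Fin N)) : EuclideanSpace ℝ (Fin N) :=
  ξ + (t * inner ℝ e ξ) • gradient ζ x

theorem shearPullback_sub (x ξ η : EuclideanSpace ℝ (Fin N)) :
    shearPullback ζ e t x (ξ - η) = shearPullback ζ e t x ξ - shearPullback ζ e t x η := by
  simp only [shearPullback, inner_sub_right]
  module

theorem norm_shearPullback_le (hb : ∀ x, ‖fderiv ℝ ζ x‖ * ‖e‖ ≤ c) (ht : |t| * c ≤ 1 / 2)
    (x ξ : EuclideanSpace ℝ (Fin N)) : ‖shearPullback ζ e t x ξ‖ ≤ 2 * ‖ξ‖ := by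
  refine (norm_add_le _ _).trans ?_
  rw [norm_smul, norm_mul, norm_gradient_eq, Real.norm_eq_abs]
  have h1 := norm_inner_le_norm (𝕜 := ℝ) e ξ
  have h2 : |t| * ‖(inner ℝ e ξ : ℝ)‖ * ‖fderiv ℝ ζ x‖ ≤ |t| * c * ‖ξ‖ := by
    calc |t| * ‖(inner ℝ e ξ : ℝ)‖ * ‖fderiv ℝ ζ x‖ ≤ |t| * (‖e‖ * ‖ξ‖) * ‖fderiv ℝ ζ x‖ := by
          gcongr
      _ = |t| * (‖fderiv ℝ ζ x‖ * ‖e‖) * ‖ξ‖ := by ring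
      _ ≤ |t| * c * ‖ξ‖ := by
          have := hb x
          gcongr
  have h3 := mul_le_mul_of_nonneg_right ht (norm_nonneg ξ)
  linarith [norm_nonneg ξ]

theorem aestronglyMeasurable_shearPullback (hζ : ContDiff ℝ 1 ζ)
    {f : EuclideanSpace ℝ (Fin N) → EuclideanSpace ℝ (Fin N)}
    (hf : AEStronglyMeasurable f volume) :
    AEStronglyMeasurable (fun x => shearPullback ζ e t x (f x)) volume :=
  hf.add (((aestronglyMeasurable_const.inner hf).const_mul t).smul
    (continuous_gradient hζ).aestronglyMeasurable)

theorem gradient_comp_shear (hζ : ContDiff ℝ 1 ζ) {χ : EuclideanSpace ℝ (Fin N) → ℝ}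
    (hχ : ContDiff ℝ 1 χ) (x : EuclideanSpace ℝ (Fin N)) :
    gradient (fun y => χ (shear ζ e t y)) x =
      shearPullback ζ e t x (gradient χ (shear ζ e t x)) := by
  have h1 := ((hχ.differentiable one_ne_zero (shear ζ e t x)).hasFDerivAt).comp x
    (hasFDerivAt_shear (e := e) (t := t) hζ x)
  refine ext_inner_right ℝ fun v => ?_
  rw [inner_gradient_eq]
  have h2 : fderiv ℝ (fun y => χ (shear ζ e t y)) x = _ := h1.fderiv
  rw [h2]
  simp only [shearPullback, inner_add_left, real_inner_smul_left, inner_gradient_eq,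
    ContinuousLinearMap.comp_apply, add_apply, ContinuousLinearMap.id_apply,
    ContinuousLinearMap.smulRight_apply, smul_apply, smul_eq_mul, map_add,
    map_smul]
  rw [real_inner_comm, inner_gradient_eq]
  ring

/-- Increments vanish off the support of ζ, so they are limits of test functions supported in Ω
although u itself is not. The weight is comparable at x and at its image, so convergence of the
gradients survives the composition. -/
theorem MemD12On.comp_shear_sub
    (hu : MemD12On Set.univ a u g φ) (hζ : ContDiff ℝ ∞ ζ)
    (hc : HasCompactSupport ζ) (h0 : (0 : EuclideanSpace ℝ (Fin N)) ∉ tsupport ζ)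
    (hs : tsupport ζ ⊆ Ω) (hb : ∀ x, ‖fderiv ℝ ζ x‖ * ‖e‖ ≤ c) (ht : |t| * c ≤ 1 / 2) :
    MemD12On Ω a (fun x => u (shear ζ e t x) - u x)
      (fun x => shearPullback ζ e t x (g (shear ζ e t x)) - g x)
      (fun n x => φ n (shear ζ e t x) - φ n x) := by
  have hζ1 : ContDiff ℝ 1 ζ := hζ.of_le (by exact_mod_cast le_top)
  have hφ1 : ∀ n, ContDiff ℝ 1 (φ n) := fun n => (hu.contDiff n).of_le (by exact_mod_cast le_top)
  have qmp := quasiMeasurePreserving_shear hζ1 hb ht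
  have supp : ∀ n, Function.support (fun x => φ n (shear ζ e t x) - φ n x) ⊆ tsupport ζ := by
    intro n x hx
    by_contra h
    exact hx (by simp [shear_eq_self h])
  refine ⟨?_, ?_, ?_, ?_, ?_, ?_⟩
  · exact (aestronglyMeasurable_shearPullback hζ1
      (hu.measurable_gradient.comp_quasiMeasurePreserving qmp)).sub hu.measurable_gradient
  · exact fun n => ((hu.contDiff n).comp (contDiff_shear hζ)).sub (hu.contDiff n)
  · exact fun n => HasCompactSupport.of_support_subset_isCompact hc.isCompact (supp n)
  · exact fun n => (closure_minimal (supp n) (isClosed_tsupport ζ)).trans hs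
  · filter_upwards [hu.tendsto_ae, qmp.ae hu.tendsto_ae] with x h1 h2
    exact h2.sub h1
  · obtain ⟨C, hC1, hC⟩ := exists_norm_rpow_le_shear hζ1 hc h0 hb (-a)
    have hC0 : 0 ≤ C := by linarith
    set D : ℕ → EuclideanSpace ℝ (Fin N) → EuclideanSpace ℝ (Fin N) := fun n x =>
      ‖x‖ ^ (-a) • (gradient (φ n) x - g x) with hD
    have hDm : ∀ n, AEStronglyMeasurable (D n) volume := fun n =>
      (measurable_norm_rpow _).aestronglyMeasurable.smul
        ((continuous_gradient (hφ1 n)).aestronglyMeasurable.sub hu.measurable_gradient)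
    have lim : Tendsto (fun n => ENNReal.ofReal (2 * C) * (2 * eLpNorm (D n) 2 volume) +
        eLpNorm (D n) 2 volume) atTop (𝓝 0) := by
      have := (ENNReal.Tendsto.const_mul (ENNReal.Tendsto.const_mul hu.tendsto_gradient
        (Or.inr (ENNReal.ofNat_ne_top (n := 2)))) (Or.inr (ENNReal.ofReal_ne_top (r := 2 * C)))).add
        hu.tendsto_gradient
      simpa using this
    refine tendsto_of_tendsto_of_tendsto_of_le_of_le tendsto_const_nhds lim (fun _ => zero_le) ?_
    intro n
    have pt : ∀ x, ‖‖x‖ ^ (-a) • (gradient (fun y => φ n (shear ζ e t y) - φ n y) x -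
        (shearPullback ζ e t x (g (shear ζ e t x)) - g x))‖ ≤
        ‖2 * C * ‖D n (shear ζ e t x)‖ + ‖D n x‖‖ := by
      intro x
      have hcomp : DifferentiableAt ℝ (fun y => φ n (shear ζ e t y)) x :=
        ((hφ1 n).comp (contDiff_shear hζ1)).differentiable one_ne_zero x
      rw [gradient_sub hcomp ((hφ1 n).differentiable one_ne_zero x)]
      have e1 : gradient (fun y => φ n (shear ζ e t y)) x = _ := gradient_comp_shear hζ1 (hφ1 n) x
      rw [e1, Real.norm_of_nonneg (by positivity), sub_sub_sub_comm, ← shearPullback_sub, smul_sub]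
      refine (norm_sub_le _ _).trans (add_le_add_left ?_ _)
      rw [norm_smul, Real.norm_of_nonneg (by positivity)]
      calc ‖x‖ ^ (-a) * ‖shearPullback ζ e t x
            (gradient (φ n) (shear ζ e t x) - g (shear ζ e t x))‖
          ≤ (C * ‖shear ζ e t x‖ ^ (-a)) *
            (2 * ‖gradient (φ n) (shear ζ e t x) - g (shear ζ e t x)‖) := by
            gcongr
            · exact hC t ht x
            · exact norm_shearPullback_le hb ht _ _
        _ = 2 * C * ‖D n (shear ζ e t x)‖ := by
            rw [hD, norm_smul, Real.norm_of_nonneg (by positivity)]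
            ring
    have hm1 : AEStronglyMeasurable (fun x => D n (shear ζ e t x)) volume :=
      (hDm n).comp_quasiMeasurePreserving qmp
    refine (eLpNorm_mono pt).trans
      ((eLpNorm_add_le (hm1.norm.const_mul _) (hDm n).norm one_le_two).trans ?_)
    have c1 := eLpNorm_const_smul (2 * C)
      (fun x : EuclideanSpace ℝ (Fin N) => ‖D n (shear ζ e t x)‖) 2 volume
    rw [eLpNorm_norm, Real.enorm_of_nonneg (by positivity)] at c1
    refine add_le_add (c1.le.trans ?_) (eLpNorm_norm _).le
    gcongr
    exact eLpNorm_comp_shear_le hζ1 hb ht (hDm n) one_le_two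

/-- Write the increment as the integral over s in (0, 1] of the derivative of χ along the shears
with parameter s t, apply Cauchy-Schwarz in s, exchange the integrals, and undo each shear. No
weight is needed on the left, since the support of ζ avoids 0. -/
theorem eLpNorm_comp_shear_sub_le (hζ : ContDiff ℝ 1 ζ) (hc : HasCompactSupport ζ)
    (h0 : (0 : EuclideanSpace ℝ (Fin N)) ∉ tsupport ζ) (hb : ∀ x, ‖fderiv ℝ ζ x‖ * ‖e‖ ≤ c) (a : ℝ) :
    ∃ C : ℝ, 0 ≤ C ∧ ∀ t, |t| * c ≤ 1 / 2 → ∀ χ : EuclideanSpace ℝ (Fin N) → ℝ, ContDiff ℝ 1 χ →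
      eLpNorm (fun x => χ (shear ζ e t x) - χ x) 2 volume ≤
        ENNReal.ofReal (C * |t|) * eLpNorm (fun x => ‖x‖ ^ (-a) • gradient χ x) 2 volume := by
  obtain ⟨A, hA⟩ := hc.exists_bound_of_continuous hζ.continuous
  obtain ⟨B, hB0, hB⟩ := exists_one_le_mul_norm_rpow hc.isCompact h0 (-a)
  have hA0 : 0 ≤ A := (norm_nonneg _).trans (hA 0)
  -- A bounds ζ, B undoes the weight on the support, and the last 2 covers the square root of the
  -- Jacobian factor 2.
  refine ⟨A * ‖e‖ * B * 2, by positivity, fun t ht χ hχ => ?_⟩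
  set G : EuclideanSpace ℝ (Fin N) → ℝ≥0∞ := fun x => ‖‖x‖ ^ (-a) • gradient χ x‖ₑ ^ 2 with hG
  have hGm : Measurable G := by
    have h1 := (continuous_gradient hχ).measurable
    have h2 := measurable_norm_rpow (E := EuclideanSpace ℝ (Fin N)) (-a)
    exact (h2.smul h1).enorm.pow_const 2
  have hGm' : Measurable (fun x => ‖‖x‖ ^ (-a) • gradient χ x‖ₑ) := by
    have h1 := (continuous_gradient hχ).measurable
    have h2 := measurable_norm_rpow (E := EuclideanSpace ℝ (Fin N)) (-a)
    exact (h2.smul h1).enorm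
  set k : ℝ≥0∞ := ENNReal.ofReal (A * ‖e‖ * B * |t|) with hk
  have hts : ∀ s ∈ Set.Ioc (0 : ℝ) 1, |s * t| * c ≤ 1 / 2 := by
    intro s hs
    have hc0 : 0 ≤ c := le_trans (by positivity) (hb 0)
    refine le_trans ?_ ht
    rw [abs_mul, abs_of_pos hs.1]
    have := hs.2
    gcongr
    exact mul_le_of_le_one_left (abs_nonneg t) this
  have joint : Continuous (fun q : EuclideanSpace ℝ (Fin N) × ℝ => shear ζ e (q.2 * t) q.1) := by
    have := hζ.continuous
    unfold shear
    fun_prop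
  have pt : ∀ x, ‖χ (shear ζ e t x) - χ x‖ₑ ^ 2 ≤
      k ^ 2 * ∫⁻ s in Set.Ioc (0 : ℝ) 1, G (shear ζ e (s * t) x) := by
    intro x
    by_cases hx : x ∈ tsupport ζ
    swap
    · rw [shear_eq_self hx]
      simp
    have h1 : ContDiff ℝ 1 (fun s : ℝ => χ (shear ζ e (s * t) x)) := by
      refine hχ.comp ?_
      unfold shear
      fun_prop
    have h2 := enorm_sub_le_lintegral_deriv h1
    have e0 : shear ζ e (0 * t) x = x := by simp [shear]
    simp only [one_mul, e0] at h2
    have h3 : ‖χ (shear ζ e t x) - χ x‖ₑ ≤ k * ∫⁻ s in Set.Ioc (0 : ℝ) 1,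
        ‖‖shear ζ e (s * t) x‖ ^ (-a) • gradient χ (shear ζ e (s * t) x)‖ₑ := by
      refine h2.trans ?_
      rw [← lintegral_const_mul' _ _ ENNReal.ofReal_ne_top]
      refine setLIntegral_mono' measurableSet_Ioc fun s hs => ?_
      have hd : HasDerivAt (fun s : ℝ => χ (shear ζ e (s * t) x))
          (fderiv ℝ χ (shear ζ e (s * t) x) ((t * ζ x) • e)) s := by
        have hi : HasDerivAt (fun s : ℝ => shear ζ e (s * t) x) ((t * ζ x) • e) s := by
          have := ((((hasDerivAt_id' s).mul_const t).mul_const (ζ x)).smul_const e).const_add x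
          rw [one_mul] at this
          exact this
        exact ((hχ.differentiable one_ne_zero _).hasFDerivAt).comp_hasDerivAt s hi
      rw [hd.deriv, ← ofReal_norm, ← ofReal_norm, ← ENNReal.ofReal_mul (by positivity)]
      refine ENNReal.ofReal_le_ofReal ?_
      refine (ContinuousLinearMap.le_opNorm _ _).trans ?_
      have h4 := hB _ ((shear_mem_tsupport_iff hζ hb (hts s hs) x).2 hx)
      rw [norm_smul, norm_smul, norm_mul, Real.norm_eq_abs, ← norm_gradient_eq,
        Real.norm_of_nonneg (by positivity : 0 ≤ ‖shear ζ e (s * t) x‖ ^ (-a))]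
      calc ‖gradient χ (shear ζ e (s * t) x)‖ * (|t| * ‖ζ x‖ * ‖e‖)
          ≤ ‖gradient χ (shear ζ e (s * t) x)‖ * (|t| * A * ‖e‖) *
            (B * ‖shear ζ e (s * t) x‖ ^ (-a)) := by
            refine le_trans ?_ (le_mul_of_one_le_right (by positivity) h4)
            have := hA x
            gcongr
        _ = _ := by ring
    refine (pow_le_pow_left₀ (zero_le) h3 2).trans ?_
    rw [mul_pow]
    gcongr
    refine sq_lintegral_Ioc_le ?_
    exact hGm'.comp (joint.measurable.comp (measurable_const.prodMk measurable_id))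
  have sq : eLpNorm (fun x => χ (shear ζ e t x) - χ x) 2 volume ^ 2 ≤
      (ENNReal.ofReal (A * ‖e‖ * B * 2 * |t|) *
        eLpNorm (fun x => ‖x‖ ^ (-a) • gradient χ x) 2 volume) ^ 2 := by
    rw [mul_pow, eLpNorm_two_sq, eLpNorm_two_sq]
    calc ∫⁻ x, ‖χ (shear ζ e t x) - χ x‖ₑ ^ 2
        ≤ ∫⁻ x, k ^ 2 * ∫⁻ s in Set.Ioc (0 : ℝ) 1, G (shear ζ e (s * t) x) := lintegral_mono pt
      _ = k ^ 2 * ∫⁻ s in Set.Ioc (0 : ℝ) 1, ∫⁻ x, G (shear ζ e (s * t) x) := by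
          rw [lintegral_const_mul' _ _ (by finiteness), lintegral_lintegral_swap]
          exact (hGm.comp joint.measurable).aemeasurable
      _ ≤ k ^ 2 * ∫⁻ s in Set.Ioc (0 : ℝ) 1, 2 * ∫⁻ x, G x := by
          gcongr 1
          exact setLIntegral_mono' measurableSet_Ioc fun s hs =>
            lintegral_comp_shear_le hζ hb (hts s hs) G
      _ = k ^ 2 * 2 * ∫⁻ x, G x := by
          rw [lintegral_const, Measure.restrict_apply MeasurableSet.univ, Set.univ_inter,
            Real.volume_Ioc]
          simp [mul_assoc]
      _ ≤ ENNReal.ofReal (A * ‖e‖ * B * 2 * |t|) ^ 2 * ∫⁻ x, G x := by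
          gcongr
          rw [hk, show A * ‖e‖ * B * 2 * |t| = A * ‖e‖ * B * |t| * 2 by ring,
            ENNReal.ofReal_mul (by positivity) (q := 2), mul_pow]
          gcongr
          rw [ENNReal.ofReal_ofNat]
          norm_num
  exact (ENNReal.pow_le_pow_left_iff (by norm_num)).1 sq

theorem MemD12On.exists_eLpNorm_comp_shear_sub_le (hN : 0 < N) (ha : 2 * a < N)
    (hu : MemD12On Set.univ a u g φ) (hζ : ContDiff ℝ 1 ζ) (hc : HasCompactSupport ζ)
    (h0 : (0 : EuclideanSpace ℝ (Fin N)) ∉ tsupport ζ) (hb : ∀ x, ‖fderiv ℝ ζ x‖ * ‖e‖ ≤ c) :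
    ∃ C : ℝ, 0 ≤ C ∧ ∀ t, |t| * c ≤ 1 / 2 →
      eLpNorm (fun x => u (shear ζ e t x) - u x) 2 volume ≤ ENNReal.ofReal (C * |t|) := by
  obtain ⟨C, hC0, hC⟩ := eLpNorm_comp_shear_sub_le hζ hc h0 hb a
  have hφ1 : ∀ n, ContDiff ℝ 1 (φ n) := fun n => (hu.contDiff n).of_le (by exact_mod_cast le_top)
  set A := eLpNorm (fun x => ‖x‖ ^ (-a) • g x) 2 volume with hA
  have hAtop : A ≠ ⊤ := (hu.memLp_gradient hN ha).2.ne
  refine ⟨C * A.toReal, by positivity, fun t ht => ?_⟩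
  have qmp := quasiMeasurePreserving_shear hζ hb ht
  have hE : ENNReal.ofReal (C * A.toReal * |t|) = ENNReal.ofReal (C * |t|) * (0 + A) := by
    rw [zero_add, mul_right_comm, ENNReal.ofReal_mul (by positivity), ENNReal.ofReal_toReal hAtop]
  rw [hE]
  refine eLpNorm_le_of_tendsto_ae_of_tendsto
    (f := fun n x => φ n (shear ζ e t x) - φ n x)
    (B := fun n => ENNReal.ofReal (C * |t|) *
      (eLpNorm (fun x => ‖x‖ ^ (-a) • (gradient (φ n) x - g x)) 2 volume + A)) ?_ ?_ ?_ ?_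
  · exact fun n => (((hφ1 n).comp (contDiff_shear hζ)).sub (hφ1 n)).continuous.aestronglyMeasurable
  · filter_upwards [hu.tendsto_ae, qmp.ae hu.tendsto_ae] with x h1 h2
    exact h2.sub h1
  · intro n
    refine (hC t ht _ (hφ1 n)).trans ?_
    gcongr
    have hDm : AEStronglyMeasurable (fun x => ‖x‖ ^ (-a) • (gradient (φ n) x - g x)) volume :=
      (measurable_norm_rpow _).aestronglyMeasurable.smul
        ((continuous_gradient (hφ1 n)).aestronglyMeasurable.sub hu.measurable_gradient)
    refine le_trans (le_of_eq ?_) (eLpNorm_add_le hDm hu.measurable_weighted one_le_two)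
    congr 1
    ext1 x
    simp [smul_sub]
  · exact ENNReal.Tendsto.const_mul (hu.tendsto_gradient.add tendsto_const_nhds)
      (Or.inr ENNReal.ofReal_ne_top)

end ShearEstimates

/-! ### Convexity of powers and the second order remainder -/

/-- The tangent line inequality for the convex function s^q at y, which is Bernoulli's inequality
for x / y. -/
theorem rpow_sub_rpow_le {x y q : ℝ} (hx : 0 < x) (hy : 0 < y) (hq : 1 ≤ q) :
    y ^ q - x ^ q ≤ q * y ^ (q - 1) * (y - x) := by
  have h1 := one_add_mul_self_le_rpow_one_add (s := x / y - 1) (p := q)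
    (by linarith [div_pos hx hy]) hq
  rw [add_sub_cancel, Real.div_rpow hx.le hy.le, le_div_iff₀ (by positivity)] at h1
  have h2 : y ^ q = y ^ (q - 1) * y := by
    nth_rewrite 3 [← Real.rpow_one y]
    rw [← Real.rpow_add hy]
    ring_nf
  have h3 : q * (x / y - 1) * y ^ q = q * y ^ (q - 1) * (x - y) := by
    rw [h2]
    field_simp
  linarith

theorem rpow_remainder_nonneg {u v p : ℝ} (hu : 0 < u) (hv : 0 < v) (hp : 2 < p) :
    0 ≤ (v ^ p - u ^ p) / p - u ^ (p - 1) * (v - u) := by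
  have h := rpow_sub_rpow_le hv hu (by linarith : 1 ≤ p)
  have hp0 : 0 < p := by linarith
  rw [sub_nonneg, le_div_iff₀ hp0]
  linarith

/-- The tangent at v bounds the remainder by (v^{p-1} - u^{p-1}) (v - u), and the tangent inequality
for the power p - 1 ≥ 1 gives the quadratic bound. Keeping both u^{p-2} and v^{p-2} covers either
order of u and v. -/
theorem rpow_remainder_le {u v p : ℝ} (hu : 0 < u) (hv : 0 < v) (hp : 2 < p) :
    (v ^ p - u ^ p) / p - u ^ (p - 1) * (v - u) ≤
      (p - 1) * ((v - u) ^ 2 * (u ^ (p - 2) + v ^ (p - 2))) := by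
  have hp0 : 0 < p := by linarith
  have h1 : (v ^ p - u ^ p) / p ≤ v ^ (p - 1) * (v - u) := by
    rw [div_le_iff₀ hp0]
    linarith [rpow_sub_rpow_le hu hv (by linarith : 1 ≤ p)]
  have e : p - 1 - 1 = p - 2 := by ring
  have h2 : (v ^ (p - 1) - u ^ (p - 1)) * (v - u) ≤
      (p - 1) * ((v - u) ^ 2 * (u ^ (p - 2) + v ^ (p - 2))) := by
    have hu' : 0 ≤ (p - 1) * ((v - u) ^ 2 * u ^ (p - 2)) := by
      have : 0 ≤ p - 1 := by linarith
      positivity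
    have hv' : 0 ≤ (p - 1) * ((v - u) ^ 2 * v ^ (p - 2)) := by
      have : 0 ≤ p - 1 := by linarith
      positivity
    rcases le_total u v with h | h
    · have h3 := rpow_sub_rpow_le hu hv (by linarith : 1 ≤ p - 1)
      rw [e] at h3
      have := mul_le_mul_of_nonneg_right h3 (sub_nonneg.2 h)
      linarith
    · have h3 := rpow_sub_rpow_le hv hu (by linarith : 1 ≤ p - 1)
      rw [e] at h3
      have := mul_le_mul_of_nonneg_right h3 (sub_nonneg.2 h)
      linarith
  linarith

/-- Where |W| < T, bound |W|^{p-2} by T^{p-2}. On the remaining set use Hölder with exponents p/2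
and p/(p-2). The factor in front of the squared L^p norm of δ is then a tail of W, small for T
large. -/
theorem lintegral_sq_mul_rpow_le {α : Type*} [MeasurableSpace α] {μ : Measure α} {p T : ℝ}
    (hp : 2 < p) (hT : 0 ≤ T) {δ W : α → ℝ} (hδ : AEStronglyMeasurable δ μ)
    (hW : AEStronglyMeasurable W μ) (hs : NullMeasurableSet {x | T ≤ ‖W x‖} μ) :
    ∫⁻ x, ‖δ x‖ₑ ^ 2 * ‖W x‖ₑ ^ (p - 2) ∂μ ≤ ENNReal.ofReal (T ^ (p - 2)) * eLpNorm δ 2 μ ^ 2 +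
      eLpNorm δ (ENNReal.ofReal p) μ ^ 2 *
        eLpNorm ({x | T ≤ ‖W x‖}.indicator W) (ENNReal.ofReal p) μ ^ (p - 2) := by
  set s := {x | T ≤ ‖W x‖} with hsdef
  have hp2 : 0 < p - 2 := by linarith
  have hp0 : 0 < p := by linarith
  have hpt : (ENNReal.ofReal p).toReal = p := ENNReal.toReal_ofReal hp0.le
  have hpn : ENNReal.ofReal p ≠ 0 := by simpa using hp0
  have pt : ∀ x, ‖δ x‖ₑ ^ 2 * ‖W x‖ₑ ^ (p - 2) ≤ ENNReal.ofReal (T ^ (p - 2)) * ‖δ x‖ₑ ^ 2 +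
      ‖δ x‖ₑ ^ (2 : ℝ) * ‖s.indicator W x‖ₑ ^ (p - 2) := by
    intro x
    by_cases hx : x ∈ s
    · rw [Set.indicator_of_mem hx, ENNReal.rpow_ofNat]
      exact le_add_self
    · refine le_trans ?_ le_self_add
      rw [mul_comm]
      gcongr
      rw [← ENNReal.ofReal_rpow_of_nonneg hT hp2.le, ← ofReal_norm]
      gcongr
      exact (not_le.1 hx).le
  refine (lintegral_mono pt).trans ?_
  rw [lintegral_add_left' ((hδ.enorm.pow_const 2).const_mul _), lintegral_const_mul''
    _ (hδ.enorm.pow_const 2), eLpNorm_two_sq]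
  gcongr
  have hol : (p / 2).HolderConjugate (p / (p - 2)) := by
    rw [Real.holderConjugate_iff]
    constructor
    · linarith
    · field_simp
      ring
  have hWs : AEStronglyMeasurable (s.indicator W) μ := hW.indicator₀ hs
  have := ENNReal.lintegral_mul_le_Lp_mul_Lq μ hol (f := fun x => ‖δ x‖ₑ ^ (2 : ℝ))
    (g := fun x => ‖s.indicator W x‖ₑ ^ (p - 2)) (hδ.enorm.pow_const _) (hWs.enorm.pow_const _)
  simp only [Pi.mul_apply] at this
  refine this.trans (le_of_eq ?_)
  rw [eLpNorm_eq_lintegral_rpow_enorm_toReal hpn ENNReal.ofReal_ne_top,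
    eLpNorm_eq_lintegral_rpow_enorm_toReal hpn ENNReal.ofReal_ne_top, hpt,
    ← ENNReal.rpow_ofNat, ← ENNReal.rpow_mul, ← ENNReal.rpow_mul]
  simp_rw [← ENNReal.rpow_mul]
  rw [show 2 * (p / 2) = p by ring, show (p - 2) * (p / (p - 2)) = p by field_simp,
    show 1 / (p / 2) = 1 / p * 2 by field_simp, show 1 / (p / (p - 2)) = 1 / p * (p - 2) by field_simp]

/-! ### The remainder is absorbed by the energy of the increment -/

section Remainder

variable {N : ℕ} {Ω : Set (EuclideanSpace ℝ (Fin N))} {a b p c : ℝ}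
  {K u ζ : EuclideanSpace ℝ (Fin N) → ℝ} {e : EuclideanSpace ℝ (Fin N)}
  {g : EuclideanSpace ℝ (Fin N) → EuclideanSpace ℝ (Fin N)}
  {φ : ℕ → EuclideanSpace ℝ (Fin N) → ℝ}

theorem ae_pos_comp_shear (hpos : ∀ᵐ x ∂volume.restrict Ω, 0 < u x) (hΩ : MeasurableSet Ω)
    (hζ : ContDiff ℝ 1 ζ) (hs : tsupport ζ ⊆ Ω) (hb : ∀ x, ‖fderiv ℝ ζ x‖ * ‖e‖ ≤ c) {t : ℝ}
    (ht : |t| * c ≤ 1 / 2) : ∀ᵐ x ∂volume.restrict Ω, 0 < u (shear ζ e t x) := by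
  rw [ae_restrict_iff' hΩ] at hpos ⊢
  filter_upwards [(quasiMeasurePreserving_shear hζ hb ht).ae hpos] with x hx hxΩ
  refine hx ?_
  by_cases h : x ∈ tsupport ζ
  · exact hs ((shear_mem_tsupport_iff hζ hb ht x).2 h)
  · rwa [shear_eq_self h]

theorem exists_rpow_mul_le_ofReal {X : ℝ≥0∞} (hX : X ≠ ⊤) {η q : ℝ} (hη : 0 < η) (hq : 0 < q) :
    ∃ ε : ℝ, 0 < ε ∧ X * ENNReal.ofReal ε ^ q ≤ ENNReal.ofReal η := by
  refine ⟨(η / (X.toReal + 1)) ^ (1 / q), by positivity, ?_⟩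
  rw [ENNReal.ofReal_rpow_of_pos (by positivity), ← Real.rpow_mul (by positivity),
    one_div_mul_cancel hq.ne', Real.rpow_one, ← ENNReal.ofReal_toReal hX,
    ← ENNReal.ofReal_mul (by positivity)]
  refine ENNReal.ofReal_le_ofReal ?_
  rw [ENNReal.toReal_ofReal (by positivity), mul_div_assoc', div_le_iff₀ (by positivity)]
  nlinarith [ENNReal.toReal_nonneg (a := X)]

/-- The second order remainder of `u ^ p` along the flow of shears is controlled by a small multiple
of the energy of the increment, up to `O(t²)`. -/
theorem MemD12On.exists_lintegral_remainder_le (hP : CKNParams N a b p)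
    (hu : MemD12On Set.univ a u g φ) (hpos : ∀ᵐ x ∂volume.restrict Ω, 0 < u x)
    (hΩ : MeasurableSet Ω) (hζ : ContDiff ℝ ∞ ζ) (hc : HasCompactSupport ζ)
    (h0 : (0 : EuclideanSpace ℝ (Fin N)) ∉ tsupport ζ) (hs : tsupport ζ ⊆ Ω)
    (hb : ∀ x, ‖fderiv ℝ ζ x‖ * ‖e‖ ≤ c) {η : ℝ} (hη : 0 < η) :
    ∃ C : ℝ, 0 ≤ C ∧ ∀ t, |t| * c ≤ 1 / 2 →
      ∫⁻ x in Ω, ‖((u (shear ζ e t x) ^ p - u x ^ p) / p -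
        u x ^ (p - 1) * (u (shear ζ e t x) - u x)) / ‖x‖ ^ (b * p)‖ₑ ≤
      ENNReal.ofReal η * eLpNorm (fun x => ‖x‖ ^ (-a) •
        (shearPullback ζ e t x (g (shear ζ e t x)) - g x)) 2 volume ^ 2 +
      ENNReal.ofReal (C * t ^ 2) := by
  have hN := hP.pos
  have ha := hP.two_mul_lt
  have hp := hP.two_lt
  have hp1 : 0 < p - 1 := by linarith
  have hp2 : 0 < p - 2 := by linarith
  have hζ1 : ContDiff ℝ 1 ζ := hζ.of_le (by exact_mod_cast le_top)
  obtain ⟨Cs, hCs⟩ := exists_ckn_constant hP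
  obtain ⟨C1, hC1, hshear⟩ := exists_norm_rpow_le_shear hζ1 hc h0 hb (-b)
  obtain ⟨B, hB0, hB⟩ := exists_norm_rpow_le hc.isCompact h0 (-b)
  obtain ⟨C2, hC2, hL2⟩ := hu.exists_eLpNorm_comp_shear_sub_le hN ha hζ1 hc h0 hb
  set D : ℝ := (p - 1) * (1 + C1 ^ (p - 2)) with hD
  have hD0 : 0 ≤ D := by positivity
  -- The tail level ε is chosen so that the final coefficient D Cs² 2^{p-2} ε^{p-2} of the energy is
  -- at most η. The factor 2^{p-2} pays for composing the tail with the shear.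
  obtain ⟨ε, hε, hεle⟩ := exists_rpow_mul_le_ofReal
    (X := ENNReal.ofReal D * (Cs ^ 2 * 2 ^ (p - 2))) (by
      have := hCs.1
      finiteness) hη hp2
  set U : EuclideanSpace ℝ (Fin N) → ℝ := fun x => ‖x‖ ^ (-b) * u x with hU
  have hUL : MemLp U (ENNReal.ofReal p) volume := (hu.ckn hP).2
  -- A strongly measurable representative makes the set where it exceeds T, and the preimage of that
  -- set under the shear, measurable.
  set U1 := hUL.1.mk U with hU1
  have hU1s : StronglyMeasurable U1 := hUL.1.stronglyMeasurable_mk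
  have hUU : U =ᵐ[volume] U1 := hUL.1.ae_eq_mk
  -- T depends on u and ε only and not on t; hence the O(t²) term below has a constant uniform in t.
  obtain ⟨T, hT, hTε⟩ := (hUL.ae_eq hUU).eLpNorm_indicator_norm_ge_pos_le hU1s hε
  have hset : MeasurableSet {x | T ≤ ‖U1 x‖} := measurableSet_le measurable_const hU1s.measurable.norm
  have htail : eLpNorm ({x | T ≤ ‖U1 x‖}.indicator U1) (ENNReal.ofReal p) volume ≤
      ENNReal.ofReal ε := by simpa using hTε
  refine ⟨D * (T ^ (p - 2) * (B * C2) ^ 2), by positivity, fun t ht => ?_⟩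
  have qmp := quasiMeasurePreserving_shear hζ1 hb ht
  set δ : EuclideanSpace ℝ (Fin N) → ℝ := fun x => ‖x‖ ^ (-b) * (u (shear ζ e t x) - u x) with hδ
  set A := eLpNorm (fun x => ‖x‖ ^ (-a) •
        (shearPullback ζ e t x (g (shear ζ e t x)) - g x)) 2 volume with hA
  have hδm : AEStronglyMeasurable δ volume := (measurable_norm_rpow _).aestronglyMeasurable.mul
    ((hu.aestronglyMeasurable.comp_quasiMeasurePreserving qmp).sub hu.aestronglyMeasurable)
  have hδp : eLpNorm δ (ENNReal.ofReal p) volume ≤ Cs * A :=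
    (hCs.2 _ _ _ _ (hu.comp_shear_sub hζ hc h0 hs hb ht)).2
  have hδ2 : eLpNorm δ 2 volume ≤ ENNReal.ofReal (B * C2 * |t|) := by
    have h1 : eLpNorm δ 2 volume ≤
        eLpNorm (fun x => B * (u (shear ζ e t x) - u x)) 2 volume := by
      refine eLpNorm_mono fun x => ?_
      by_cases hx : x ∈ tsupport ζ
      · rw [hδ, norm_mul, norm_mul, Real.norm_of_nonneg (by positivity : 0 ≤ ‖x‖ ^ (-b)),
          Real.norm_of_nonneg hB0.le]
        have := hB x hx
        gcongr
      · simp [hδ, shear_eq_self hx]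
    refine h1.trans ?_
    have h2 := eLpNorm_const_smul B (fun x => u (shear ζ e t x) - u x) 2 volume
    refine h2.le.trans ?_
    rw [Real.enorm_of_nonneg hB0.le, mul_assoc, ENNReal.ofReal_mul hB0.le]
    gcongr
    exact hL2 t ht
  set R : ℝ≥0∞ := ENNReal.ofReal (T ^ (p - 2)) * ENNReal.ofReal (B * C2 * |t|) ^ 2 +
    (Cs * A) ^ 2 * (2 ^ (p - 2) * ENNReal.ofReal ε ^ (p - 2)) with hR
  have i1 : ∫⁻ x, ‖δ x‖ₑ ^ 2 * ‖U1 x‖ₑ ^ (p - 2) ≤ R := by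
    refine (lintegral_sq_mul_rpow_le hp hT.le hδm hU1s.aestronglyMeasurable
      hset.nullMeasurableSet).trans ?_
    rw [hR]
    gcongr
    refine (ENNReal.rpow_le_rpow htail hp2.le).trans ?_
    refine le_mul_of_one_le_left zero_le (ENNReal.one_le_rpow (by norm_num) hp2)
  have i2 : ∫⁻ x, ‖δ x‖ₑ ^ 2 * ‖U1 (shear ζ e t x)‖ₑ ^ (p - 2) ≤ R := by
    refine (lintegral_sq_mul_rpow_le (W := fun x => U1 (shear ζ e t x)) hp hT.le hδm
      (hU1s.comp_measurable qmp.measurable).aestronglyMeasurable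
      (qmp.measurable hset).nullMeasurableSet).trans ?_
    rw [hR]
    gcongr
    rw [← ENNReal.mul_rpow_of_nonneg _ _ hp2.le]
    refine ENNReal.rpow_le_rpow ?_ hp2.le
    refine le_trans ?_ ((eLpNorm_comp_shear_le hζ1 hb ht
      (hU1s.indicator hset).aestronglyMeasurable (by simp; linarith)).trans
      (mul_le_mul_right htail 2))
    exact le_of_eq rfl
  have pt : ∀ᵐ x ∂volume.restrict Ω, ‖((u (shear ζ e t x) ^ p - u x ^ p) / p -
        u x ^ (p - 1) * (u (shear ζ e t x) - u x)) / ‖x‖ ^ (b * p)‖ₑ ≤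
      ENNReal.ofReal (p - 1) * (‖δ x‖ₑ ^ 2 * ‖U1 x‖ₑ ^ (p - 2) + ENNReal.ofReal (C1 ^ (p - 2)) *
        (‖δ x‖ₑ ^ 2 * ‖U1 (shear ζ e t x)‖ₑ ^ (p - 2))) := by
    filter_upwards [hpos, ae_pos_comp_shear hpos hΩ hζ1 hs hb ht,
      ae_ne_zero hN _ Measure.absolutelyContinuous_restrict, ae_restrict_of_ae hUU,
      ae_restrict_of_ae (qmp.ae hUU)] with x h1 h2 h3 h4 h5
    rw [← h4, ← h5]
    have hx : 0 < ‖x‖ := norm_pos_iff.2 h3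
    have h6 : shear ζ e t x ≠ 0 ∨ shear ζ e t x = 0 := ne_or_eq _ _
    have hr0 := rpow_remainder_nonneg h1 h2 hp
    have hr1 := rpow_remainder_le h1 h2 hp
    set r := (u (shear ζ e t x) ^ p - u x ^ p) / p -
        u x ^ (p - 1) * (u (shear ζ e t x) - u x) with hr
    have hUn : 0 ≤ U x := by positivity
    have hUn' : 0 ≤ U (shear ζ e t x) := by positivity
    rw [Real.enorm_of_nonneg (by positivity), Real.enorm_eq_ofReal_abs (δ x),
      Real.enorm_of_nonneg hUn, Real.enorm_of_nonneg hUn',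
      ENNReal.ofReal_rpow_of_nonneg hUn hp2.le, ENNReal.ofReal_rpow_of_nonneg hUn' hp2.le,
      ← ENNReal.ofReal_pow (abs_nonneg _), sq_abs, ← ENNReal.ofReal_mul (by positivity),
      ← ENNReal.ofReal_mul (by positivity), ← ENNReal.ofReal_mul (by positivity),
      ← ENNReal.ofReal_add (by positivity) (by positivity), ← ENNReal.ofReal_mul hp1.le]
    refine ENNReal.ofReal_le_ofReal ?_
    -- The weight is shared between the two factors: two powers of |x|^{-b} go to the increment and
    -- p - 2 to u.
    have hw : (‖x‖ ^ (b * p))⁻¹ = (‖x‖ ^ (-b)) ^ 2 * (‖x‖ ^ (-b)) ^ (p - 2) := by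
      rw [← Real.rpow_natCast, ← Real.rpow_mul hx.le, ← Real.rpow_mul hx.le, ← Real.rpow_add hx,
        ← Real.rpow_neg hx.le]
      congr 1
      push_cast
      ring
    have hV : (‖x‖ ^ (-b) * u (shear ζ e t x)) ^ (p - 2) ≤
        C1 ^ (p - 2) * U (shear ζ e t x) ^ (p - 2) := by
      rw [← Real.mul_rpow (by positivity) hUn']
      refine Real.rpow_le_rpow (by positivity) ?_ hp2.le
      rw [hU, ← mul_assoc]
      have := hshear t ht x
      gcongr
    calc r / ‖x‖ ^ (b * p) ≤ ((p - 1) * ((u (shear ζ e t x) - u x) ^ 2 *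
          (u x ^ (p - 2) + u (shear ζ e t x) ^ (p - 2)))) / ‖x‖ ^ (b * p) := by gcongr
      _ = (p - 1) * (δ x ^ 2 * U x ^ (p - 2) +
          δ x ^ 2 * (‖x‖ ^ (-b) * u (shear ζ e t x)) ^ (p - 2)) := by
          rw [div_eq_mul_inv, hw, hδ, hU, Real.mul_rpow (by positivity) h1.le,
            Real.mul_rpow (by positivity) h2.le]
          ring
      _ ≤ (p - 1) * (δ x ^ 2 * U x ^ (p - 2) +
          δ x ^ 2 * (C1 ^ (p - 2) * U (shear ζ e t x) ^ (p - 2))) := by gcongr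
      _ = _ := by ring
  have hm2 : AEMeasurable (fun x => ‖δ x‖ₑ ^ 2 * ‖U1 (shear ζ e t x)‖ₑ ^ (p - 2)) volume :=
    (hδm.enorm.pow_const 2).mul
      ((hU1s.comp_measurable qmp.measurable).aestronglyMeasurable.enorm.pow_const _)
  have hm1 : AEMeasurable (fun x => ‖δ x‖ₑ ^ 2 * ‖U1 x‖ₑ ^ (p - 2)) volume :=
    (hδm.enorm.pow_const 2).mul (hU1s.aestronglyMeasurable.enorm.pow_const _)
  calc _ ≤ ∫⁻ x in Ω, ENNReal.ofReal (p - 1) * (‖δ x‖ₑ ^ 2 * ‖U1 x‖ₑ ^ (p - 2) +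
          ENNReal.ofReal (C1 ^ (p - 2)) * (‖δ x‖ₑ ^ 2 * ‖U1 (shear ζ e t x)‖ₑ ^ (p - 2))) :=
        lintegral_mono_ae pt
    _ ≤ ∫⁻ x, ENNReal.ofReal (p - 1) * (‖δ x‖ₑ ^ 2 * ‖U1 x‖ₑ ^ (p - 2) +
          ENNReal.ofReal (C1 ^ (p - 2)) * (‖δ x‖ₑ ^ 2 * ‖U1 (shear ζ e t x)‖ₑ ^ (p - 2))) :=
        setLIntegral_le_lintegral _ _
    _ = ENNReal.ofReal (p - 1) * ((∫⁻ x, ‖δ x‖ₑ ^ 2 * ‖U1 x‖ₑ ^ (p - 2)) +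
          ENNReal.ofReal (C1 ^ (p - 2)) *
            ∫⁻ x, ‖δ x‖ₑ ^ 2 * ‖U1 (shear ζ e t x)‖ₑ ^ (p - 2)) := by
        rw [lintegral_const_mul' _ _ ENNReal.ofReal_ne_top, lintegral_add_left' hm1,
          lintegral_const_mul' _ _ ENNReal.ofReal_ne_top]
    _ ≤ ENNReal.ofReal (p - 1) * (R + ENNReal.ofReal (C1 ^ (p - 2)) * R) := by gcongr
    _ = ENNReal.ofReal D * R := by
        rw [hD, ENNReal.ofReal_mul hp1.le, ENNReal.ofReal_add zero_le_one (by positivity),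
          ENNReal.ofReal_one]
        ring
    _ = ENNReal.ofReal D * (Cs ^ 2 * 2 ^ (p - 2)) * ENNReal.ofReal ε ^ (p - 2) * A ^ 2 +
        ENNReal.ofReal (D * (T ^ (p - 2) * (B * C2) ^ 2) * t ^ 2) := by
        rw [hR, ← ENNReal.ofReal_pow (by positivity), ← ENNReal.ofReal_mul (by positivity),
          mul_add, ← ENNReal.ofReal_mul hD0, add_comm]
        congr 1
        · ring
        · congr 1
          rw [mul_pow (B * C2), sq_abs]
          ring
    _ ≤ _ := by gcongr

end Remainder

theorem integral_sub_sub {α : Type*} [MeasurableSpace α] {μ : Measure α} {f g h : α → ℝ}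
    (hf : Integrable f μ) (hg : Integrable g μ) (hh : Integrable h μ) :
    ∫ x, (f x - g x - h x) ∂μ = ∫ x, f x ∂μ - ∫ x, g x ∂μ - ∫ x, h x ∂μ := by
  rw [← integral_sub hf hg]
  exact integral_sub (hf.sub hg) hh

/-! ### One-sided energy comparison under shears -/

section EnergyBound

variable {N : ℕ} {Ω : Set (EuclideanSpace ℝ (Fin N))} {a b p c : ℝ}
  {K u v ζ : EuclideanSpace ℝ (Fin N) → ℝ} {e : EuclideanSpace ℝ (Fin N)}
  {g h : EuclideanSpace ℝ (Fin N) → EuclideanSpace ℝ (Fin N)}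
  {φ : ℕ → EuclideanSpace ℝ (Fin N) → ℝ}

theorem norm_rpow_smul_sq (x y : EuclideanSpace ℝ (Fin N)) (a : ℝ) :
    ‖‖x‖ ^ (-a) • y‖ ^ 2 = ‖x‖ ^ (-2 * a) * ‖y‖ ^ 2 := by
  rw [norm_smul, mul_pow, Real.norm_of_nonneg (by positivity), norm_rpow_neg_mul_self, sq (‖x‖ ^ (-a))]

theorem integrable_weighted_sq (hh : MemLp (fun x => ‖x‖ ^ (-a) • h x) 2 volume) :
    Integrable (fun x => ‖x‖ ^ (-2 * a) * ‖h x‖ ^ 2) volume := by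
  have := (memLp_two_iff_integrable_sq_norm hh.1).1 hh
  simpa only [norm_rpow_smul_sq] using this

theorem integral_weighted_sq_eq (hh : MemLp (fun x => ‖x‖ ^ (-a) • h x) 2 volume) :
    ENNReal.ofReal (∫ x, ‖x‖ ^ (-2 * a) * ‖h x‖ ^ 2) =
      eLpNorm (fun x => ‖x‖ ^ (-a) • h x) 2 volume ^ 2 := by
  rw [ofReal_integral_eq_lintegral_ofReal (integrable_weighted_sq hh)
    (Eventually.of_forall fun x => by positivity), eLpNorm_two_sq]
  refine lintegral_congr fun x => ?_
  rw [← norm_rpow_smul_sq, ← ofReal_norm, ENNReal.ofReal_pow (norm_nonneg _)]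

theorem integrableOn_potential (hN : 0 < N) (hp : 0 < p)
    (hv : MemLp (fun x => ‖x‖ ^ (-b) * v x) (ENNReal.ofReal p) volume)
    (hpos : ∀ᵐ x ∂volume.restrict Ω, 0 < v x)
    (hΩ : MeasurableSet Ω) (hK : AEStronglyMeasurable K (volume.restrict Ω)) {M : ℝ}
    (hM : ∀ x ∈ Ω, |K x| ≤ M) :
    IntegrableOn (fun x => K x * (v x ^ p / ‖x‖ ^ (b * p))) Ω volume := by
  have h1 := (hv.restrict Ω).integrable_norm_rpow (by simpa using hp) ENNReal.ofReal_ne_top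
  rw [ENNReal.toReal_ofReal hp.le] at h1
  have h2 : Integrable (fun x => K x * ‖‖x‖ ^ (-b) * v x‖ ^ p) (volume.restrict Ω) := by
    refine (h1.const_mul M).mono' (hK.mul h1.1) ?_
    filter_upwards [ae_restrict_mem hΩ] with x hx
    rw [norm_mul, Real.norm_of_nonneg (by positivity : 0 ≤ ‖‖x‖ ^ (-b) * v x‖ ^ p)]
    exact mul_le_mul_of_nonneg_right (hM x hx) (by positivity)
  refine h2.congr ?_
  filter_upwards [hpos, ae_ne_zero hN _ Measure.absolutelyContinuous_restrict] with x h3 h4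
  rw [rpow_div_eq (norm_pos_iff.2 h4) h3.le, Real.norm_of_nonneg (by positivity)]

/-- The energy of `u` does not decrease, up to `O(t²)`, when `u` is composed with a shear. -/
theorem IsPositiveWeakSolution.exists_energy_comp_shear_ge (hP : CKNParams N a b p)
    (hu : MemD12On Set.univ a u g φ) (hsol : IsPositiveWeakSolution Ω a b p K u g)
    (hΩ : MeasurableSet Ω) (hK : AEStronglyMeasurable K (volume.restrict Ω)) {M : ℝ}
    (hM : ∀ x ∈ Ω, |K x| ≤ M) (hζ : ContDiff ℝ ∞ ζ) (hc : HasCompactSupport ζ)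
    (h0 : (0 : EuclideanSpace ℝ (Fin N)) ∉ tsupport ζ) (hs : tsupport ζ ⊆ Ω)
    (hb : ∀ x, ‖fderiv ℝ ζ x‖ * ‖e‖ ≤ c) :
    ∃ C : ℝ, ∀ t, |t| * c ≤ 1 / 2 →
      (1 / 2 * ∫ x in Ω, ‖x‖ ^ (-2 * a) * ‖g x‖ ^ 2) -
        (1 / p * ∫ x in Ω, K x * (u x ^ p / ‖x‖ ^ (b * p))) - C * t ^ 2 ≤
      (1 / 2 * ∫ x in Ω, ‖x‖ ^ (-2 * a) * ‖shearPullback ζ e t x (g (shear ζ e t x))‖ ^ 2) -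
        1 / p * ∫ x in Ω, K x * (u (shear ζ e t x) ^ p / ‖x‖ ^ (b * p)) := by
  have hN := hP.pos
  have ha := hP.two_mul_lt
  have hp := hP.two_lt
  have hp0 : 0 < p := by linarith
  have hζ1 : ContDiff ℝ 1 ζ := hζ.of_le (by exact_mod_cast le_top)
  obtain ⟨M', hM'0, hM'⟩ : ∃ M' : ℝ, 0 < M' ∧ ∀ x ∈ Ω, |K x| ≤ M' :=
    ⟨max M 1, by positivity, fun x hx => (hM x hx).trans (le_max_left _ _)⟩
  -- With this η, multiplication by the bound M' of |K| gives exactly the coefficient 1/2 of the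
  -- quadratic gradient term that has to absorb the remainder.
  obtain ⟨C, hC0, hC⟩ := hu.exists_lintegral_remainder_le hP hsol.pos hΩ hζ hc h0 hs hb
    (η := 1 / (2 * M')) (by positivity)
  refine ⟨M' * C, fun t ht => ?_⟩
  have hd := hu.comp_shear_sub hζ hc h0 hs hb ht
  obtain ⟨w1, w2, w3⟩ := hsol.weak_eq_memD12On hP hu hΩ hK hM hd
  have hgL := hu.memLp_gradient hN ha
  have hdL := hd.memLp_gradient hN ha
  have hvpos := ae_pos_comp_shear hsol.pos hΩ hζ1 hs hb ht
  set d : EuclideanSpace ℝ (Fin N) → EuclideanSpace ℝ (Fin N) := fun x =>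
    shearPullback ζ e t x (g (shear ζ e t x)) - g x with hd_def
  set v : EuclideanSpace ℝ (Fin N) → ℝ := fun x => u (shear ζ e t x) with hv_def
  have hhL : MemLp (fun x => ‖x‖ ^ (-a) • shearPullback ζ e t x (g (shear ζ e t x))) 2 volume :=
    (hdL.add hgL).ae_eq (Eventually.of_forall fun x => by
      simp only [Pi.add_apply, ← smul_add, sub_add_cancel])
  have huL := (hu.ckn hP).2
  have hvL : MemLp (fun x => ‖x‖ ^ (-b) * v x) (ENNReal.ofReal p) volume :=
    ((hd.ckn hP).2.add huL).ae_eq (Eventually.of_forall fun x => by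
      simp only [Pi.add_apply, hv_def]
      ring)
  have ig := (integrable_weighted_sq hgL).integrableOn (s := Ω)
  have idd : IntegrableOn (fun x => ‖x‖ ^ (-2 * a) * ‖d x‖ ^ 2) Ω volume :=
    (integrable_weighted_sq hdL).integrableOn
  have ih := (integrable_weighted_sq hhL).integrableOn (s := Ω)
  have iu := integrableOn_potential hN hp0 huL hsol.pos hΩ hK hM
  have iv := integrableOn_potential hN hp0 hvL hvpos hΩ hK hM
  set r : EuclideanSpace ℝ (Fin N) → ℝ := fun x => ((v x ^ p - u x ^ p) / p -
        u x ^ (p - 1) * (v x - u x)) / ‖x‖ ^ (b * p) with hr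
  -- Polarization for g + d. By `w3` this integral equals the right-hand side of the weak equation
  -- tested with v - u.
  have e1 : ∫ x in Ω, ‖x‖ ^ (-2 * a) * inner ℝ (g x) (d x) =
      1 / 2 * (∫ x in Ω, ‖x‖ ^ (-2 * a) * ‖shearPullback ζ e t x (g (shear ζ e t x))‖ ^ 2) -
      1 / 2 * (∫ x in Ω, ‖x‖ ^ (-2 * a) * ‖g x‖ ^ 2) -
      1 / 2 * ∫ x in Ω, ‖x‖ ^ (-2 * a) * ‖d x‖ ^ 2 := by
    rw [← integral_const_mul, ← integral_const_mul, ← integral_const_mul,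
      ← integral_sub_sub (ih.const_mul _) (ig.const_mul _) (idd.const_mul _)]
    refine integral_congr_ae (Eventually.of_forall fun x => ?_)
    have : shearPullback ζ e t x (g (shear ζ e t x)) = g x + d x := by
      simp only [hd_def, add_sub_cancel]
    simp only
    rw [this, norm_add_sq_real]
    ring
  have e2 : ∫ x in Ω, K x * r x = 1 / p * (∫ x in Ω, K x * (v x ^ p / ‖x‖ ^ (b * p))) -
      1 / p * (∫ x in Ω, K x * (u x ^ p / ‖x‖ ^ (b * p))) -
      ∫ x in Ω, K x * (u x ^ (p - 1) / ‖x‖ ^ (b * p)) * (v x - u x) := by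
    rw [← integral_const_mul, ← integral_const_mul,
      ← integral_sub_sub (iv.const_mul _) (iu.const_mul _) w2]
    refine integral_congr_ae (Eventually.of_forall fun x => ?_)
    simp only [hr]
    ring
  have e3 : ∫ x in Ω, K x * r x ≤ 1 / 2 * (∫ x in Ω, ‖x‖ ^ (-2 * a) * ‖d x‖ ^ 2) +
      M' * C * t ^ 2 := by
    have hI : (∫ x in Ω, ‖x‖ ^ (-2 * a) * ‖d x‖ ^ 2) = ∫ x, ‖x‖ ^ (-2 * a) * ‖d x‖ ^ 2 := by
      refine setIntegral_eq_integral_of_forall_compl_eq_zero fun x hx => ?_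
      have hx' : x ∉ tsupport ζ := fun h => hx (hs h)
      have : gradient ζ x = 0 := by
        by_contra h
        exact hx' (tsupport_gradient_subset ζ (subset_tsupport _ h))
      simp [hd_def, shear_eq_self hx', shearPullback, this]
    have hI0 : 0 ≤ ∫ x, ‖x‖ ^ (-2 * a) * ‖d x‖ ^ 2 := integral_nonneg fun x => by positivity
    refine le_of_abs_le ?_
    rw [hI, ← Real.norm_eq_abs, ← ENNReal.ofReal_le_ofReal_iff (by positivity), ofReal_norm]
    refine (enorm_integral_le_lintegral_enorm _).trans ?_
    calc ∫⁻ x in Ω, ‖K x * r x‖ₑ ≤ ∫⁻ x in Ω, ENNReal.ofReal M' * ‖r x‖ₑ := by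
          refine setLIntegral_mono' hΩ fun x hx => ?_
          rw [enorm_mul, Real.enorm_eq_ofReal_abs (K x)]
          gcongr
          exact hM' x hx
      _ = ENNReal.ofReal M' * ∫⁻ x in Ω, ‖r x‖ₑ := lintegral_const_mul' _ _ ENNReal.ofReal_ne_top
      _ ≤ ENNReal.ofReal M' * (ENNReal.ofReal (1 / (2 * M')) *
          ENNReal.ofReal (∫ x, ‖x‖ ^ (-2 * a) * ‖d x‖ ^ 2) + ENNReal.ofReal (C * t ^ 2)) := by
          rw [integral_weighted_sq_eq hdL]
          gcongr
          exact hC t ht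
      _ = _ := by
          rw [← ENNReal.ofReal_mul (by positivity), ← ENNReal.ofReal_add (by positivity)
            (by positivity), ← ENNReal.ofReal_mul (by positivity)]
          congr 1
          field_simp
  -- By `e1`, `e2` and the weak equation, E(v) - E(u) = (1/2) ∫ w |d|² - ∫ K r, and `e3` bounds the
  -- last integral.
  linarith

end EnergyBound

/-! ### Inner variations: cutoffs, integrability, stationarity -/

theorem exists_contDiff_eventuallyEq_one {E : Type*} [NormedAddCommGroup E] [NormedSpace ℝ E]
    [FiniteDimensional ℝ E] {S U : Set E} (hS : IsCompact S) (hU : IsOpen U) (h : S ⊆ U) :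
    ∃ χ : E → ℝ, ContDiff ℝ ∞ χ ∧ HasCompactSupport χ ∧ tsupport χ ⊆ U ∧
      (∀ x ∈ S, χ =ᶠ[𝓝 x] fun _ => 1) ∧ ∀ x, χ x ∈ Set.Icc (0 : ℝ) 1 := by
  obtain ⟨L, hL, hSL, hLU⟩ := exists_compact_between hS hU h
  obtain ⟨f, h1, h2, h3⟩ := exists_contMDiffMap_one_nhds_of_subset_interior
    (modelWithCornersSelf ℝ E) (n := ⊤) hS.isClosed hSL
  have hsupp : Function.support f ⊆ L := fun x hx => by
    by_contra h
    exact hx (h2 x h)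
  exact ⟨f, f.contMDiff.contDiff, HasCompactSupport.of_support_subset_isCompact hL hsupp,
    (closure_minimal hsupp hL.isClosed).trans hLU, eventually_nhdsSet_iff_forall.1 h1, h3⟩

section Shear

variable {E : Type*} [NormedAddCommGroup E] [InnerProductSpace ℝ E] [FiniteDimensional ℝ E]
  [MeasurableSpace E] [BorelSpace E] {ζ : E → ℝ} {e : E} {c t : ℝ}

theorem integrable_comp_shear {F : Type*} [NormedAddCommGroup F] (hζ : ContDiff ℝ 1 ζ) (hb : ∀ x, ‖fderiv ℝ ζ x‖ * ‖e‖ ≤ c)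
    (ht : |t| * c ≤ 1 / 2) {q : E → F} (hq : Integrable q volume) :
    Integrable (fun x => q (shear ζ e t x)) volume := by
  have h := memLp_one_iff_integrable.2 hq
  refine memLp_one_iff_integrable.1 ⟨hq.1.comp_quasiMeasurePreserving
    (quasiMeasurePreserving_shear hζ hb ht), ?_⟩
  exact (eLpNorm_comp_shear_le hζ hb ht hq.1 le_rfl).trans_lt
    (ENNReal.mul_lt_top (by norm_num) h.2)

theorem integrable_inner_of_hasCompactSupport {F : Type*} [NormedAddCommGroup F]
    [InnerProductSpace ℝ F] {m q : E → F} (hm : Continuous m)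
    (hmc : HasCompactSupport m) (hq : Integrable q volume) :
    Integrable (fun x => inner ℝ (m x) (q x)) volume :=
  integrable_inner_of_memLp (p := ⊤) (q := 1) (hm.memLp_of_hasCompactSupport hmc)
    (memLp_one_iff_integrable.2 hq)

theorem integrable_inner_shear_deriv {F : Type*} [NormedAddCommGroup F]
    [InnerProductSpace ℝ F] (hζ : ContDiff ℝ 1 ζ) (hζc : HasCompactSupport ζ)
    {m q : E → F} (hm : ContDiff ℝ 1 m) (hmc : HasCompactSupport m) (hq : Integrable q volume) :
    Integrable (fun x => inner ℝ (fderiv ℝ m x (ζ x • e) + fderiv ℝ ζ x e • m x) (q x)) volume := by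
  refine integrable_inner_of_hasCompactSupport ?_ ?_ hq
  · have h1 := hm.continuous_fderiv one_ne_zero
    have h2 := hζ.continuous_fderiv one_ne_zero
    have h3 := hζ.continuous
    have h4 := hm.continuous
    fun_prop
  · refine HasCompactSupport.add ?_ ?_
    · refine hζc.mono fun x hx => ?_
      rw [Function.mem_support] at hx ⊢
      contrapose! hx
      simp [hx]
    · refine hmc.mono fun x hx => ?_
      rw [Function.mem_support] at hx ⊢
      contrapose! hx
      simp [hx]

end Shear

theorem integral_add_add_add {α : Type*} [MeasurableSpace α] {μ : Measure α} {f g h k : α → ℝ}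
    (hf : Integrable f μ) (hg : Integrable g μ) (hh : Integrable h μ) (hk : Integrable k μ) :
    ∫ x, (f x + (g x + (h x + k x))) ∂μ =
      ∫ x, f x ∂μ + (∫ x, g x ∂μ + (∫ x, h x ∂μ + ∫ x, k x ∂μ)) := by
  have h1 := integral_add hf (hg.add (hh.add hk))
  have h2 := integral_add hg (hh.add hk)
  have h3 := integral_add hh hk
  simp only [Pi.add_apply] at h1 h2
  rw [h1, h2, h3]

section InnerVariation

variable {N : ℕ} {Ω : Set (EuclideanSpace ℝ (Fin N))} {a b p : ℝ}
  {K u v ζ : EuclideanSpace ℝ (Fin N) → ℝ} 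
  {g h : EuclideanSpace ℝ (Fin N) → EuclideanSpace ℝ (Fin N)}
  {φ : ℕ → EuclideanSpace ℝ (Fin N) → ℝ}

theorem integrableOn_of_norm_rpow_smul {F : Type*} [NormedAddCommGroup F] [NormedSpace ℝ F]
    {S : Set (EuclideanSpace ℝ (Fin N))} (hS : IsCompact S)
    (h0 : (0 : EuclideanSpace ℝ (Fin N)) ∉ S) {s : ℝ} {f : EuclideanSpace ℝ (Fin N) → F}
    (hf : IntegrableOn (fun x => ‖x‖ ^ s • f x) S volume) : IntegrableOn f S volume := by
  have hc : ContinuousOn (fun x : EuclideanSpace ℝ (Fin N) => ‖x‖ ^ (-s)) S := fun x hx =>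
    (contDiffAt_norm_rpow (n := 1) (-s) (fun h => h0 (h ▸ hx))).continuousAt.continuousWithinAt
  refine (hf.continuousOn_smul hc hS).congr_fun (fun x hx => ?_) hS.measurableSet
  have hx' : 0 < ‖x‖ := norm_pos_iff.2 (fun h => h0 (h ▸ hx))
  simp only
  rw [smul_smul, ← Real.rpow_add hx', neg_add_cancel, Real.rpow_zero, one_smul]

theorem contDiff_mul_of_tsupport_subset {χ : EuclideanSpace ℝ (Fin N) → ℝ} {k : WithTop ℕ∞}
    (hΩ : IsOpen Ω) (hχ : ContDiff ℝ k χ) (hs : tsupport χ ⊆ Ω) (hK : ContDiffOn ℝ k K Ω) :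
    ContDiff ℝ k (fun x => χ x * K x) := by
  rw [contDiff_iff_contDiffAt]
  intro x
  by_cases hx : x ∈ tsupport χ
  · exact hχ.contDiffAt.mul (hK.contDiffAt (hΩ.mem_nhds (hs hx)))
  · rw [notMem_tsupport_iff_eventuallyEq] at hx
    refine (contDiffAt_const (c := (0 : ℝ))).congr_of_eventuallyEq ?_
    filter_upwards [hx] with y hy
    simp [hy]

theorem contDiff_gradient {ζ : EuclideanSpace ℝ (Fin N) → ℝ} (hζ : ContDiff ℝ ∞ ζ) :
    ContDiff ℝ 1 (gradient ζ) :=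
  (LinearIsometryEquiv.contDiff _).comp
    ((contDiff_infty.1 hζ 2).fderiv_right (m := 1)
      (by norm_num [one_add_one_eq_two]))

theorem gradient_eq_zero_of_notMem_tsupport {x : EuclideanSpace ℝ (Fin N)} (hx : x ∉ tsupport ζ) :
    gradient ζ x = 0 := by
  by_contra h
  exact hx (tsupport_gradient_subset ζ (subset_tsupport _ h))

/-- Stationarity of the energy under inner variations in the direction `e`. -/
theorem IsPositiveWeakSolution.inner_variation (hP : CKNParams N a b p)
    (hu : MemD12On Set.univ a u g φ) (hsol : IsPositiveWeakSolution Ω a b p K u g)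
    (hΩ : IsOpen Ω) (hK : ContDiffOn ℝ 1 K Ω) {M : ℝ}
    (hM : ∀ x ∈ Ω, |K x| ≤ M) (hζ : ContDiff ℝ ∞ ζ) (hc : HasCompactSupport ζ)
    (h0 : (0 : EuclideanSpace ℝ (Fin N)) ∉ tsupport ζ) (hs : tsupport ζ ⊆ Ω)
    (e : EuclideanSpace ℝ (Fin N)) :
    IntegrableOn (fun x => ‖x‖ ^ (-2 * a) * (inner ℝ e (g x) * inner ℝ (g x) (gradient ζ x)) -
      1 / 2 * ‖g x‖ ^ 2 * (fderiv ℝ (fun y => ‖y‖ ^ (-2 * a)) x e * ζ x +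
        fderiv ℝ ζ x e * ‖x‖ ^ (-2 * a)) +
      1 / p * u x ^ p * (fderiv ℝ (fun y => ‖y‖ ^ (-(b * p)) * K y) x e * ζ x +
        fderiv ℝ ζ x e * (‖x‖ ^ (-(b * p)) * K x))) Ω volume ∧
    ∫ x in Ω, (‖x‖ ^ (-2 * a) * (inner ℝ e (g x) * inner ℝ (g x) (gradient ζ x)) -
      1 / 2 * ‖g x‖ ^ 2 * (fderiv ℝ (fun y => ‖y‖ ^ (-2 * a)) x e * ζ x +
        fderiv ℝ ζ x e * ‖x‖ ^ (-2 * a)) +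
      1 / p * u x ^ p * (fderiv ℝ (fun y => ‖y‖ ^ (-(b * p)) * K y) x e * ζ x +
        fderiv ℝ ζ x e * (‖x‖ ^ (-(b * p)) * K x))) = 0 := by
  have hN := hP.pos
  have ha := hP.two_mul_lt
  have hp := hP.two_lt
  have hp0 : 0 < p := by linarith
  have hζ1 : ContDiff ℝ 1 ζ := hζ.of_le (by exact_mod_cast le_top)
  have hKm : AEStronglyMeasurable K (volume.restrict Ω) :=
    hK.continuousOn.aestronglyMeasurable hΩ.measurableSet
  obtain ⟨c1, hc1⟩ := (hc.fderiv (𝕜 := ℝ)).exists_bound_of_continuous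
    (hζ1.continuous_fderiv one_ne_zero)
  set c := c1 * ‖e‖ with hcdef
  have hb : ∀ x, ‖fderiv ℝ ζ x‖ * ‖e‖ ≤ c := fun x =>
    mul_le_mul_of_nonneg_right (hc1 x) (norm_nonneg _)
  obtain ⟨C, hC⟩ := hsol.exists_energy_comp_shear_ge hP hu hΩ.measurableSet hKm hM hζ hc h0 hs hb
  have hgL := hu.memLp_gradient hN ha
  have huL := (hu.ckn hP).2
  set S := tsupport ζ with hS
  have hScomp : IsCompact S := hc.isCompact
  have hSm : MeasurableSet S := hScomp.measurableSet
  -- χ is 1 near the support of ζ and lives in Ω \ {0}. Multiplied by χ, the weights and K become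
  -- compactly supported C¹ functions on the whole space, as `hasDerivAt_integral_inner_comp_shear`
  -- requires.
  obtain ⟨χ, χ1, χ2, χ3, χ4, χ5⟩ := exists_contDiff_eventuallyEq_one hScomp
    (hΩ.sdiff (isClosed_singleton (x := (0 : EuclideanSpace ℝ (Fin N)))))
    (fun x hx => ⟨hs hx, fun h => h0 (by rw [← Set.mem_singleton_iff.1 h]; exact hx)⟩)
  have χ1' : ContDiff ℝ 1 χ := χ1.of_le (by exact_mod_cast le_top)
  have χ0 : (0 : EuclideanSpace ℝ (Fin N)) ∉ tsupport χ := fun h => (χ3 h).2 rfl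
  have χS : ∀ x ∈ S, χ x = 1 := fun x hx => (χ4 x hx).eq_of_nhds
  have χΩ : tsupport χ ⊆ Ω := fun x hx => (χ3 hx).1
  set m1 : EuclideanSpace ℝ (Fin N) → ℝ := fun x => ‖x‖ ^ (-2 * a) * χ x with hm1
  set m2 : EuclideanSpace ℝ (Fin N) → EuclideanSpace ℝ (Fin N) := fun x => m1 x • gradient ζ x
    with hm2
  set m3 : EuclideanSpace ℝ (Fin N) → ℝ := fun x => m1 x * ‖gradient ζ x‖ ^ 2 with hm3
  set m4 : EuclideanSpace ℝ (Fin N) → ℝ := fun x => ‖x‖ ^ (-(b * p)) * (χ x * K x) with hm4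
  have hm1d : ContDiff ℝ 1 m1 := contDiff_norm_rpow_mul _ χ1' χ0
  have hm2d : ContDiff ℝ 1 m2 := hm1d.smul (contDiff_gradient hζ)
  have hm3d : ContDiff ℝ 1 m3 := hm1d.mul ((contDiff_gradient hζ).norm_sq ℝ)
  have hm4d : ContDiff ℝ 1 m4 := contDiff_norm_rpow_mul _
    (contDiff_mul_of_tsupport_subset hΩ χ1' χΩ hK) (fun h => χ0 (tsupport_mul_subset_left h))
  have hm1c : HasCompactSupport m1 := χ2.mul_left
  have hm2c : HasCompactSupport m2 := hm1c.smul_right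
  have hm3c : HasCompactSupport m3 := hm1c.mul_right
  have hm4c : HasCompactSupport m4 := χ2.mul_right.mul_left
  set q1 : EuclideanSpace ℝ (Fin N) → ℝ := S.indicator fun x => ‖g x‖ ^ 2 with hq1
  set q2 : EuclideanSpace ℝ (Fin N) → EuclideanSpace ℝ (Fin N) :=
    S.indicator fun x => (inner ℝ e (g x) : ℝ) • g x with hq2
  set q3 : EuclideanSpace ℝ (Fin N) → ℝ := S.indicator fun x => (inner ℝ e (g x)) ^ 2 with hq3
  set q4 : EuclideanSpace ℝ (Fin N) → ℝ := S.indicator fun x => u x ^ p with hq4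
  have hgS : IntegrableOn (fun x => ‖g x‖ ^ 2) S volume :=
    integrableOn_of_norm_rpow_smul hScomp h0 (integrable_weighted_sq hgL).integrableOn
  have hgm := hu.measurable_gradient
  have i1 : Integrable q1 volume := hgS.integrable_indicator hSm
  have i2 : Integrable q2 volume := by
    refine IntegrableOn.integrable_indicator ?_ hSm
    refine (hgS.const_mul ‖e‖).mono'
      (((aestronglyMeasurable_const (b := e)).inner (𝕜 := ℝ) hgm).smul hgm :).restrict
      (Eventually.of_forall fun x => ?_)
    rw [norm_smul, sq, ← mul_assoc]
    have := norm_inner_le_norm (𝕜 := ℝ) e (g x)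
    gcongr
  have i3 : Integrable q3 volume := by
    refine IntegrableOn.integrable_indicator ?_ hSm
    refine (hgS.const_mul (‖e‖ ^ 2)).mono' ((aestronglyMeasurable_const.inner hgm).pow 2).restrict
      (Eventually.of_forall fun x => ?_)
    rw [norm_pow, ← mul_pow]
    have := norm_inner_le_norm (𝕜 := ℝ) e (g x)
    gcongr
  have i4 : Integrable q4 volume := by
    refine IntegrableOn.integrable_indicator ?_ hSm
    refine integrableOn_of_norm_rpow_smul (s := -(b * p)) hScomp h0 ?_
    have := integrableOn_potential (K := fun _ => 1) (M := 1) hN hp0 huL hsol.pos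
      hΩ.measurableSet aestronglyMeasurable_const (by simp)
    refine (this.mono_set hs).congr (Eventually.of_forall fun x => ?_)
    simp only [smul_eq_mul, one_mul]
    rw [Real.rpow_neg (norm_nonneg x), div_eq_inv_mul]
  -- The part of the energy that depends on t. The squared norm of the pulled back gradient is a
  -- quadratic polynomial in t, with coefficients m1 q1, 2 m2 q2 and m3 q3 evaluated along the
  -- shear. Outside S nothing moves.
  set J : ℝ → ℝ := fun t =>
    1 / 2 * ((∫ x, inner ℝ (m1 x) (q1 (shear ζ e t x))) +
      2 * (t * ∫ x, inner ℝ (m2 x) (q2 (shear ζ e t x))) +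
      t ^ 2 * ∫ x, inner ℝ (m3 x) (q3 (shear ζ e t x))) -
    1 / p * ∫ x, inner ℝ (m4 x) (q4 (shear ζ e t x)) with hJ
  have key : ∀ t, |t| * c ≤ 1 / 2 →
      (1 / 2 * ∫ x in Ω, ‖x‖ ^ (-2 * a) * ‖shearPullback ζ e t x (g (shear ζ e t x))‖ ^ 2) -
        1 / p * ∫ x in Ω, K x * (u (shear ζ e t x) ^ p / ‖x‖ ^ (b * p)) =
      1 / 2 * (∫ x in Ω, Sᶜ.indicator (fun x => ‖x‖ ^ (-2 * a) * ‖g x‖ ^ 2) x) -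
        1 / p * (∫ x in Ω, Sᶜ.indicator (fun x => K x * (u x ^ p / ‖x‖ ^ (b * p))) x) + J t := by
    intro t ht
    have hζ0 : ∀ x, x ∉ S → shear ζ e t x ∉ S := fun x hx h =>
      hx ((shear_mem_tsupport_iff hζ1 hb ht x).1 h)
    have hin : ∀ {x}, x ∈ S → shear ζ e t x ∈ S := fun {x} hx =>
      (shear_mem_tsupport_iff hζ1 hb ht x).2 hx
    have j1 := integrable_inner_of_hasCompactSupport hm1d.continuous hm1c
      (integrable_comp_shear hζ1 hb ht i1)
    have j2 := integrable_inner_of_hasCompactSupport hm2d.continuous hm2c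
      (integrable_comp_shear hζ1 hb ht i2)
    have j3 := integrable_inner_of_hasCompactSupport hm3d.continuous hm3c
      (integrable_comp_shear hζ1 hb ht i3)
    have j4 := integrable_inner_of_hasCompactSupport hm4d.continuous hm4c
      (integrable_comp_shear hζ1 hb ht i4)
    have j5 : IntegrableOn (Sᶜ.indicator (fun x => ‖x‖ ^ (-2 * a) * ‖g x‖ ^ 2)) Ω volume :=
      ((integrable_weighted_sq hgL).indicator hSm.compl).integrableOn
    have j6 : IntegrableOn (Sᶜ.indicator (fun x => K x * (u x ^ p / ‖x‖ ^ (b * p)))) Ω volume :=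
      (integrableOn_potential hN hp0 huL hsol.pos hΩ.measurableSet hKm hM).indicator hSm.compl
    have r1 := setIntegral_eq_integral_of_forall_compl_eq_zero (μ := volume) (s := Ω)
      (f := fun x => inner ℝ (m1 x) (q1 (shear ζ e t x))) (fun x hx => by
        simp [hq1, hζ0 x fun h => hx (hs h)])
    have r2 := setIntegral_eq_integral_of_forall_compl_eq_zero (μ := volume) (s := Ω)
      (f := fun x => inner ℝ (m2 x) (q2 (shear ζ e t x))) (fun x hx => by
        simp [hq2, hζ0 x fun h => hx (hs h)])
    have r3 := setIntegral_eq_integral_of_forall_compl_eq_zero (μ := volume) (s := Ω)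
      (f := fun x => inner ℝ (m3 x) (q3 (shear ζ e t x))) (fun x hx => by
        simp [hq3, hζ0 x fun h => hx (hs h)])
    have r4 := setIntegral_eq_integral_of_forall_compl_eq_zero (μ := volume) (s := Ω)
      (f := fun x => inner ℝ (m4 x) (q4 (shear ζ e t x))) (fun x hx => by
        simp [hq4, hζ0 x fun h => hx (hs h)])
    have s1 : ∫ x in Ω, ‖x‖ ^ (-2 * a) * ‖shearPullback ζ e t x (g (shear ζ e t x))‖ ^ 2 =
        (∫ x in Ω, Sᶜ.indicator (fun x => ‖x‖ ^ (-2 * a) * ‖g x‖ ^ 2) x) +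
        ((∫ x, inner ℝ (m1 x) (q1 (shear ζ e t x))) +
        ((2 * t) * (∫ x, inner ℝ (m2 x) (q2 (shear ζ e t x))) +
        t ^ 2 * ∫ x, inner ℝ (m3 x) (q3 (shear ζ e t x)))) := by
      rw [← r1, ← r2, ← r3, ← integral_const_mul, ← integral_const_mul,
        ← integral_add_add_add j5 j1.integrableOn (j2.integrableOn.const_mul _)
          (j3.integrableOn.const_mul _)]
      refine integral_congr_ae (Eventually.of_forall fun x => ?_)
      by_cases hx : x ∈ S
      · simp only [hq1, hq2, hq3, Set.indicator_of_mem (hin hx),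
          Set.indicator_of_notMem (Set.notMem_compl_iff.2 hx), hm1, hm2, hm3, χS x hx,
          shearPullback, RCLike.inner_apply, conj_trivial, real_inner_smul_left,
          real_inner_smul_right, norm_add_sq_real, norm_smul, mul_pow, Real.norm_eq_abs, sq_abs]
        rw [real_inner_comm (gradient ζ x)]
        ring
      · simp [hq1, hq2, hq3, hx, shear_eq_self hx, shearPullback,
          gradient_eq_zero_of_notMem_tsupport hx]
    have s2 : ∫ x in Ω, K x * (u (shear ζ e t x) ^ p / ‖x‖ ^ (b * p)) =
        (∫ x in Ω, Sᶜ.indicator (fun x => K x * (u x ^ p / ‖x‖ ^ (b * p))) x) +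
        ∫ x, inner ℝ (m4 x) (q4 (shear ζ e t x)) := by
      rw [← r4, ← integral_add j6 j4.integrableOn]
      refine integral_congr_ae (Eventually.of_forall fun x => ?_)
      by_cases hx : x ∈ S
      · simp only [hq4, Set.indicator_of_mem (hin hx),
          Set.indicator_of_notMem (Set.notMem_compl_iff.2 hx), hm4, χS x hx,
          RCLike.inner_apply, conj_trivial, Real.rpow_neg (norm_nonneg x)]
        ring
      · simp [hq4, hx, shear_eq_self hx]
    rw [s1, s2, hJ]
    ring
  have hJ' : HasDerivAt J (1 / 2 * ((-∫ x, inner ℝ (fderiv ℝ m1 x (ζ x • e) +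
      fderiv ℝ ζ x e • m1 x) (q1 x)) + 2 * ∫ x, inner ℝ (m2 x) (q2 x)) -
      1 / p * (-∫ x, inner ℝ (fderiv ℝ m4 x (ζ x • e) + fderiv ℝ ζ x e • m4 x) (q4 x))) 0 := by
    have k1 := hasDerivAt_integral_inner_comp_shear (e := e) hζ1 hc hm1d hm1c i1
    have k2 := hasDerivAt_integral_inner_comp_shear (e := e) hζ1 hc hm2d hm2c i2
    have k3 := hasDerivAt_integral_inner_comp_shear (e := e) hζ1 hc hm3d hm3c i3
    have k4 := hasDerivAt_integral_inner_comp_shear (e := e) hζ1 hc hm4d hm4c i4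
    have k := (((k1.add (((hasDerivAt_id' (0 : ℝ)).mul k2).const_mul 2)).add
      (((hasDerivAt_id' (0 : ℝ)).pow 2).mul k3)).const_mul (1 / 2)).sub (k4.const_mul (1 / p))
    have h5 : ∀ x, shear ζ e 0 x = x := fun x => by simp [shear]
    refine HasDerivAt.congr_deriv k ?_
    simp only [h5, one_mul, zero_mul, add_zero, Pi.pow_apply, ne_eq, OfNat.ofNat_ne_zero,
      not_false_eq_true, zero_pow, Nat.reduceSub, pow_one, mul_zero]
  -- The energy bound is one-sided but holds for both signs of t, so J(t) + C t² is minimal at 0. As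
  -- C t² has zero derivative there, J'(0) = 0.
  have hmin : IsLocalMin (fun t => J t + C * t ^ 2) 0 := by
    have hnear : ∀ᶠ t : ℝ in 𝓝 0, |t| * c ≤ 1 / 2 := by
      have : Tendsto (fun t : ℝ => |t| * c) (𝓝 0) (𝓝 0) := by
        have : Continuous (fun t : ℝ => |t| * c) := by fun_prop
        simpa using this.tendsto 0
      exact this.eventually (ge_mem_nhds (by norm_num))
    filter_upwards [hnear] with t ht
    have h1 := hC t ht
    have h2 := key t ht
    have h3 := key 0 (by simp)
    have h4 : ∀ x ξ, shearPullback ζ e 0 x ξ = ξ := fun x ξ => by simp [shearPullback]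
    have h5 : ∀ x, shear ζ e 0 x = x := fun x => by simp [shear]
    simp only [h4, h5] at h3
    have h6 : C * (0 : ℝ) ^ 2 = 0 := by simp
    linarith
  have hsq : HasDerivAt (fun t : ℝ => C * t ^ 2) 0 0 := by
    simpa using ((hasDerivAt_id' (0 : ℝ)).fun_pow 2).const_mul C
  have hzero := hmin.hasDerivAt_eq_zero (hJ'.add hsq)
  rw [add_zero] at hzero
  have d1 := integrable_inner_shear_deriv (e := e) hζ1 hc hm1d hm1c i1
  have d2 := integrable_inner_of_hasCompactSupport hm2d.continuous hm2c i2
  have d4 := integrable_inner_shear_deriv (e := e) hζ1 hc hm4d hm4c i4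
  have hint : ∀ x, ‖x‖ ^ (-2 * a) * (inner ℝ e (g x) * inner ℝ (g x) (gradient ζ x)) -
      1 / 2 * ‖g x‖ ^ 2 * (fderiv ℝ (fun y => ‖y‖ ^ (-2 * a)) x e * ζ x +
        fderiv ℝ ζ x e * ‖x‖ ^ (-2 * a)) +
      1 / p * u x ^ p * (fderiv ℝ (fun y => ‖y‖ ^ (-(b * p)) * K y) x e * ζ x +
        fderiv ℝ ζ x e * (‖x‖ ^ (-(b * p)) * K x)) =
      inner ℝ (m2 x) (q2 x) -
      1 / 2 * inner ℝ (fderiv ℝ m1 x (ζ x • e) + fderiv ℝ ζ x e • m1 x) (q1 x) +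
      1 / p * inner ℝ (fderiv ℝ m4 x (ζ x • e) + fderiv ℝ ζ x e • m4 x) (q4 x) := by
    intro x
    by_cases hx : x ∈ S
    · have f1 : fderiv ℝ m1 x = fderiv ℝ (fun y => ‖y‖ ^ (-2 * a)) x := by
        refine Filter.EventuallyEq.fderiv_eq ?_
        filter_upwards [χ4 x hx] with y hy
        simp [hm1, hy]
      have f4 : fderiv ℝ m4 x = fderiv ℝ (fun y => ‖y‖ ^ (-(b * p)) * K y) x := by
        refine Filter.EventuallyEq.fderiv_eq ?_
        filter_upwards [χ4 x hx] with y hy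
        simp [hm4, hy]
      rw [f1, f4]
      simp only [hq1, hq2, hq4, Set.indicator_of_mem hx, hm1, hm2, hm4, χS x hx,
        RCLike.inner_apply, conj_trivial, real_inner_smul_left, real_inner_smul_right, map_smul,
        smul_eq_mul]
      rw [real_inner_comm (gradient ζ x)]
      ring
    · have h1 : ζ x = 0 := image_eq_zero_of_notMem_tsupport hx
      have h2 := gradient_eq_zero_of_notMem_tsupport hx
      have h3 : fderiv ℝ ζ x e = 0 := by rw [← inner_gradient_eq, h2, inner_zero_left]
      simp [h1, h2, h3, hm2]
  have hI := (d2.sub (d1.const_mul (1 / 2))).add (d4.const_mul (1 / p))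
  refine ⟨(hI.integrableOn (s := Ω)).congr (Eventually.of_forall fun x => (hint x).symm), ?_⟩
  rw [setIntegral_eq_integral_of_forall_compl_eq_zero]
  · rw [integral_congr_ae (Eventually.of_forall hint)]
    have h1 := integral_add (d2.sub (d1.const_mul (1 / 2))) (d4.const_mul (1 / p))
    have h2 := integral_sub d2 (d1.const_mul (1 / 2))
    simp only [Pi.sub_apply, integral_const_mul] at h1 h2
    rw [h1, h2]
    linarith
  · intro x hx
    have hx' : x ∉ S := fun h => hx (hs h)
    have h1 : ζ x = 0 := image_eq_zero_of_notMem_tsupport hx'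
    have h2 := gradient_eq_zero_of_notMem_tsupport hx'
    have h3 : fderiv ℝ ζ x e = 0 := by rw [← inner_gradient_eq, h2, inner_zero_left]
    simp [h1, h2, h3]

end InnerVariation

/-! ### The Pohozaev field and its weak divergence -/

section Pohozaev

variable {N : ℕ} {Ω : Set (EuclideanSpace ℝ (Fin N))} {a b p : ℝ}
  {K u ζ : EuclideanSpace ℝ (Fin N) → ℝ}
  {g : EuclideanSpace ℝ (Fin N) → EuclideanSpace ℝ (Fin N)}
  {φ : ℕ → EuclideanSpace ℝ (Fin N) → ℝ}

/-- The vector field whose flux through the boundary gives the boundary terms of the Pohozaev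
identity. -/
def pohozaevField (a b p : ℝ) (K u : EuclideanSpace ℝ (Fin N) → ℝ)
    (g : EuclideanSpace ℝ (Fin N) → EuclideanSpace ℝ (Fin N)) (x : EuclideanSpace ℝ (Fin N)) :
    EuclideanSpace ℝ (Fin N) :=
  (‖x‖ ^ (-2 * a) * inner ℝ x (g x)) • g x - (1 / 2 * (‖x‖ ^ (-2 * a) * ‖g x‖ ^ 2)) • x +
    (1 / p * (K x * (u x ^ p / ‖x‖ ^ (b * p)))) • x +
    (((N : ℝ) - 2 - 2 * a) / 2 * (‖x‖ ^ (-2 * a) * u x)) • g x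

/-- The divergence of the field `pohozaevField`. -/
def pohozaevSource (b p : ℝ) (K u : EuclideanSpace ℝ (Fin N) → ℝ) (x : EuclideanSpace ℝ (Fin N)) :
    ℝ :=
  1 / p * (inner ℝ (gradient K x) x * (u x ^ p / ‖x‖ ^ (b * p)))

theorem sum_inner_mul_apply (L : EuclideanSpace ℝ (Fin N) →L[ℝ] ℝ) (x : EuclideanSpace ℝ (Fin N)) :
    ∑ i, inner ℝ (EuclideanSpace.basisFun (Fin N) ℝ i) x * L (EuclideanSpace.basisFun (Fin N) ℝ i) =
      L x := by
  conv_rhs => rw [← (EuclideanSpace.basisFun (Fin N) ℝ).sum_repr' x]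
  simp only [map_sum, map_smul, smul_eq_mul]

theorem fderiv_norm_rpow_apply_self (s : ℝ) {x : EuclideanSpace ℝ (Fin N)} (hx : x ≠ 0) :
    fderiv ℝ (fun y => ‖y‖ ^ s) x x = s * ‖x‖ ^ s := by
  rw [(hasFDerivAt_norm_rpow_of_ne_zero s hx).fderiv]
  simp only [smul_apply, innerSL_apply_apply, real_inner_self_eq_norm_sq, smul_eq_mul]
  rw [mul_assoc, ← Real.rpow_natCast, ← Real.rpow_add (norm_pos_iff.2 hx)]
  norm_num

theorem fderiv_norm_rpow_mul_apply_self (s : ℝ) {x : EuclideanSpace ℝ (Fin N)} (hx : x ≠ 0)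
    (hK : DifferentiableAt ℝ K x) :
    fderiv ℝ (fun y => ‖y‖ ^ s * K y) x x =
      ‖x‖ ^ s * (inner ℝ (gradient K x) x + s * K x) := by
  rw [fderiv_fun_mul (hasFDerivAt_norm_rpow_of_ne_zero s hx).differentiableAt hK]
  simp only [add_apply, smul_apply, smul_eq_mul, fderiv_norm_rpow_apply_self s hx,
    inner_gradient_eq]
  ring

/-- The distributional divergence of `pohozaevField` in the punctured domain. -/
theorem IsPositiveWeakSolution.integral_inner_pohozaevField (hP : CKNParams N a b p)
    (hu : MemD12On Set.univ a u g φ) (hsol : IsPositiveWeakSolution Ω a b p K u g)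
    (hΩ : IsOpen Ω) (hK : ContDiffOn ℝ 1 K Ω) {M : ℝ}
    (hM : ∀ x ∈ Ω, |K x| ≤ M) (hζ : ContDiff ℝ ∞ ζ) (hc : HasCompactSupport ζ)
    (h0 : (0 : EuclideanSpace ℝ (Fin N)) ∉ tsupport ζ) (hs : tsupport ζ ⊆ Ω) :
    ∫ x in Ω, (inner ℝ (pohozaevField a b p K u g x) (gradient ζ x) +
      pohozaevSource b p K u x * ζ x) = 0 := by
  have hN := hP.pos
  have hp := hP.two_lt
  have hζ1 : ContDiff ℝ 1 ζ := hζ.of_le (by exact_mod_cast le_top)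
  have hKm : AEStronglyMeasurable K (volume.restrict Ω) :=
    hK.continuousOn.aestronglyMeasurable hΩ.measurableSet
  set B := EuclideanSpace.basisFun (Fin N) ℝ with hB
  have hη : ∀ i, ContDiff ℝ ∞ (fun x => ζ x * inner ℝ (B i) x) := fun i =>
    hζ.mul (contDiff_const.inner ℝ contDiff_id)
  have hηs : ∀ i, tsupport (fun x => ζ x * inner ℝ (B i) x) ⊆ tsupport ζ := fun i =>
    tsupport_mul_subset_left
  -- The cutoffs ζ x_i in the directions e_i add up to the deformation field ζ(x) x, a localized
  -- dilation.
  have hv := fun i => hsol.inner_variation hP hu hΩ hK hM (hη i) hc.mul_right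
    (fun h => h0 (hηs i h)) ((hηs i).trans hs) (B i)
  obtain ⟨w1, w2, w3⟩ := hsol.weak_eq_memD12On hP hu hΩ.measurableSet hKm hM
    (hu.mul hN hP.lt hζ hc hs)
  set G : Fin N → EuclideanSpace ℝ (Fin N) → ℝ := fun i x =>
    ‖x‖ ^ (-2 * a) * (inner ℝ (B i) (g x) *
        inner ℝ (g x) (gradient (fun x => ζ x * inner ℝ (B i) x) x)) -
      1 / 2 * ‖g x‖ ^ 2 * (fderiv ℝ (fun y => ‖y‖ ^ (-2 * a)) x (B i) *
          (ζ x * inner ℝ (B i) x) +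
        fderiv ℝ (fun x => ζ x * inner ℝ (B i) x) x (B i) * ‖x‖ ^ (-2 * a)) +
      1 / p * u x ^ p * (fderiv ℝ (fun y => ‖y‖ ^ (-(b * p)) * K y) x (B i) *
          (ζ x * inner ℝ (B i) x) +
        fderiv ℝ (fun x => ζ x * inner ℝ (B i) x) x (B i) * (‖x‖ ^ (-(b * p)) * K x)) with hG
  have hsum : ∫ x in Ω, ∑ i, G i x = 0 := by
    rw [integral_finsetSum _ fun i _ => (hv i).1]
    exact Finset.sum_eq_zero fun i _ => (hv i).2
  have hsumi : IntegrableOn (fun x => ∑ i, G i x) Ω volume :=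
    integrable_finsetSum _ fun i _ => (hv i).1
  set γ := ((N : ℝ) - 2 - 2 * a) / 2 with hγ
  -- The sum of the inner variations is corrected by γ times the weak equation tested with ζ u. The
  -- sum contains w |g|² ζ with coefficient 1 + a - N/2 = -γ, so the correction cancels it.
  have pt : ∀ᵐ x ∂volume.restrict Ω, inner ℝ (pohozaevField a b p K u g x) (gradient ζ x) +
      pohozaevSource b p K u x * ζ x = ∑ i, G i x - (-γ) * (‖x‖ ^ (-2 * a) *
        inner ℝ (g x) (ζ x • g x + u x • gradient ζ x)) -
      γ * (K x * (u x ^ (p - 1) / ‖x‖ ^ (b * p)) * (ζ x * u x)) := by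
    filter_upwards [hsol.pos, ae_ne_zero hN _ Measure.absolutelyContinuous_restrict,
      ae_restrict_mem hΩ.measurableSet] with x h1 h2 h3
    have hKd : DifferentiableAt ℝ K x :=
      (hK.contDiffAt (hΩ.mem_nhds h3)).differentiableAt one_ne_zero
    have hζd : DifferentiableAt ℝ ζ x := hζ1.differentiable one_ne_zero x
    have hBd : ∀ i, HasFDerivAt (fun x => (inner ℝ (B i) x : ℝ)) (innerSL ℝ (B i)) x := fun i =>
      (innerSL ℝ (B i)).hasFDerivAt
    have hf : ∀ i, fderiv ℝ (fun x => ζ x * inner ℝ (B i) x) x =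
        ζ x • innerSL ℝ (B i) + (inner ℝ (B i) x : ℝ) • fderiv ℝ ζ x := fun i =>
      (hζd.hasFDerivAt.mul (hBd i)).fderiv
    have hgr : ∀ i, inner ℝ (g x) (gradient (fun x => ζ x * inner ℝ (B i) x) x) =
        ζ x * inner ℝ (B i) (g x) + inner ℝ (B i) x * inner ℝ (g x) (gradient ζ x) := fun i => by
      rw [real_inner_comm, inner_gradient_eq, hf, real_inner_comm (gradient ζ x), inner_gradient_eq]
      simp
    have hBB : ∀ i, inner ℝ (B i) (B i) = (1 : ℝ) := fun i => by
      rw [real_inner_self_eq_norm_sq, B.norm_eq_one]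
      norm_num
    have s1 : ∑ i, inner ℝ (B i) (g x) * inner ℝ (B i) (g x) = ‖g x‖ ^ 2 := by
      have := sum_inner_mul_apply (innerSL ℝ (g x)) (g x)
      simp only [innerSL_apply_apply, real_inner_self_eq_norm_sq] at this
      rw [← this]
      exact Finset.sum_congr rfl fun i _ => by rw [real_inner_comm (g x)]
    have s2 : ∑ i, inner ℝ (B i) x * inner ℝ (B i) (g x) = inner ℝ x (g x) := by
      have := sum_inner_mul_apply (innerSL ℝ (g x)) x
      simp only [innerSL_apply_apply] at this
      rw [real_inner_comm (g x) x, ← this]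
      exact Finset.sum_congr rfl fun i _ => by rw [real_inner_comm (g x)]
    have s3 := sum_inner_mul_apply (fderiv ℝ (fun y => ‖y‖ ^ (-2 * a)) x) x
    have s4 := sum_inner_mul_apply (fderiv ℝ (fun y => ‖y‖ ^ (-(b * p)) * K y) x) x
    have s5 := sum_inner_mul_apply (fderiv ℝ ζ x) x
    rw [fderiv_norm_rpow_apply_self _ h2] at s3
    rw [fderiv_norm_rpow_mul_apply_self _ h2 hKd] at s4
    have s6 : ∑ i, fderiv ℝ (fun x => ζ x * inner ℝ (B i) x) x (B i) =
        N * ζ x + fderiv ℝ ζ x x := by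
      simp only [hf, add_apply, smul_apply, smul_eq_mul, innerSL_apply_apply, hBB, mul_one]
      rw [Finset.sum_add_distrib, s5]
      simp
    have hGs : ∑ i, G i x = ‖x‖ ^ (-2 * a) * (ζ x * ‖g x‖ ^ 2 +
          inner ℝ x (g x) * inner ℝ (g x) (gradient ζ x)) -
        1 / 2 * ‖g x‖ ^ 2 * ((-2 * a * ‖x‖ ^ (-2 * a)) * ζ x +
          (N * ζ x + fderiv ℝ ζ x x) * ‖x‖ ^ (-2 * a)) +
        1 / p * u x ^ p * ((‖x‖ ^ (-(b * p)) * (inner ℝ (gradient K x) x + -(b * p) * K x)) * ζ x +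
          (N * ζ x + fderiv ℝ ζ x x) * (‖x‖ ^ (-(b * p)) * K x)) := by
      have hGi : ∀ i, G i x = ‖x‖ ^ (-2 * a) * ζ x * (inner ℝ (B i) (g x) * inner ℝ (B i) (g x)) +
          (‖x‖ ^ (-2 * a) * inner ℝ (g x) (gradient ζ x)) *
            (inner ℝ (B i) x * inner ℝ (B i) (g x)) -
          (1 / 2 * ‖g x‖ ^ 2 * ζ x) *
            (inner ℝ (B i) x * fderiv ℝ (fun y => ‖y‖ ^ (-2 * a)) x (B i)) -
          (1 / 2 * ‖g x‖ ^ 2 * ‖x‖ ^ (-2 * a)) *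
            fderiv ℝ (fun x => ζ x * inner ℝ (B i) x) x (B i) +
          (1 / p * u x ^ p * ζ x) *
            (inner ℝ (B i) x * fderiv ℝ (fun y => ‖y‖ ^ (-(b * p)) * K y) x (B i)) +
          (1 / p * u x ^ p * (‖x‖ ^ (-(b * p)) * K x)) *
            fderiv ℝ (fun x => ζ x * inner ℝ (B i) x) x (B i) := by
        intro i
        rw [hG]
        simp only [hgr]
        ring
      simp only [hGi, Finset.sum_add_distrib, Finset.sum_sub_distrib, ← Finset.mul_sum, s1, s2, s6]
      rw [s3, s4]
      ring
    rw [hGs, pohozaevField, pohozaevSource]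
    simp only [inner_add_left, inner_sub_left, real_inner_smul_left, inner_add_right,
      real_inner_smul_right, real_inner_self_eq_norm_sq]
    rw [real_inner_comm (gradient ζ x) x, inner_gradient_eq, ← hγ]
    have hup : u x ^ p = u x ^ (p - 1) * u x := rpow_eq_rpow_sub_one_mul h1
    rw [hup, Real.rpow_neg (norm_nonneg x), div_eq_mul_inv]
    have hp0 : p ≠ 0 := by linarith
    have hq : 1 / p * p = 1 := by field_simp
    -- The relation that defines p. It cancels the terms K u^p ζ and leaves only ∇K·x.
    have hNp : 1 / p * N = γ + b := by
      have h4 : (3 : ℝ) ≤ N := by exact_mod_cast hP.three_le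
      have h5 := hP.le
      have h6 := hP.eq
      have h7 : (0 : ℝ) < N - 2 * (1 + a - b) := by linarith
      rw [eq_div_iff h7.ne'] at h6
      rw [one_div_mul_eq_div, div_eq_iff hp0, hγ]
      linarith
    have hγ2 : (N : ℝ) = 2 * γ + 2 + 2 * a := by
      rw [hγ]
      ring
    generalize 1 / p = q at hq hNp ⊢
    linear_combination (K x * (‖x‖ ^ (b * p))⁻¹ * (u x ^ (p - 1) * u x) * ζ x) * (b * hq - hNp) +
      (1 / 2 * ‖x‖ ^ (-2 * a) * ζ x * ‖g x‖ ^ 2) * hγ2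
  rw [integral_congr_ae pt, integral_sub_sub hsumi (w1.const_mul _) (w2.const_mul _), hsum,
    integral_const_mul, integral_const_mul, w3]
  ring

end Pohozaev

/-! ### Defining functions, the outer normal and boundary charts -/

section DefiningFunctions

variable {N : ℕ} {Ω V V' : Set (EuclideanSpace ℝ (Fin N))} {x y z : EuclideanSpace ℝ (Fin N)}
  {ρ ρ' : EuclideanSpace ℝ (Fin N) → ℝ}

theorem exists_lt_zero_lt_of_hasDerivAt_pos {f : ℝ → ℝ} {f' : ℝ} (hf : HasDerivAt f f' 0)
    (hf' : 0 < f') : (∀ᶠ t in 𝓝[>] (0 : ℝ), f 0 < f t) ∧ ∀ᶠ t in 𝓝[<] (0 : ℝ), f t < f 0 := by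
  have h := (hasDerivAt_iff_tendsto_slope_zero.1 hf).eventually (lt_mem_nhds hf')
  rw [eventually_nhdsWithin_iff] at h
  constructor
  · filter_upwards [nhdsWithin_le_nhds h, self_mem_nhdsWithin] with t ht ht0
    have h1 := ht (ne_of_gt ht0)
    rw [zero_add, smul_eq_mul] at h1
    have := (pos_iff_pos_of_mul_pos h1).1 (inv_pos.2 ht0)
    linarith
  · filter_upwards [nhdsWithin_le_nhds h, self_mem_nhdsWithin] with t ht ht0
    have h1 := ht (ne_of_lt ht0)
    rw [zero_add, smul_eq_mul] at h1
    have := (neg_iff_neg_of_mul_pos h1).1 (inv_lt_zero.2 ht0)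
    linarith

namespace IsLocalDefiningFunction

theorem of_mem (h : IsLocalDefiningFunction Ω x V ρ) (hy : y ∈ V) :
    IsLocalDefiningFunction Ω y V ρ :=
  ⟨h.isOpen, hy, h.smooth, h.gradient_ne_zero, h.mem_iff⟩

theorem contDiffAt (h : IsLocalDefiningFunction Ω x V ρ) (hy : y ∈ V) : ContDiffAt ℝ ∞ ρ y :=
  h.smooth.contDiffAt (h.isOpen.mem_nhds hy)

theorem hasFDerivAt (h : IsLocalDefiningFunction Ω x V ρ) (hy : y ∈ V) :
    HasFDerivAt ρ (innerSL ℝ (gradient ρ y)) y := by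
  have h1 := ((h.contDiffAt hy).differentiableAt (by simp)).hasFDerivAt
  have h2 : innerSL ℝ (gradient ρ y) = fderiv ℝ ρ y :=
    ContinuousLinearMap.ext fun v => by rw [innerSL_apply_apply, inner_gradient_eq]
  rwa [h2]

theorem continuousOn_gradient (h : IsLocalDefiningFunction Ω x V ρ) :
    ContinuousOn (gradient ρ) V :=
  (LinearIsometryEquiv.continuous _).comp_continuousOn
    (h.smooth.continuousOn_fderiv_of_isOpen h.isOpen (by simp))

theorem hasDerivAt_line (h : IsLocalDefiningFunction Ω x V ρ) (hy : y ∈ V)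
    (v : EuclideanSpace ℝ (Fin N)) :
    HasDerivAt (fun t : ℝ => ρ (y + t • v)) (inner ℝ (gradient ρ y) v) 0 := by
  have h1 : HasDerivAt (fun t : ℝ => y + t • v) v 0 := by
    simpa using ((hasDerivAt_id' (0 : ℝ)).smul_const v).const_add y
  have h2 : HasFDerivAt ρ (innerSL ℝ (gradient ρ y)) (y + (0 : ℝ) • v) := by
    simpa using h.hasFDerivAt hy
  exact h2.comp_hasDerivAt 0 h1

theorem tendsto_line (y v : EuclideanSpace ℝ (Fin N)) :
    Tendsto (fun t : ℝ => y + t • v) (𝓝 0) (𝓝 y) := by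
  have : Continuous (fun t : ℝ => y + t • v) := by fun_prop
  simpa using this.tendsto 0

/-- Since the gradient does not vanish, moving against it from a zero of ρ enters Ω, so zeros are
limits of points of Ω. Where ρ is positive, it is positive nearby. -/
theorem mem_frontier_iff (hΩ : IsOpen Ω) (h : IsLocalDefiningFunction Ω x V ρ) (hy : y ∈ V) :
    y ∈ frontier Ω ↔ ρ y = 0 := by
  have hV := h.isOpen.mem_nhds hy
  rw [hΩ.frontier_eq]
  constructor
  · rintro ⟨h1, h2⟩
    rw [h.mem_iff y hy, not_lt] at h2
    refine le_antisymm (not_lt.1 fun h3 => ?_) h2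
    have h4 : ∀ᶠ w in 𝓝 y, 0 < ρ w :=
      (h.hasFDerivAt hy).continuousAt.eventually (lt_mem_nhds h3)
    obtain ⟨w, ⟨hw1, hw2⟩, hw3⟩ := mem_closure_iff_nhds.1 h1 _ (inter_mem h4 hV)
    have hw1 : 0 < ρ w := hw1
    exact (lt_asymm hw1) ((h.mem_iff w hw2).1 hw3)
  · intro h1
    refine ⟨mem_closure_iff_nhds.2 fun t ht => ?_, by rw [h.mem_iff y hy, h1]; exact lt_irrefl _⟩
    have h2 := (exists_lt_zero_lt_of_hasDerivAt_pos (h.hasDerivAt_line hy (gradient ρ y)) (by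
      rw [real_inner_self_eq_norm_sq]
      have := norm_pos_iff.2 (h.gradient_ne_zero y hy)
      positivity)).2
    have h3 : ∀ᶠ s in 𝓝[<] (0 : ℝ), y + s • gradient ρ y ∈ t ∩ V :=
      nhdsWithin_le_nhds ((tendsto_line y _).eventually (inter_mem ht hV))
    obtain ⟨s, hs1, hs2, hs3⟩ := (h2.and h3).exists
    refine ⟨_, hs2, (h.mem_iff _ hs3).2 ?_⟩
    simpa [h1] using hs1

/-- If the unit gradients α and β were different, a small step along α - β would raise ρ and lower
ρ', so the new point would lie both outside and inside Ω. Hence the chosen normal does not depend on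
the choice. -/
theorem unit_gradient_eq (hΩ : IsOpen Ω) (h : IsLocalDefiningFunction Ω x V ρ)
    (h' : IsLocalDefiningFunction Ω x V' ρ') (hx : x ∈ frontier Ω) :
    ‖gradient ρ x‖⁻¹ • gradient ρ x = ‖gradient ρ' x‖⁻¹ • gradient ρ' x := by
  have hm := norm_pos_iff.2 (h.gradient_ne_zero x h.mem)
  have hm' := norm_pos_iff.2 (h'.gradient_ne_zero x h'.mem)
  set α := ‖gradient ρ x‖⁻¹ • gradient ρ x with hα
  set β := ‖gradient ρ' x‖⁻¹ • gradient ρ' x with hβ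
  have eα : gradient ρ x = ‖gradient ρ x‖ • α := by rw [hα, smul_inv_smul₀ hm.ne']
  have eβ : gradient ρ' x = ‖gradient ρ' x‖ • β := by rw [hβ, smul_inv_smul₀ hm'.ne']
  have nα : ‖α‖ = 1 := by rw [hα, norm_smul, norm_inv, norm_norm, inv_mul_cancel₀ hm.ne']
  have nβ : ‖β‖ = 1 := by rw [hβ, norm_smul, norm_inv, norm_norm, inv_mul_cancel₀ hm'.ne']
  by_contra hne
  have hlt : inner ℝ α β < 1 := (inner_lt_one_iff_real_of_norm_eq_one nα nβ).2 hne
  have d1 := h.hasDerivAt_line h.mem (α - β)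
  have d2 := h'.hasDerivAt_line h'.mem (α - β)
  have e1 : 0 < inner ℝ (gradient ρ x) (α - β) := by
    rw [eα, real_inner_smul_left, inner_sub_right, real_inner_self_eq_norm_sq, nα]
    exact mul_pos hm (by linarith)
  have e2 : 0 < -inner ℝ (gradient ρ' x) (α - β) := by
    rw [eβ, real_inner_smul_left, inner_sub_right, real_inner_self_eq_norm_sq, nβ,
      real_inner_comm, ← mul_neg]
    exact mul_pos hm' (by linarith)
  have f1 := (exists_lt_zero_lt_of_hasDerivAt_pos d1 e1).1
  have f2 := (exists_lt_zero_lt_of_hasDerivAt_pos d2.neg e2).1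
  have f3 : ∀ᶠ s in 𝓝[>] (0 : ℝ), x + s • (α - β) ∈ V ∩ V' :=
    nhdsWithin_le_nhds ((tendsto_line x _).eventually
      (inter_mem (h.isOpen.mem_nhds h.mem) (h'.isOpen.mem_nhds h'.mem)))
  obtain ⟨s, hs1, hs2, hs3, hs4⟩ := (f1.and (f2.and f3)).exists
  simp only [zero_smul, add_zero, Pi.neg_apply, (h.mem_frontier_iff hΩ h.mem).1 hx,
    (h'.mem_frontier_iff hΩ h'.mem).1 hx] at hs1 hs2
  have hin : x + s • (α - β) ∈ Ω := (h'.mem_iff _ hs4).2 (by linarith)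
  exact lt_asymm hs1 ((h.mem_iff _ hs3).1 hin)

theorem outerUnitNormal_eq (hΩ : IsOpen Ω) (h : IsLocalDefiningFunction Ω x V ρ)
    (hx : x ∈ frontier Ω) : outerUnitNormal Ω x = ‖gradient ρ x‖⁻¹ • gradient ρ x := by
  have hex : ∃ ρ V, x ∈ frontier Ω ∧ IsLocalDefiningFunction Ω x V ρ := ⟨ρ, V, hx, h⟩
  rw [outerUnitNormal, dif_pos hex]
  obtain ⟨V', -, h'⟩ := hex.choose_spec
  exact unit_gradient_eq hΩ h' h hx

theorem const_mul (h : IsLocalDefiningFunction Ω x V ρ) {c : ℝ} (hc : 0 < c) :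
    IsLocalDefiningFunction Ω x V (fun y => c * ρ y) ∧
      ∀ y ∈ V, gradient (fun y => c * ρ y) y = c • gradient ρ y := by
  have hg : ∀ y ∈ V, gradient (fun y => c * ρ y) y = c • gradient ρ y := by
    intro y hy
    refine ext_inner_right ℝ fun v => ?_
    rw [inner_gradient_eq, real_inner_smul_left, inner_gradient_eq,
      fderiv_const_mul ((h.contDiffAt hy).differentiableAt (by simp))]
    rfl
  refine ⟨⟨h.isOpen, h.mem, contDiffOn_const.mul h.smooth, fun y hy => ?_, fun y hy => ?_⟩, hg⟩
  · rw [hg y hy]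
    exact smul_ne_zero hc.ne' (h.gradient_ne_zero y hy)
  · rw [h.mem_iff y hy]
    constructor <;> intro h2 <;> nlinarith

end IsLocalDefiningFunction

theorem continuousOn_outerUnitNormal (hΩ : IsOpen Ω) (hs : HasSmoothBoundary Ω) :
    ContinuousOn (outerUnitNormal Ω) (frontier Ω) := by
  intro x hx
  obtain ⟨V, ρ, h⟩ := hs x hx
  have hV := h.isOpen.mem_nhds h.mem
  have h1 : ContinuousAt (fun y => ‖gradient ρ y‖⁻¹ • gradient ρ y) x := by
    have h2 := h.continuousOn_gradient.continuousAt hV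
    exact (h2.norm.inv₀ (norm_ne_zero_iff.2 (h.gradient_ne_zero x h.mem))).smul h2
  refine h1.continuousWithinAt.congr_of_eventuallyEq ?_ (h.outerUnitNormal_eq hΩ hx)
  filter_upwards [self_mem_nhdsWithin, nhdsWithin_le_nhds hV] with y hy hyV
  exact (h.of_mem hyV).outerUnitNormal_eq hΩ hy

theorem norm_outerUnitNormal_le (x : EuclideanSpace ℝ (Fin N)) :
    ‖outerUnitNormal Ω x‖ ≤ 1 := by
  rw [outerUnitNormal]
  split_ifs with hex
  · rw [norm_smul, norm_inv, norm_norm]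
    exact inv_mul_le_one
  · simp

/-- A normalized local defining function of `Ω` at the boundary point `z`: on a closed ball around
`z` its gradient is within `ε` of the unit normal `n` at `z`. -/
structure IsBoundaryChart (Ω O : Set (EuclideanSpace ℝ (Fin N))) (z : EuclideanSpace ℝ (Fin N))
    (V : Set (EuclideanSpace ℝ (Fin N))) (ρ : EuclideanSpace ℝ (Fin N) → ℝ)
    (n : EuclideanSpace ℝ (Fin N)) (ε r : ℝ) : Prop where
  isLocalDefiningFunction : IsLocalDefiningFunction Ω z V ρ
  norm_normal : ‖n‖ = 1
  radius_pos : 0 < r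
  closedBall_subset : Metric.closedBall z (2 * r) ⊆ V ∩ O
  norm_gradient_sub_le : ∀ x ∈ Metric.closedBall z (2 * r), ‖gradient ρ x - n‖ ≤ ε

theorem HasSmoothBoundary.exists_isBoundaryChart (hs : HasSmoothBoundary Ω)
    {O : Set (EuclideanSpace ℝ (Fin N))} (hO : O ∈ 𝓝 z) (hz : z ∈ frontier Ω) {ε : ℝ}
    (hε : 0 < ε) : ∃ V ρ n r, IsBoundaryChart Ω O z V ρ n ε r := by
  obtain ⟨V, ρ₀, h₀⟩ := hs z hz
  have hm := norm_pos_iff.2 (h₀.gradient_ne_zero z h₀.mem)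
  -- Rescaling makes the gradient at z a unit vector, which serves as the axis n of the chart.
  obtain ⟨h, hg⟩ := h₀.const_mul (inv_pos.2 hm)
  set ρ := fun y => ‖gradient ρ₀ z‖⁻¹ * ρ₀ y with hρ
  have hV := h.isOpen.mem_nhds h.mem
  have h1 : ∀ᶠ x in 𝓝 z, ‖gradient ρ x - gradient ρ z‖ ≤ ε := by
    have := h.continuousOn_gradient.continuousAt hV
    have := this.eventually (Metric.closedBall_mem_nhds _ hε)
    simpa only [Metric.mem_closedBall, dist_eq_norm] using this
  obtain ⟨r, hr, hball⟩ := Metric.nhds_basis_closedBall.mem_iff.1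
    (inter_mem (inter_mem hV hO) h1)
  refine ⟨V, ρ, gradient ρ z, r / 2, h, ?_, by positivity, ?_, ?_⟩
  · rw [hg z h.mem, norm_smul, norm_inv, norm_norm, inv_mul_cancel₀ hm.ne']
  · rw [mul_div_cancel₀ _ two_ne_zero]
    exact hball.trans Set.inter_subset_left
  · rw [mul_div_cancel₀ _ two_ne_zero]
    exact hball.trans Set.inter_subset_right

namespace IsBoundaryChart

variable {O : Set (EuclideanSpace ℝ (Fin N))} {n : EuclideanSpace ℝ (Fin N)} {ε r : ℝ}

theorem abs_sub_sub_inner_le (h : IsBoundaryChart Ω O z V ρ n ε r)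
    (hx : x ∈ Metric.closedBall z (2 * r)) (hy : y ∈ Metric.closedBall z (2 * r)) :
    |ρ x - ρ y - inner ℝ n (x - y)| ≤ ε * ‖x - y‖ := by
  have := (convex_closedBall z (2 * r)).norm_image_sub_le_of_norm_hasFDerivWithin_le'
    (f := ρ) (φ := innerSL ℝ n) (C := ε)
    (fun w hw => (h.isLocalDefiningFunction.hasFDerivAt
      (h.closedBall_subset hw).1).hasFDerivWithinAt) (fun w hw => by
        rw [← map_sub, innerSL_apply_norm]
        exact h.norm_gradient_sub_le w hw) hy hx
  simpa [Real.norm_eq_abs] using this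

theorem norm_gradient_le (h : IsBoundaryChart Ω O z V ρ n ε r)
    (hx : x ∈ Metric.closedBall z (2 * r)) : ‖gradient ρ x‖ ≤ 1 + ε := by
  have h1 := norm_add_le n (gradient ρ x - n)
  rw [add_sub_cancel, h.norm_normal] at h1
  linarith [h.norm_gradient_sub_le x hx]

theorem le_inner_gradient (h : IsBoundaryChart Ω O z V ρ n ε r)
    (hx : x ∈ Metric.closedBall z (2 * r)) : 1 - ε ≤ inner ℝ (gradient ρ x) n := by
  have h1 := abs_real_inner_le_norm (gradient ρ x - n) n
  rw [h.norm_normal, mul_one, inner_sub_left, real_inner_self_eq_norm_sq, h.norm_normal] at h1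
  have := (abs_le.1 (h1.trans (h.norm_gradient_sub_le x hx))).1
  linarith

theorem inner_gradient_le (h : IsBoundaryChart Ω O z V ρ n ε r) :
    inner ℝ (gradient ρ x) n ≤ ‖gradient ρ x‖ := by
  have := real_inner_le_norm (gradient ρ x) n
  rwa [h.norm_normal, mul_one] at this

end IsBoundaryChart

end DefiningFunctions

/-! ### Slicing by lines normal to a hyperplane; graphs over it -/

section Slicing

variable {E : Type*} [NormedAddCommGroup E] [InnerProductSpace ℝ E] {z n : E}

/-- The point with height `q.1` over the point `q.2` of the hyperplane through `z` with unit
normal `n`. -/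
def sliceMap (z n : E) (q : ℝ × (ℝ ∙ n)ᗮ) : E := z + (q.1 • n + q.2)

theorem continuous_sliceMap : Continuous (sliceMap z n) := by
  unfold sliceMap
  fun_prop

theorem inner_normal_coe (y : (ℝ ∙ n)ᗮ) : inner ℝ n (y : E) = 0 :=
  Submodule.mem_orthogonal_singleton_iff_inner_right.1 y.2

theorem sliceMap_sub (q q' : ℝ × (ℝ ∙ n)ᗮ) :
    sliceMap z n q - sliceMap z n q' = (q.1 - q'.1) • n + ((q.2 - q'.2 : (ℝ ∙ n)ᗮ) : E) := by
  rw [sliceMap, sliceMap, Submodule.coe_sub]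
  module

theorem inner_normal_sliceMap_sub (hn : ‖n‖ = 1) (q q' : ℝ × (ℝ ∙ n)ᗮ) :
    inner ℝ n (sliceMap z n q - sliceMap z n q') = q.1 - q'.1 := by
  rw [sliceMap_sub, inner_add_right, real_inner_smul_right, inner_normal_coe,
    real_inner_self_eq_norm_sq, hn]
  ring

theorem norm_sliceMap_sub_le (hn : ‖n‖ = 1) (q q' : ℝ × (ℝ ∙ n)ᗮ) :
    ‖sliceMap z n q - sliceMap z n q'‖ ≤ |q.1 - q'.1| + ‖q.2 - q'.2‖ := by
  rw [sliceMap_sub]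
  refine (norm_add_le _ _).trans (le_of_eq ?_)
  rw [norm_smul, hn, mul_one, Real.norm_eq_abs, Submodule.coe_norm]

theorem norm_sub_le_norm_sliceMap_sub (q q' : ℝ × (ℝ ∙ n)ᗮ) :
    ‖q.2 - q'.2‖ ≤ ‖sliceMap z n q - sliceMap z n q'‖ := by
  rw [sliceMap_sub, Submodule.coe_norm]
  refine abs_le_of_sq_le_sq' ?_ (norm_nonneg _) |>.2
  rw [norm_add_sq_real, real_inner_smul_left, inner_normal_coe]
  nlinarith [sq_nonneg ‖(q.1 - q'.1) • n‖]

theorem sliceMap_mem_closedBall (hn : ‖n‖ = 1) {s r : ℝ} {y : (ℝ ∙ n)ᗮ} (h1 : |s| ≤ r)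
    (h2 : ‖y‖ ≤ r) : sliceMap z n (s, y) ∈ Metric.closedBall z (2 * r) := by
  rw [mem_closedBall_iff_norm]
  have := norm_sliceMap_sub_le (z := z) hn (s, y) (0, 0)
  simp only [sub_zero] at this
  have e : sliceMap z n (0, (0 : (ℝ ∙ n)ᗮ)) = z := by simp [sliceMap]
  rw [e] at this
  linarith

theorem hasDerivAt_sliceMap (y : (ℝ ∙ n)ᗮ) (s : ℝ) :
    HasDerivAt (fun s => sliceMap z n (s, y)) n s := by
  have := (((hasDerivAt_id' s).smul_const n).add_const (y : E)).const_add z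
  rw [one_smul] at this
  exact this

/-- The coordinates inverse to `sliceMap`. -/
def sliceCoord (z n : E) (hn : ‖n‖ = 1) (x : E) : ℝ × (ℝ ∙ n)ᗮ :=
  (inner ℝ n (x - z), ⟨x - z - (inner ℝ n (x - z) : ℝ) • n, by
    rw [Submodule.mem_orthogonal_singleton_iff_inner_right, inner_sub_right, real_inner_smul_right,
      real_inner_self_eq_norm_sq, hn]
    ring⟩)

theorem continuous_sliceCoord (hn : ‖n‖ = 1) : Continuous (sliceCoord z n hn) := by
  unfold sliceCoord
  fun_prop

theorem sliceMap_sliceCoord (hn : ‖n‖ = 1) (x : E) : sliceMap z n (sliceCoord z n hn x) = x := by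
  simp [sliceMap, sliceCoord]

theorem sliceCoord_sliceMap (hn : ‖n‖ = 1) (q : ℝ × (ℝ ∙ n)ᗮ) :
    sliceCoord z n hn (sliceMap z n q) = q := by
  have h : inner ℝ n (sliceMap z n q - z) = q.1 := by
    rw [sliceMap, add_sub_cancel_left, inner_add_right, real_inner_smul_right, inner_normal_coe,
      real_inner_self_eq_norm_sq, hn]
    ring
  refine Prod.ext h (Subtype.ext ?_)
  simp only [sliceCoord, h]
  simp [sliceMap]

/-- The graph of a function over the hyperplane through `z` with unit normal `n`. -/
def graphMap (z n : E) (f : (ℝ ∙ n)ᗮ → ℝ) (y : (ℝ ∙ n)ᗮ) : E := sliceMap z n (f y, y)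

/-- Orthogonal projection back to the hyperplane does not increase distances. -/
theorem antilipschitzWith_graphMap (f : (ℝ ∙ n)ᗮ → ℝ) :
    AntilipschitzWith 1 (graphMap z n f) :=
  AntilipschitzWith.of_le_mul_dist fun y y' => by
    rw [NNReal.coe_one, one_mul, dist_eq_norm, dist_eq_norm]
    exact norm_sub_le_norm_sliceMap_sub (f y, y) (f y', y')

theorem lipschitzWith_graphMap (hn : ‖n‖ = 1) {f : (ℝ ∙ n)ᗮ → ℝ} {L : NNReal}
    (hf : LipschitzWith L f) : LipschitzWith (1 + L) (graphMap z n f) :=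
  LipschitzWith.of_dist_le_mul fun y y' => by
    have h1 := norm_sliceMap_sub_le (z := z) hn (f y, y) (f y', y')
    have h2 := hf.dist_le_mul y y'
    rw [Real.dist_eq] at h2
    rw [dist_eq_norm, dist_eq_norm]
    rw [dist_eq_norm] at h2
    push_cast
    refine h1.trans ?_
    simp only
    linarith

variable [FiniteDimensional ℝ E] [MeasurableSpace E] [BorelSpace E]

theorem measurePreserving_sliceMap (hn : ‖n‖ = 1) :
    MeasurePreserving (sliceMap z n) (volume.prod volume) volume := by
  have h1 := (LinearIsometryEquiv.toSpanUnitSingleton (𝕜 := ℝ) n hn).measurePreserving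
  have h2 := h1.prod (MeasurePreserving.id (volume : Measure (ℝ ∙ n)ᗮ))
  have h3 := ((ℝ ∙ n).measurePreserving_measurableEquivProd z).symm
  rw [InnerProductSpace.euclideanHausdorffMeasure_eq_volume] at h3
  have h4 := h3.comp h2
  have e : sliceMap z n = ⇑((ℝ ∙ n).measurableEquivProd z).symm ∘
      Prod.map (LinearIsometryEquiv.toSpanUnitSingleton (𝕜 := ℝ) n hn) id := by
    ext1 q
    simp [sliceMap, add_comm]
  rw [e]
  exact h4

theorem measurableEmbedding_sliceMap (hn : ‖n‖ = 1) : MeasurableEmbedding (sliceMap z n) :=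
  (Homeomorph.mk ⟨sliceMap z n, sliceCoord z n hn, sliceCoord_sliceMap hn, sliceMap_sliceCoord hn⟩
    continuous_sliceMap (continuous_sliceCoord hn)).measurableEmbedding

theorem integral_eq_integral_sliceMap (hn : ‖n‖ = 1) {F : E → ℝ} (hF : Integrable F volume) :
    ∫ x, F x = ∫ y : (ℝ ∙ n)ᗮ, ∫ s : ℝ, F (sliceMap z n (s, y)) := by
  rw [← (measurePreserving_sliceMap (z := z) hn).integral_comp (measurableEmbedding_sliceMap hn) F]
  exact integral_prod_symm _ ((measurePreserving_sliceMap hn).integrable_comp_of_integrable hF)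

theorem integrable_integral_sliceMap (hn : ‖n‖ = 1) {F : E → ℝ} (hF : Integrable F volume) :
    Integrable (fun y : (ℝ ∙ n)ᗮ => ∫ s : ℝ, F (sliceMap z n (s, y))) volume :=
  ((measurePreserving_sliceMap hn).integrable_comp_of_integrable hF).integral_prod_right

/-- The surface measure of a Lipschitz graph compared with the Lebesgue measure of its base. -/
theorem volume_le_euclideanHausdorffMeasure_graph [Nontrivial E] (hn : ‖n‖ = 1) {f : (ℝ ∙ n)ᗮ → ℝ}
    {L : NNReal} (hf : LipschitzWith L f) (S : Set (ℝ ∙ n)ᗮ) :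
    volume S ≤ Measure.euclideanHausdorffMeasure (Module.finrank ℝ E - 1) (graphMap z n f '' S) ∧
    Measure.euclideanHausdorffMeasure (Module.finrank ℝ E - 1) (graphMap z n f '' S) ≤
      (1 + L : ℝ≥0∞) ^ (Module.finrank ℝ E - 1) * volume S := by
  have hn0 : n ≠ 0 := by
    intro h
    simp [h] at hn
  have hpos : 0 < Module.finrank ℝ E := Module.finrank_pos
  have : Fact (Module.finrank ℝ E = (Module.finrank ℝ E - 1) + 1) := ⟨by omega⟩
  have hfr : Module.finrank ℝ (ℝ ∙ n)ᗮ = Module.finrank ℝ E - 1 :=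
    Submodule.finrank_orthogonal_span_singleton hn0
  have hvol : (volume : Measure (ℝ ∙ n)ᗮ) =
      Measure.euclideanHausdorffMeasure (Module.finrank ℝ E - 1) := by
    rw [← hfr, InnerProductSpace.euclideanHausdorffMeasure_eq_volume]
  rw [hvol, Measure.euclideanHausdorffMeasure_def, Measure.euclideanHausdorffMeasure_def,
    Measure.smul_apply, Measure.smul_apply]
  set d := Module.finrank ℝ E - 1
  -- The projection gives the lower bound with constant 1, and the Lipschitz constant 1 + L of the
  -- graph map gives the upper bound. No area formula is used: the two bounds agree in the limit L →
  -- 0.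
  have h1 := (antilipschitzWith_graphMap (z := z) f).le_hausdorffMeasure_image
    (d := d) (by positivity) S
  have h2 := (lipschitzWith_graphMap (z := z) hn hf).hausdorffMeasure_image_le
    (d := d) (by positivity) S
  constructor
  · gcongr
    simpa using h1
  · refine le_trans (smul_le_smul_of_nonneg_left h2 zero_le) (le_of_eq ?_)
    rw [ENNReal.smul_def, ENNReal.smul_def, smul_eq_mul, smul_eq_mul, mul_left_comm]
    push_cast
    rw [ENNReal.rpow_natCast]

end Slicing

/-! ### One-dimensional approximate identities at the boundary -/

/-- An approximate identity on the negative half line, concentrated in `[-2δ, -δ]`. -/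
def transitionKernel (δ q : ℝ) : ℝ := δ⁻¹ * deriv Real.smoothTransition (-q / δ - 1)

theorem continuous_deriv_smoothTransition : Continuous (deriv Real.smoothTransition) :=
  (Real.smoothTransition.contDiff (n := 1)).continuous_deriv le_rfl

theorem transitionKernel_nonneg {δ : ℝ} (hδ : 0 < δ) (q : ℝ) : 0 ≤ transitionKernel δ q :=
  mul_nonneg (inv_nonneg.2 hδ.le) Real.smoothTransition.monotone.deriv_nonneg

theorem continuous_transitionKernel (δ : ℝ) : Continuous (transitionKernel δ) := by
  have := continuous_deriv_smoothTransition
  unfold transitionKernel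
  fun_prop

theorem transitionKernel_eq_zero {δ q : ℝ} (hδ : 0 < δ) (hq : q ≤ -2 * δ) :
    transitionKernel δ q = 0 := by
  rw [transitionKernel, deriv_smoothTransition_eq_zero, mul_zero]
  rw [le_sub_iff_add_le, le_div_iff₀ hδ]
  linarith

theorem hasDerivAt_neg_smoothTransition {R : ℝ → ℝ} {R' s : ℝ} (δ : ℝ) (hR : HasDerivAt R R' s) :
    HasDerivAt (fun s => -Real.smoothTransition (-R s / δ - 1)) (R' * transitionKernel δ (R s))
      s := by
  have h1 : HasDerivAt Real.smoothTransition (deriv Real.smoothTransition (-R s / δ - 1))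
      (-R s / δ - 1) :=
    ((Real.smoothTransition.contDiff (n := 1)).differentiable one_ne_zero _).hasDerivAt
  have h2 := (h1.comp s ((hR.neg.div_const δ).sub_const 1)).neg
  refine h2.congr_deriv ?_
  rw [transitionKernel]
  ring

section OneDimensional

variable {R R' A : ℝ → ℝ} {α β c M δ : ℝ}

/-- The integrand is an exact derivative whose primitive vanishes at β, where R = 0. The kernel thus
has mass at most 1, and mass exactly 1 once 2δ ≤ -R(α). -/
theorem integral_mul_transitionKernel (hαβ : α ≤ β)
    (hR : ∀ s ∈ Set.Icc α β, HasDerivAt R (R' s) s) (hR' : ContinuousOn R' (Set.Icc α β))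
    (hβ : R β = 0) : ∫ s in α..β, R' s * transitionKernel δ (R s) =
      Real.smoothTransition (-R α / δ - 1) := by
  have hRc : ContinuousOn R (Set.Icc α β) := fun s hs => (hR s hs).continuousAt.continuousWithinAt
  rw [intervalIntegral.integral_eq_sub_of_hasDerivAt
    (fun s hs => hasDerivAt_neg_smoothTransition δ (hR s (by rwa [Set.uIcc_of_le hαβ] at hs)))]
  · rw [hβ, neg_zero, zero_div, zero_sub,
      Real.smoothTransition.zero_of_nonpos (by norm_num : (-1 : ℝ) ≤ 0)]
    ring
  · refine ContinuousOn.intervalIntegrable ?_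
    rw [Set.uIcc_of_le hαβ]
    exact hR'.mul ((continuous_transitionKernel δ).comp_continuousOn hRc)

theorem abs_integral_transitionKernel_le (hαβ : α ≤ β)
    (hR : ∀ s ∈ Set.Icc α β, HasDerivAt R (R' s) s) (hR' : ContinuousOn R' (Set.Icc α β))
    (hR'0 : ∀ s ∈ Set.Icc α β, 0 ≤ R' s) (hβ : R β = 0) (hM : 0 ≤ M)
    (hδ : 0 < δ) (hA : ∀ s ∈ Set.Icc α β, transitionKernel δ (R s) ≠ 0 → |A s| ≤ M) :
    |∫ s in α..β, A s * (R' s * transitionKernel δ (R s))| ≤ M := by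
  have hRc : ContinuousOn R (Set.Icc α β) := fun s hs => (hR s hs).continuousAt.continuousWithinAt
  have hi : IntervalIntegrable (fun s => M * (R' s * transitionKernel δ (R s))) volume α β := by
    refine ContinuousOn.intervalIntegrable ?_
    rw [Set.uIcc_of_le hαβ]
    exact continuousOn_const.mul (hR'.mul ((continuous_transitionKernel δ).comp_continuousOn hRc))
  rw [← Real.norm_eq_abs]
  refine (intervalIntegral.norm_integral_le_of_norm_le hαβ ?_ hi).trans ?_
  · refine Eventually.of_forall fun s hs => ?_
    have hs' : s ∈ Set.Icc α β := Set.Ioc_subset_Icc_self hs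
    rw [norm_mul, Real.norm_of_nonneg (mul_nonneg (hR'0 s hs') (transitionKernel_nonneg hδ _))]
    by_cases h : transitionKernel δ (R s) = 0
    · simp [h]
    · exact mul_le_mul_of_nonneg_right (hA s hs' h)
        (mul_nonneg (hR'0 s hs') (transitionKernel_nonneg hδ _))
  · rw [intervalIntegral.integral_const_mul, integral_mul_transitionKernel hαβ hR hR' hβ]
    exact mul_le_of_le_one_right hM (Real.smoothTransition.le_one _)

theorem tendsto_integral_transitionKernel (hαβ : α < β)
    (hR : ∀ s ∈ Set.Icc α β, HasDerivAt R (R' s) s) (hR' : ContinuousOn R' (Set.Icc α β))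
    (hR'0 : ∀ s ∈ Set.Icc α β, 0 ≤ R' s) (hβ : R β = 0) (hc : 0 < c)
    (hRβ : ∀ s ∈ Set.Icc α β, R s ≤ -(c * (β - s))) (hA : ContinuousOn A (Set.Icc α β)) :
    Tendsto (fun δ => ∫ s in α..β, A s * (R' s * transitionKernel δ (R s))) (𝓝[>] 0)
      (𝓝 (A β)) := by
  have hRc : ContinuousOn R (Set.Icc α β) := fun s hs => (hR s hs).continuousAt.continuousWithinAt
  rw [Metric.tendsto_nhds]
  intro η hη
  have hcont := hA β (Set.right_mem_Icc.2 hαβ.le)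
  obtain ⟨θ, hθ, hball⟩ := Metric.continuousWithinAt_iff.1 hcont (η / 2) (by positivity)
  have hα : R α < 0 := by
    have := hRβ α (Set.left_mem_Icc.2 hαβ.le)
    have := mul_pos hc (sub_pos.2 hαβ)
    linarith
  -- The kernel is nonzero only where -2δ < R(s) ≤ -c (β - s). The first bound on δ confines this to
  -- β - s < θ; the second gives the kernel total mass 1.
  have h1 : ∀ᶠ δ in 𝓝[>] (0 : ℝ), δ < min (c * θ / 2) (-R α / 2) :=
    nhdsWithin_le_nhds (gt_mem_nhds (lt_min (by positivity) (by linarith)))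
  filter_upwards [h1, self_mem_nhdsWithin] with δ hδ1 hδ
  have hδ : 0 < δ := hδ
  obtain ⟨hδ2, hδ3⟩ := lt_min_iff.1 hδ1
  have hone : ∫ s in α..β, R' s * transitionKernel δ (R s) = 1 := by
    rw [integral_mul_transitionKernel hαβ.le hR hR' hβ]
    refine Real.smoothTransition.one_of_one_le ?_
    rw [le_sub_iff_add_le, le_div_iff₀ hδ]
    linarith
  have hk : ContinuousOn (fun s => R' s * transitionKernel δ (R s)) (Set.Icc α β) :=
    hR'.mul ((continuous_transitionKernel δ).comp_continuousOn hRc)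
  have hsub : (∫ s in α..β, A s * (R' s * transitionKernel δ (R s))) - A β =
      ∫ s in α..β, (A s - A β) * (R' s * transitionKernel δ (R s)) := by
    simp_rw [sub_mul]
    rw [intervalIntegral.integral_sub, intervalIntegral.integral_const_mul, hone, mul_one]
    · refine ContinuousOn.intervalIntegrable ?_
      rw [Set.uIcc_of_le hαβ.le]
      exact hA.mul hk
    · refine ContinuousOn.intervalIntegrable ?_
      rw [Set.uIcc_of_le hαβ.le]
      exact continuousOn_const.mul hk
  rw [Real.dist_eq, hsub]
  refine lt_of_le_of_lt (abs_integral_transitionKernel_le hαβ.le hR hR' hR'0 hβ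
    (by positivity : 0 ≤ η / 2) hδ (A := fun s => A s - A β) fun s hs hne => ?_) (by linarith)
  have h2 : -2 * δ < R s := by
    by_contra h
    exact hne (transitionKernel_eq_zero hδ (not_lt.1 h))
  have h3 := hRβ s hs
  have h4 : β - s < θ := by
    have : c * (β - s) < c * θ := by linarith
    exact lt_of_mul_lt_mul_left this hc.le
  have h5 := hball hs (by rw [Real.dist_eq, abs_sub_comm, abs_of_nonneg (by linarith [hs.2])]; exact h4)
  rw [Real.dist_eq] at h5
  exact h5.le

end OneDimensional

/-! ### The boundary as a Lipschitz graph in a chart -/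

section BoundaryGraph

variable {N : ℕ} {Ω V O : Set (EuclideanSpace ℝ (Fin N))} {z n : EuclideanSpace ℝ (Fin N)}
  {ρ : EuclideanSpace ℝ (Fin N) → ℝ} {ε r : ℝ}

/-- The cylinder of radius and half height `r` around `z` with axis `n`. -/
def chartBox (z n : EuclideanSpace ℝ (Fin N)) (hn : ‖n‖ = 1) (r : ℝ) :
    Set (EuclideanSpace ℝ (Fin N)) :=
  {x | |(sliceCoord z n hn x).1| < r ∧ ‖(sliceCoord z n hn x).2‖ < r}

theorem isOpen_chartBox (hn : ‖n‖ = 1) : IsOpen (chartBox z n hn r) := by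
  have := continuous_sliceCoord (z := z) hn
  exact (isOpen_lt this.fst.abs continuous_const).inter (isOpen_lt this.snd.norm continuous_const)

theorem sliceMap_mem_chartBox_iff (hn : ‖n‖ = 1) (s : ℝ) (y : (ℝ ∙ n)ᗮ) :
    sliceMap z n (s, y) ∈ chartBox z n hn r ↔ |s| < r ∧ ‖y‖ < r := by
  rw [chartBox, Set.mem_ofPred_eq, sliceCoord_sliceMap]

theorem mem_chartBox_self (hn : ‖n‖ = 1) (hr : 0 < r) : z ∈ chartBox z n hn r := by
  have h1 := (sliceMap_mem_chartBox_iff (z := z) (r := r) hn 0 0).2 (by simpa using hr)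
  have h2 : sliceMap z n ((0 : ℝ), (0 : (ℝ ∙ n)ᗮ)) = z := by simp [sliceMap]
  rwa [h2] at h1

theorem chartBox_subset_closedBall (hn : ‖n‖ = 1) :
    chartBox z n hn r ⊆ Metric.closedBall z (2 * r) := fun x hx => by
  rw [← sliceMap_sliceCoord (z := z) hn x]
  exact sliceMap_mem_closedBall hn hx.1.le hx.2.le

namespace IsBoundaryChart

theorem nonneg (h : IsBoundaryChart Ω O z V ρ n ε r) : 0 ≤ ε :=
  (norm_nonneg _).trans (h.norm_gradient_sub_le z
    (Metric.mem_closedBall_self (by linarith [h.radius_pos])))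

theorem abs_sub_sub_le (h : IsBoundaryChart Ω O z V ρ n ε r) {s s' : ℝ} {y y' : (ℝ ∙ n)ᗮ}
    (h1 : |s| ≤ r) (h2 : ‖y‖ ≤ r) (h1' : |s'| ≤ r) (h2' : ‖y'‖ ≤ r) :
    |ρ (sliceMap z n (s, y)) - ρ (sliceMap z n (s', y')) - (s - s')| ≤
      ε * (|s - s'| + ‖y - y'‖) := by
  have hn := h.norm_normal
  have := h.abs_sub_sub_inner_le (sliceMap_mem_closedBall hn h1 h2)
    (sliceMap_mem_closedBall hn h1' h2')
  rw [inner_normal_sliceMap_sub hn] at this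
  exact this.trans (mul_le_mul_of_nonneg_left (norm_sliceMap_sub_le hn (s, y) (s', y')) h.nonneg)

/-- Near a boundary point the boundary is a Lipschitz graph with small Lipschitz constant. -/
theorem exists_graph (hΩ : IsOpen Ω) (h : IsBoundaryChart Ω O z V ρ n ε r)
    (hz : z ∈ frontier Ω) (hε : ε ≤ 1 / 4) :
    ∃ f : (ℝ ∙ n)ᗮ → ℝ, LipschitzWith (2 * ε).toNNReal f ∧
      ∀ y, ‖y‖ < r → |f y| < r ∧ ρ (sliceMap z n (f y, y)) = 0 := by
  have hr := h.radius_pos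
  have hρz : ρ (sliceMap z n (0, (0 : (ℝ ∙ n)ᗮ))) = 0 := by
    have : sliceMap z n (0, (0 : (ℝ ∙ n)ᗮ)) = z := by simp [sliceMap]
    rw [this]
    exact (h.isLocalDefiningFunction.mem_frontier_iff hΩ h.isLocalDefiningFunction.mem).1 hz
  have hε0 := h.nonneg
  have hex : ∀ y : (ℝ ∙ n)ᗮ, ∃ s : ℝ, ‖y‖ < r → |s| < r ∧ ρ (sliceMap z n (s, y)) = 0 := by
    intro y
    by_cases hy : ‖y‖ < r
    swap
    · exact ⟨0, fun h => absurd h hy⟩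
    have hcont : ContinuousOn (fun s => ρ (sliceMap z n (s, y))) (Set.Icc (-r) r) := by
      intro s hs
      have h1 : ContinuousAt ρ (sliceMap z n (s, y)) :=
        (h.isLocalDefiningFunction.hasFDerivAt (h.closedBall_subset
          (sliceMap_mem_closedBall h.norm_normal (abs_le.2 hs) hy.le)).1).continuousAt
      exact (ContinuousAt.comp (f := fun s => sliceMap z n (s, y)) (g := ρ) h1
        (hasDerivAt_sliceMap (z := z) y s).continuousAt).continuousWithinAt
    -- At heights ±r the function ρ differs from ±r by at most ε (r + ‖y‖) ≤ r/2, so it changes sign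
    -- along the segment.
    have e1 := h.abs_sub_sub_le (s := r) (y := y) (s' := 0) (y' := 0) (abs_of_pos hr).le hy.le
      (by simpa using hr.le) (by simpa using hr.le)
    have e2 := h.abs_sub_sub_le (s := -r) (y := y) (s' := 0) (y' := 0) (by rw [abs_neg, abs_of_pos hr]) hy.le
      (by simpa using hr.le) (by simpa using hr.le)
    simp only [sub_zero, abs_neg, abs_of_pos hr, hρz] at e1 e2
    have e3 : ε * (r + ‖y‖) ≤ 1 / 4 * (r + r) := by gcongr
    have l1 := (abs_le.1 (e1.trans e3)).1
    have l2 := (abs_le.1 (e2.trans e3)).2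
    obtain ⟨s, hs, hs0⟩ := intermediate_value_Icc (by linarith : -r ≤ r) hcont
      (show (0 : ℝ) ∈ Set.Icc _ _ from ⟨by linarith, by linarith⟩)
    refine ⟨s, fun _ => ⟨abs_lt.2 ⟨lt_of_le_of_ne hs.1 ?_, lt_of_le_of_ne hs.2 ?_⟩, hs0⟩⟩
    · rintro rfl
      simp only at hs0
      linarith
    · rintro rfl
      simp only at hs0
      linarith
  choose f₀ hf₀ using hex
  have hlip : LipschitzOnWith (2 * ε).toNNReal f₀ (Metric.ball 0 r) := by
    refine LipschitzOnWith.of_dist_le_mul fun y hy y' hy' => ?_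
    rw [mem_ball_zero_iff] at hy hy'
    obtain ⟨a1, a2⟩ := hf₀ y hy
    obtain ⟨b1, b2⟩ := hf₀ y' hy'
    have := h.abs_sub_sub_le a1.le hy.le b1.le hy'.le
    rw [a2, b2, sub_zero, zero_sub, abs_neg] at this
    rw [Real.dist_eq, dist_eq_norm, Real.coe_toNNReal _ (by linarith)]
    -- From |Δf| ≤ ε (|Δf| + ‖Δy‖) and ε ≤ 1/4 follows |Δf| ≤ 2ε ‖Δy‖.
    nlinarith [abs_nonneg (f₀ y - f₀ y'), norm_nonneg (y - y')]
  obtain ⟨f, hf, heq⟩ := hlip.extend_real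
  refine ⟨f, hf, fun y hy => ?_⟩
  rw [← heq (mem_ball_zero_iff.2 hy)]
  exact hf₀ y hy

variable {f : (ℝ ∙ n)ᗮ → ℝ}

theorem abs_sub_height_le (h : IsBoundaryChart Ω O z V ρ n ε r)
    (hf : ∀ y, ‖y‖ < r → |f y| < r ∧ ρ (sliceMap z n (f y, y)) = 0) {s : ℝ} {y : (ℝ ∙ n)ᗮ}
    (hs : |s| ≤ r) (hy : ‖y‖ < r) :
    |ρ (sliceMap z n (s, y)) - (s - f y)| ≤ ε * |s - f y| := by
  have := h.abs_sub_sub_le hs hy.le (hf y hy).1.le hy.le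
  rw [(hf y hy).2] at this
  simpa using this

/-- ρ differs from s - f(y) by at most ε |s - f(y)|, so the two have the same sign. -/
theorem sliceMap_mem_iff (h : IsBoundaryChart Ω O z V ρ n ε r) (hε : ε ≤ 1 / 4)
    (hf : ∀ y, ‖y‖ < r → |f y| < r ∧ ρ (sliceMap z n (f y, y)) = 0) {s : ℝ} {y : (ℝ ∙ n)ᗮ}
    (hs : |s| ≤ r) (hy : ‖y‖ < r) : sliceMap z n (s, y) ∈ Ω ↔ s < f y := by
  have h1 := h.abs_sub_height_le hf hs hy
  rw [h.isLocalDefiningFunction.mem_iff _ (h.closedBall_subset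
    (sliceMap_mem_closedBall h.norm_normal hs hy.le)).1]
  have h2 := h.nonneg
  constructor
  · intro h3
    by_contra h4
    rw [not_lt] at h4
    rw [abs_of_nonneg (sub_nonneg.2 h4)] at h1
    nlinarith [(abs_le.1 h1).1]
  · intro h3
    rw [abs_of_neg (sub_neg.2 h3)] at h1
    nlinarith [(abs_le.1 h1).2]

theorem sliceMap_mem_frontier_iff (hΩ : IsOpen Ω) (h : IsBoundaryChart Ω O z V ρ n ε r)
    (hε : ε ≤ 1 / 4)
    (hf : ∀ y, ‖y‖ < r → |f y| < r ∧ ρ (sliceMap z n (f y, y)) = 0) {s : ℝ} {y : (ℝ ∙ n)ᗮ}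
    (hs : |s| ≤ r) (hy : ‖y‖ < r) : sliceMap z n (s, y) ∈ frontier Ω ↔ s = f y := by
  rw [h.isLocalDefiningFunction.mem_frontier_iff hΩ (h.closedBall_subset
    (sliceMap_mem_closedBall h.norm_normal hs hy.le)).1]
  constructor
  · intro h3
    have h1 := h.abs_sub_height_le hf hs hy
    rw [h3, zero_sub, abs_neg] at h1
    have : |s - f y| ≤ 0 := by nlinarith [abs_nonneg (s - f y)]
    exact sub_eq_zero.1 (abs_nonpos_iff.1 this)
  · rintro rfl
    exact (hf y hy).2

theorem frontier_inter_chartBox_inter (hΩ : IsOpen Ω) (h : IsBoundaryChart Ω O z V ρ n ε r)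
    (hε : ε ≤ 1 / 4) (hf : ∀ y, ‖y‖ < r → |f y| < r ∧ ρ (sliceMap z n (f y, y)) = 0)
    (A : Set (EuclideanSpace ℝ (Fin N))) :
    A ∩ chartBox z n h.norm_normal r ∩ frontier Ω =
      graphMap z n f '' (graphMap z n f ⁻¹' A ∩ Metric.ball 0 r) := by
  ext x
  constructor
  · rintro ⟨⟨h1, h2⟩, h3⟩
    rw [← sliceMap_sliceCoord (z := z) h.norm_normal x] at h1 h2 h3 ⊢
    set q := sliceCoord z n h.norm_normal x
    obtain ⟨h4, h5⟩ := (sliceMap_mem_chartBox_iff h.norm_normal q.1 q.2).1 h2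
    have h6 := (h.sliceMap_mem_frontier_iff hΩ hε hf h4.le h5).1 h3
    have h7 : graphMap z n f q.2 = sliceMap z n q := by rw [graphMap, ← h6]
    exact ⟨q.2, ⟨by rw [Set.mem_preimage, h7]; exact h1, mem_ball_zero_iff.2 h5⟩, h7⟩
  · rintro ⟨y, ⟨h1, h2⟩, rfl⟩
    rw [mem_ball_zero_iff] at h2
    refine ⟨⟨h1, (sliceMap_mem_chartBox_iff _ _ _).2 ⟨(hf y h2).1, h2⟩⟩, ?_⟩
    exact (h.sliceMap_mem_frontier_iff hΩ hε hf (hf y h2).1.le h2).2 rfl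

/-- The surface measure in a boundary chart is comparable to the Lebesgue measure on the
hyperplane, with constants close to `1`. -/
theorem map_graphMap_le_surfaceMeasure (hΩ : IsOpen Ω) (h : IsBoundaryChart Ω O z V ρ n ε r)
    (hε : ε ≤ 1 / 4) (hfl : LipschitzWith (2 * ε).toNNReal f)
    (hf : ∀ y, ‖y‖ < r → |f y| < r ∧ ρ (sliceMap z n (f y, y)) = 0) :
    Measure.map (graphMap z n f) (volume.restrict (Metric.ball 0 r)) ≤
      (surfaceMeasure Ω).restrict (chartBox z n h.norm_normal r) ∧
    (surfaceMeasure Ω).restrict (chartBox z n h.norm_normal r) ≤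
      ENNReal.ofReal ((1 + 2 * ε) ^ (N - 1)) •
        Measure.map (graphMap z n f) (volume.restrict (Metric.ball 0 r)) := by
  have hnt : Nontrivial (EuclideanSpace ℝ (Fin N)) :=
    ⟨n, 0, fun h0 => by simpa [h0] using h.norm_normal⟩
  have hm : Measurable (graphMap z n f) :=
    (lipschitzWith_graphMap h.norm_normal hfl).continuous.measurable
  have key : ∀ A, MeasurableSet A →
      Measure.map (graphMap z n f) (volume.restrict (Metric.ball 0 r)) A =
        volume (graphMap z n f ⁻¹' A ∩ Metric.ball 0 r) ∧
      (surfaceMeasure Ω).restrict (chartBox z n h.norm_normal r) A =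
        Measure.euclideanHausdorffMeasure (N - 1)
          (graphMap z n f '' (graphMap z n f ⁻¹' A ∩ Metric.ball 0 r)) := by
    intro A hA
    constructor
    · rw [Measure.map_apply hm hA, Measure.restrict_apply (hm hA)]
    · rw [Measure.restrict_apply hA, surfaceMeasure, Measure.restrict_apply
        (hA.inter (isOpen_chartBox h.norm_normal).measurableSet),
        h.frontier_inter_chartBox_inter hΩ hε hf]
  have comp := fun S => volume_le_euclideanHausdorffMeasure_graph (z := z) h.norm_normal hfl S
  rw [finrank_euclideanSpace_fin] at comp
  refine ⟨Measure.le_iff.2 fun A hA => ?_, Measure.le_iff.2 fun A hA => ?_⟩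
  · rw [(key A hA).1, (key A hA).2]
    exact (comp _).1
  · rw [Measure.smul_apply, (key A hA).1, (key A hA).2, smul_eq_mul]
    refine (comp _).2.trans (le_of_eq ?_)
    have := h.nonneg
    rw [ENNReal.ofReal_pow (by positivity), ENNReal.ofReal_add zero_le_one (by positivity),
      ENNReal.ofReal_one]
    rfl

end IsBoundaryChart

end BoundaryGraph

/-! ### Boundary layer cutoffs in the weak divergence identity -/

section LocalFlux

variable {N : ℕ} {Ω V O : Set (EuclideanSpace ℝ (Fin N))} {z n : EuclideanSpace ℝ (Fin N)}
  {ρ : EuclideanSpace ℝ (Fin N) → ℝ} {ε r δ : ℝ} {ζ : EuclideanSpace ℝ (Fin N) → ℝ}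
  {Y : EuclideanSpace ℝ (Fin N) → EuclideanSpace ℝ (Fin N)} {c : EuclideanSpace ℝ (Fin N) → ℝ}

theorem integrable_inner_gradient_add_mul {μ : Measure (EuclideanSpace ℝ (Fin N))}
    (hY : Integrable Y μ) (hc : Integrable c μ) (hζ : ContDiff ℝ ∞ ζ) (hζc : HasCompactSupport ζ) :
    Integrable (fun x => inner ℝ (Y x) (gradient ζ x) + c x * ζ x) μ := by
  have h1 : ContDiff ℝ 1 ζ := hζ.of_le (by exact_mod_cast le_top)
  refine Integrable.add ?_ ?_
  · exact integrable_inner_of_memLp (p := 1) (q := ⊤) (memLp_one_iff_integrable.2 hY)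
      ((continuous_gradient h1).memLp_top_of_hasCompactSupport (hasCompactSupport_gradient hζc) μ)
  · refine integrable_inner_of_memLp (p := ⊤) (q := 1)
      (hζ.continuous.memLp_top_of_hasCompactSupport hζc μ)
      (memLp_one_iff_integrable.2 hc)

namespace IsBoundaryChart

theorem tsupport_mul_smoothTransition_subset (h : IsBoundaryChart Ω O z V ρ n ε r) (hδ : 0 < δ)
    (hs : tsupport ζ ⊆ V) :
    tsupport (fun x => ζ x * Real.smoothTransition (-ρ x / δ - 1)) ⊆ tsupport ζ ∩ Ω := by
  have hcont : ContinuousOn ρ (tsupport ζ) :=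
    h.isLocalDefiningFunction.smooth.continuousOn.mono hs
  have hcl : IsClosed (tsupport ζ ∩ ρ ⁻¹' Set.Iic (-δ)) :=
    hcont.preimage_isClosed_of_isClosed (isClosed_tsupport ζ) isClosed_Iic
  have h1 : tsupport (fun x => ζ x * Real.smoothTransition (-ρ x / δ - 1)) ⊆
      tsupport ζ ∩ ρ ⁻¹' Set.Iic (-δ) := by
    refine closure_minimal (fun x hx => ?_) hcl
    rw [Function.mem_support, mul_ne_zero_iff] at hx
    refine ⟨subset_tsupport ζ hx.1, ?_⟩
    rw [Set.mem_preimage, Set.mem_Iic]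
    by_contra h2
    refine hx.2 (Real.smoothTransition.zero_of_nonpos ?_)
    rw [sub_nonpos, div_le_one hδ]
    linarith
  refine h1.trans fun x hx => ⟨hx.1, ?_⟩
  rw [h.isLocalDefiningFunction.mem_iff x (hs hx.1)]
  have := hx.2
  rw [Set.mem_preimage, Set.mem_Iic] at this
  linarith

theorem inner_gradient_mul_smoothTransition (h : IsBoundaryChart Ω O z V ρ n ε r)
    (hζ : ContDiff ℝ ∞ ζ) (hδ : 0 < δ) (hs : tsupport ζ ⊆ V) (v x : EuclideanSpace ℝ (Fin N)) :
    inner ℝ v (gradient (fun x => ζ x * Real.smoothTransition (-ρ x / δ - 1)) x) =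
      Real.smoothTransition (-ρ x / δ - 1) * inner ℝ v (gradient ζ x) -
        inner ℝ ((ζ x * transitionKernel δ (ρ x)) • gradient ρ x) v := by
  by_cases hx : x ∈ tsupport ζ
  swap
  · rw [gradient_eq_zero_of_notMem_tsupport hx, gradient_eq_zero_of_notMem_tsupport
      (fun h2 => hx (h.tsupport_mul_smoothTransition_subset hδ hs h2).1),
      image_eq_zero_of_notMem_tsupport hx]
    simp
  have h1 := (hasDerivAt_neg_smoothTransition δ (hasDerivAt_id' (ρ x))).comp_hasFDerivAt x
    (h.isLocalDefiningFunction.hasFDerivAt (hs hx))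
  have h2 : HasFDerivAt (fun x => Real.smoothTransition (-ρ x / δ - 1))
      (-((1 * transitionKernel δ (ρ x)) • innerSL ℝ (gradient ρ x))) x := by
    refine h1.neg.congr_of_eventuallyEq (Eventually.of_forall fun w => ?_)
    simp
  have h3 := ((hζ.differentiable (by simp)) x).hasFDerivAt.mul h2
  have h4 : fderiv ℝ (fun x => ζ x * Real.smoothTransition (-ρ x / δ - 1)) x = _ := h3.fderiv
  rw [real_inner_comm, inner_gradient_eq, h4, real_inner_comm (gradient ζ x),
    inner_gradient_eq, real_inner_smul_left]
  simp only [add_apply, smul_apply,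
    neg_apply, innerSL_apply_apply, smul_eq_mul]
  ring

/-- The cutoff S(-ρ/δ - 1) makes ζ an admissible test function with support inside Ω. The derivative
falling on the cutoff produces the layer integral on the right, which concentrates on the boundary
as δ → 0. -/
theorem integral_smoothTransition_mul (h : IsBoundaryChart Ω O z V ρ n ε r)
    (hY : IntegrableOn Y Ω) (hc : IntegrableOn c Ω)
    (hw : ∀ ζ : EuclideanSpace ℝ (Fin N) → ℝ, ContDiff ℝ ∞ ζ → HasCompactSupport ζ →
      tsupport ζ ⊆ Ω ∩ O → ∫ x in Ω, (inner ℝ (Y x) (gradient ζ x) + c x * ζ x) = 0)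
    (hζ : ContDiff ℝ ∞ ζ) (hζc : HasCompactSupport ζ) (hs : tsupport ζ ⊆ V ∩ O) (hδ : 0 < δ) :
    IntegrableOn (fun x => Real.smoothTransition (-ρ x / δ - 1) *
      (inner ℝ (Y x) (gradient ζ x) + c x * ζ x)) Ω ∧
    IntegrableOn (fun x => inner ℝ ((ζ x * transitionKernel δ (ρ x)) • gradient ρ x) (Y x)) Ω ∧
    ∫ x in Ω, Real.smoothTransition (-ρ x / δ - 1) *
      (inner ℝ (Y x) (gradient ζ x) + c x * ζ x) =
    ∫ x in Ω, inner ℝ ((ζ x * transitionKernel δ (ρ x)) • gradient ρ x) (Y x) := by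
  have hsV : tsupport ζ ⊆ V := hs.trans Set.inter_subset_left
  have hd := h.isLocalDefiningFunction
  set ψ : EuclideanSpace ℝ (Fin N) → ℝ := fun x => ζ x * Real.smoothTransition (-ρ x / δ - 1)
    with hψ
  have hψs := h.tsupport_mul_smoothTransition_subset hδ hsV
  have hψd : ContDiff ℝ ∞ ψ := by
    refine contDiff_mul_of_tsupport_subset hd.isOpen hζ hsV ?_
    exact Real.smoothTransition.contDiff.comp_contDiffOn
      ((hd.smooth.neg.div_const δ).sub contDiffOn_const)
  have hψc : HasCompactSupport ψ := hζc.mul_right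
  have hG := integrable_inner_gradient_add_mul (μ := volume.restrict Ω) hY hc hψd hψc
  have hG0 := hw ψ hψd hψc fun x hx => ⟨(hψs hx).2, (hs (hψs hx).1).2⟩
  have hmc : HasCompactSupport (fun x => (ζ x * transitionKernel δ (ρ x)) • gradient ρ x) :=
    HasCompactSupport.smul_right (f := fun x => ζ x * transitionKernel δ (ρ x)) hζc.mul_right
  have hm : Continuous (fun x => (ζ x * transitionKernel δ (ρ x)) • gradient ρ x) := by
    have : ContinuousOn (fun x => (ζ x * transitionKernel δ (ρ x)) • gradient ρ x) V :=
      (hζ.continuous.continuousOn.mul ((continuous_transitionKernel δ).comp_continuousOn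
        hd.smooth.continuousOn)).smul hd.continuousOn_gradient
    refine this.continuous_of_tsupport_subset hd.isOpen (closure_minimal ?_ (isClosed_tsupport ζ)
      |>.trans hsV)
    intro x hx
    refine subset_tsupport ζ fun h0 => hx ?_
    simp only [h0, zero_mul, zero_smul]
  have hT2 : IntegrableOn
      (fun x => inner ℝ ((ζ x * transitionKernel δ (ρ x)) • gradient ρ x) (Y x)) Ω :=
    integrable_inner_of_memLp (p := ⊤) (q := 1) (hm.memLp_top_of_hasCompactSupport hmc _)
      (memLp_one_iff_integrable.2 hY)
  have heq : ∀ x, Real.smoothTransition (-ρ x / δ - 1) *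
      (inner ℝ (Y x) (gradient ζ x) + c x * ζ x) =
      (inner ℝ (Y x) (gradient ψ x) + c x * ψ x) +
        inner ℝ ((ζ x * transitionKernel δ (ρ x)) • gradient ρ x) (Y x) := by
    intro x
    rw [h.inner_gradient_mul_smoothTransition hζ hδ hsV]
    simp only [hψ]
    ring
  simp only [heq]
  refine ⟨hG.add hT2, hT2, ?_⟩
  rw [integral_add hG hT2, hG0, zero_add]

/-- At a fixed point of Ω the cutoff is 1 as soon as δ < -ρ/2, so dominated convergence identifies
the limit of the layer integrals. -/
theorem tendsto_integral_smoothTransition_mul (hΩ : IsOpen Ω)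
    (h : IsBoundaryChart Ω O z V ρ n ε r)
    (hY : IntegrableOn Y Ω) (hc : IntegrableOn c Ω)
    (hw : ∀ ζ : EuclideanSpace ℝ (Fin N) → ℝ, ContDiff ℝ ∞ ζ → HasCompactSupport ζ →
      tsupport ζ ⊆ Ω ∩ O → ∫ x in Ω, (inner ℝ (Y x) (gradient ζ x) + c x * ζ x) = 0)
    (hζ : ContDiff ℝ ∞ ζ) (hζc : HasCompactSupport ζ) (hs : tsupport ζ ⊆ V ∩ O) :
    Tendsto (fun δ => ∫ x in Ω,
        inner ℝ ((ζ x * transitionKernel δ (ρ x)) • gradient ρ x) (Y x)) (𝓝[>] 0)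
      (𝓝 (∫ x in Ω, (inner ℝ (Y x) (gradient ζ x) + c x * ζ x))) := by
  have hmain := fun δ (hδ : 0 < δ) =>
    h.integral_smoothTransition_mul hY hc hw hζ hζc hs hδ
  have hint := integrable_inner_gradient_add_mul (μ := volume.restrict Ω) hY hc hζ hζc
  have hev : ∀ᶠ δ in 𝓝[>] (0 : ℝ), 0 < δ := self_mem_nhdsWithin
  refine (tendsto_integral_filter_of_dominated_convergence (μ := volume.restrict Ω)
    (F := fun δ x => Real.smoothTransition (-ρ x / δ - 1) *
      (inner ℝ (Y x) (gradient ζ x) + c x * ζ x))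
    (fun x => ‖inner ℝ (Y x) (gradient ζ x) + c x * ζ x‖) ?_ ?_ hint.norm ?_).congr' ?_
  · filter_upwards [hev] with δ hδ using (hmain δ hδ).1.aestronglyMeasurable
  · refine Eventually.of_forall fun δ => Eventually.of_forall fun x => ?_
    rw [norm_mul, Real.norm_of_nonneg (Real.smoothTransition.nonneg _)]
    exact mul_le_of_le_one_left (norm_nonneg _) (Real.smoothTransition.le_one _)
  · rw [ae_restrict_iff' hΩ.measurableSet]
    refine Eventually.of_forall fun x hx => ?_
    by_cases hxs : x ∈ tsupport ζ
    · have hρ := (h.isLocalDefiningFunction.mem_iff x (hs hxs).1).1 hx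
      refine tendsto_nhds_of_eventually_eq ?_
      have h2 : ∀ᶠ δ in 𝓝[>] (0 : ℝ), δ < -ρ x / 2 :=
        nhdsWithin_le_nhds (Iio_mem_nhds (by linarith))
      filter_upwards [hev, h2] with δ hδ hδ2
      rw [Real.smoothTransition.one_of_one_le, one_mul]
      rw [le_sub_iff_add_le, le_div_iff₀ hδ]
      linarith
    · rw [gradient_eq_zero_of_notMem_tsupport hxs, image_eq_zero_of_notMem_tsupport hxs]
      simp
  · filter_upwards [hev] with δ hδ using (hmain δ hδ).2.2

end IsBoundaryChart

end LocalFlux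

/-! ### Computing the layer integral along normal lines -/

section LocalFluxSlices

variable {N : ℕ} {Ω V O : Set (EuclideanSpace ℝ (Fin N))} {z n : EuclideanSpace ℝ (Fin N)}
  {ρ : EuclideanSpace ℝ (Fin N) → ℝ} {ε r δ : ℝ} {ζ : EuclideanSpace ℝ (Fin N) → ℝ}
  {Y : EuclideanSpace ℝ (Fin N) → EuclideanSpace ℝ (Fin N)} {c : EuclideanSpace ℝ (Fin N) → ℝ}
  {f : (ℝ ∙ n)ᗮ → ℝ}

namespace IsBoundaryChart

theorem inner_gradient_pos (h : IsBoundaryChart Ω O z V ρ n ε r) (hε : ε ≤ 1 / 4)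
    {x : EuclideanSpace ℝ (Fin N)} (hx : x ∈ Metric.closedBall z (2 * r)) :
    0 < inner ℝ (gradient ρ x) n := by
  linarith [h.le_inner_gradient hx]

theorem continuousOn_flux_density (h : IsBoundaryChart Ω O z V ρ n ε r) (hε : ε ≤ 1 / 4)
    (hY : ContinuousOn Y (closure Ω ∩ O)) (hζ : Continuous ζ) :
    ContinuousOn (fun x => ζ x * (inner ℝ (gradient ρ x) (Y x) / inner ℝ (gradient ρ x) n))
      (closure Ω ∩ Metric.closedBall z (2 * r)) := by
  have h1 : ContinuousOn (gradient ρ) (closure Ω ∩ Metric.closedBall z (2 * r)) :=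
    h.isLocalDefiningFunction.continuousOn_gradient.mono
      fun x hx => (h.closedBall_subset hx.2).1
  have h2 : ContinuousOn Y (closure Ω ∩ Metric.closedBall z (2 * r)) :=
    hY.mono fun x hx => ⟨hx.1, (h.closedBall_subset hx.2).2⟩
  exact hζ.continuousOn.mul ((h1.inner h2).div (h1.inner continuousOn_const)
    fun x hx => (h.inner_gradient_pos hε hx.2).ne')

theorem sliceMap_mem_closure (hΩ : IsOpen Ω) (h : IsBoundaryChart Ω O z V ρ n ε r)
    (hε : ε ≤ 1 / 4) (hf : ∀ y, ‖y‖ < r → |f y| < r ∧ ρ (sliceMap z n (f y, y)) = 0)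
    {s : ℝ} {y : (ℝ ∙ n)ᗮ} (hs : |s| ≤ r) (hy : ‖y‖ < r) (hsf : s ≤ f y) :
    sliceMap z n (s, y) ∈ closure Ω := by
  rcases hsf.lt_or_eq with h1 | h1
  · exact subset_closure ((h.sliceMap_mem_iff hε hf hs hy).2 h1)
  · exact frontier_subset_closure ((h.sliceMap_mem_frontier_iff hΩ hε hf hs hy).2 h1)

/-- Multiplying and dividing by the derivative ⟨∇ρ, n⟩ of ρ along the line brings the slice into the
form A R' k(R) handled by the one-dimensional lemmas. On the slice, Ω is the part below the graph.
-/
theorem integral_slice_eq (h : IsBoundaryChart Ω O z V ρ n ε r)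
    (hε : ε ≤ 1 / 4) (hf : ∀ y, ‖y‖ < r → |f y| < r ∧ ρ (sliceMap z n (f y, y)) = 0)
    (hs : tsupport ζ ⊆ chartBox z n h.norm_normal r) {y : (ℝ ∙ n)ᗮ} (hy : ‖y‖ < r) :
    ∫ s : ℝ, Ω.indicator (fun x => inner ℝ ((ζ x * transitionKernel δ (ρ x)) • gradient ρ x) (Y x))
        (sliceMap z n (s, y)) =
      ∫ s in (-r)..f y, (ζ (sliceMap z n (s, y)) *
          (inner ℝ (gradient ρ (sliceMap z n (s, y))) (Y (sliceMap z n (s, y))) /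
            inner ℝ (gradient ρ (sliceMap z n (s, y))) n)) *
        (inner ℝ (gradient ρ (sliceMap z n (s, y))) n *
          transitionKernel δ (ρ (sliceMap z n (s, y)))) := by
  have hfy := (abs_lt.1 (hf y hy).1)
  rw [intervalIntegral.integral_of_le hfy.1.le, integral_Ioc_eq_integral_Ioo,
    ← integral_indicator measurableSet_Ioo]
  refine integral_congr_ae (Eventually.of_forall fun s => ?_)
  simp only
  by_cases hsr : |s| < r
  · have hsl := abs_lt.1 hsr
    by_cases hsf : s < f y
    · rw [Set.indicator_of_mem ((h.sliceMap_mem_iff hε hf hsr.le hy).2 hsf),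
        Set.indicator_of_mem (Set.mem_Ioo.2 ⟨hsl.1, hsf⟩), real_inner_smul_left]
      have := (h.inner_gradient_pos hε (sliceMap_mem_closedBall h.norm_normal hsr.le hy.le)).ne'
      field_simp
    · rw [Set.indicator_of_notMem (fun h2 => hsf ((h.sliceMap_mem_iff hε hf hsr.le hy).1 h2)),
        Set.indicator_of_notMem (fun h2 : s ∈ Set.Ioo (-r) (f y) => hsf h2.2)]
  · rw [Set.indicator_of_notMem (fun h2 : s ∈ Set.Ioo (-r) (f y) =>
      hsr (abs_lt.2 ⟨h2.1, h2.2.trans hfy.2⟩))]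
    have : ζ (sliceMap z n (s, y)) = 0 := image_eq_zero_of_notMem_tsupport fun h2 =>
      hsr ((sliceMap_mem_chartBox_iff h.norm_normal s y).1 (hs h2)).1
    refine Set.indicator_apply_eq_zero.2 fun _ => ?_
    rw [this, zero_mul, zero_smul, inner_zero_left]

theorem integral_slice_eq_zero (h : IsBoundaryChart Ω O z V ρ n ε r)
    (hs : tsupport ζ ⊆ chartBox z n h.norm_normal r) {y : (ℝ ∙ n)ᗮ} (hy : ¬‖y‖ < r) :
    ∫ s : ℝ, Ω.indicator (fun x => inner ℝ ((ζ x * transitionKernel δ (ρ x)) • gradient ρ x) (Y x))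
        (sliceMap z n (s, y)) = 0 := by
  refine integral_eq_zero_of_ae (Eventually.of_forall fun s => ?_)
  have : ζ (sliceMap z n (s, y)) = 0 := image_eq_zero_of_notMem_tsupport fun h2 =>
      hy ((sliceMap_mem_chartBox_iff h.norm_normal s y).1 (hs h2)).2
  refine Set.indicator_apply_eq_zero.2 fun _ => ?_
  rw [this, zero_mul, zero_smul, inner_zero_left]

/-- The flux of a field through the boundary inside a chart, as an integral over the base of the
chart. -/
theorem integral_eq_integral_ball (hΩ : IsOpen Ω) (h : IsBoundaryChart Ω O z V ρ n ε r)
    (hε : ε ≤ 1 / 4) (hf : ∀ y, ‖y‖ < r → |f y| < r ∧ ρ (sliceMap z n (f y, y)) = 0)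
    (hY : IntegrableOn Y Ω) (hc : IntegrableOn c Ω) (hYc : ContinuousOn Y (closure Ω ∩ O))
    (hw : ∀ ζ : EuclideanSpace ℝ (Fin N) → ℝ, ContDiff ℝ ∞ ζ → HasCompactSupport ζ →
      tsupport ζ ⊆ Ω ∩ O → ∫ x in Ω, (inner ℝ (Y x) (gradient ζ x) + c x * ζ x) = 0)
    (hζ : ContDiff ℝ ∞ ζ) (hζc : HasCompactSupport ζ)
    (hs : tsupport ζ ⊆ chartBox z n h.norm_normal r) :
    ∫ x in Ω, (inner ℝ (Y x) (gradient ζ x) + c x * ζ x) =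
      ∫ y in Metric.ball (0 : (ℝ ∙ n)ᗮ) r, ζ (graphMap z n f y) *
        (inner ℝ (gradient ρ (graphMap z n f y)) (Y (graphMap z n f y)) /
          inner ℝ (gradient ρ (graphMap z n f y)) n) := by
  have hn := h.norm_normal
  have hsVO : tsupport ζ ⊆ V ∩ O :=
    hs.trans ((chartBox_subset_closedBall hn).trans h.closedBall_subset)
  have hlim := h.tendsto_integral_smoothTransition_mul hΩ hY hc hw hζ hζc hsVO
  -- The same layer integrals are computed a second time by slicing: on each line they converge to
  -- the value of A on the graph, dominated by the bound M of A over the ball.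
  refine tendsto_nhds_unique hlim ?_
  set A : EuclideanSpace ℝ (Fin N) → ℝ :=
    fun x => ζ x * (inner ℝ (gradient ρ x) (Y x) / inner ℝ (gradient ρ x) n) with hA
  have hAc := h.continuousOn_flux_density hε hYc hζ.continuous
  obtain ⟨M, hM⟩ := (((isCompact_closedBall z (2 * r)).inter_left
    isClosed_closure)).exists_bound_of_continuousOn hAc
  have hM' : ∀ s y, |s| ≤ r → ‖y‖ < r → s ≤ f y → |A (sliceMap z n (s, y))| ≤ M :=
    fun s y h1 h2 h3 => hM _ ⟨h.sliceMap_mem_closure hΩ hε hf h1 h2 h3,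
      sliceMap_mem_closedBall hn h1 h2.le⟩
  have hε0 := h.nonneg
  have hm : ∀ y, ∀ s ∈ Set.Icc (-r) (f y), ‖y‖ < r → |s| ≤ r := fun y s h1 h2 =>
    abs_le.2 ⟨h1.1, h1.2.trans (le_of_lt (abs_lt.1 (hf y h2).1).2)⟩
  have hR : ∀ y, ‖y‖ < r → ∀ s ∈ Set.Icc (-r) (f y), HasDerivAt (fun s => ρ (sliceMap z n (s, y)))
      (inner ℝ (gradient ρ (sliceMap z n (s, y))) n) s := by
    intro y hy s hs'
    have h1 := h.isLocalDefiningFunction.hasFDerivAt (h.closedBall_subset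
      (sliceMap_mem_closedBall hn (hm y s hs' hy) hy.le)).1
    exact h1.comp_hasDerivAt s (hasDerivAt_sliceMap y s)
  have hPc : ∀ y, Continuous fun s => sliceMap z n (s, y) := fun y =>
    continuous_sliceMap.comp (by fun_prop)
  have hR' : ∀ y, ‖y‖ < r → ContinuousOn
      (fun s => inner ℝ (gradient ρ (sliceMap z n (s, y))) n) (Set.Icc (-r) (f y)) := by
    intro y hy
    refine ContinuousOn.inner (h.isLocalDefiningFunction.continuousOn_gradient.comp
      (hPc y).continuousOn fun s hs' => ?_) continuousOn_const
    exact (h.closedBall_subset (sliceMap_mem_closedBall hn (hm y s hs' hy) hy.le)).1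
  have hR'0 : ∀ y, ‖y‖ < r → ∀ s ∈ Set.Icc (-r) (f y),
      0 ≤ inner ℝ (gradient ρ (sliceMap z n (s, y))) n := fun y hy s hs' =>
    (h.inner_gradient_pos hε (sliceMap_mem_closedBall hn (hm y s hs' hy) hy.le)).le
  have hint := fun δ (hδ : 0 < δ) =>
    (h.integral_smoothTransition_mul hY hc hw hζ hζc hsVO hδ).2.1
  have hev : ∀ᶠ δ in 𝓝[>] (0 : ℝ), 0 < δ := self_mem_nhdsWithin
  rw [← integral_indicator Metric.isOpen_ball.measurableSet]
  refine (tendsto_integral_filter_of_dominated_convergence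
    (F := fun δ (y : (ℝ ∙ n)ᗮ) => ∫ s : ℝ, Ω.indicator
      (fun x => inner ℝ ((ζ x * transitionKernel δ (ρ x)) • gradient ρ x) (Y x))
        (sliceMap z n (s, y)))
    ((Metric.ball (0 : (ℝ ∙ n)ᗮ) r).indicator fun _ => M) ?_ ?_ ?_ ?_).congr' ?_
  · filter_upwards [hev] with δ hδ
    exact (integrable_integral_sliceMap hn
      ((integrable_indicator_iff hΩ.measurableSet).2 (hint δ hδ))).aestronglyMeasurable
  · filter_upwards [hev] with δ hδ
    refine Eventually.of_forall fun y => ?_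
    by_cases hy : ‖y‖ < r
    · rw [h.integral_slice_eq hε hf hs hy, Set.indicator_of_mem (mem_ball_zero_iff.2 hy),
        Real.norm_eq_abs]
      have hb := (abs_lt.1 (hf y hy).1)
      exact abs_integral_transitionKernel_le hb.1.le (hR y hy) (hR' y hy) (hR'0 y hy) (hf y hy).2
        ((abs_nonneg _).trans (hM' (f y) y (hf y hy).1.le hy le_rfl)) hδ
        fun s hs' _ => hM' s y (hm y s hs' hy) hy hs'.2
    · rw [h.integral_slice_eq_zero hs hy, Set.indicator_of_notMem
        (fun h2 => hy (mem_ball_zero_iff.1 h2)), norm_zero]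
  · exact (integrable_indicator_iff Metric.isOpen_ball.measurableSet).2
      (integrableOn_const measure_ball_lt_top.ne)
  · refine Eventually.of_forall fun y => ?_
    by_cases hy : ‖y‖ < r
    · rw [Set.indicator_of_mem (mem_ball_zero_iff.2 hy)]
      simp only [h.integral_slice_eq hε hf hs hy]
      have hb := (abs_lt.1 (hf y hy).1)
      refine tendsto_integral_transitionKernel (A := fun s => A (sliceMap z n (s, y)))
        hb.1 (hR y hy) (hR' y hy) (hR'0 y hy) (hf y hy).2
        (c := 1 - ε) (by linarith) (fun s hs' => ?_) ?_
      · have h1 := h.abs_sub_height_le hf (hm y s hs' hy) hy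
        rw [abs_of_nonpos (sub_nonpos.2 hs'.2)] at h1
        have := (abs_le.1 h1).2
        linarith
      · exact hAc.comp (hPc y).continuousOn fun s hs' =>
          ⟨h.sliceMap_mem_closure hΩ hε hf (hm y s hs' hy) hy hs'.2,
            sliceMap_mem_closedBall hn (hm y s hs' hy) hy.le⟩
    · rw [Set.indicator_of_notMem (fun h2 => hy (mem_ball_zero_iff.1 h2))]
      simp only [h.integral_slice_eq_zero hs hy]
      exact tendsto_const_nhds
  · filter_upwards [hev] with δ hδ
    rw [← integral_eq_integral_sliceMap hn
      ((integrable_indicator_iff hΩ.measurableSet).2 (hint δ hδ)),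
      integral_indicator hΩ.measurableSet]

end IsBoundaryChart

end LocalFluxSlices

/-- Monotonicity in the measure is applied to the nonnegative functions |φ| + φ and |φ| - φ. The
loss is the difference of the two integrals of |φ|, at most (C - 1) times the larger one. -/
theorem abs_integral_sub_integral_le_of_le_smul {α : Type*} [MeasurableSpace α] {μ μ' : Measure α}
    {C : ℝ} (h1 : μ' ≤ μ) (h2 : μ ≤ ENNReal.ofReal C • μ') (hC : 1 ≤ C) {φ : α → ℝ}
    (hφ : Integrable φ μ) : |∫ x, φ x ∂μ' - ∫ x, φ x ∂μ| ≤ (C - 1) * ∫ x, |φ x| ∂μ := by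
  have hφ' := hφ.mono_measure h1
  have a1 : ∫ x, (|φ x| + φ x) ∂μ' ≤ ∫ x, (|φ x| + φ x) ∂μ :=
    integral_mono_measure h1 (Eventually.of_forall fun x => by
      simp only [Pi.zero_apply]; linarith [neg_abs_le (φ x)]) (hφ.abs.add hφ)
  have a2 : ∫ x, (|φ x| - φ x) ∂μ' ≤ ∫ x, (|φ x| - φ x) ∂μ :=
    integral_mono_measure h1 (Eventually.of_forall fun x => by
      simp only [Pi.zero_apply]; linarith [le_abs_self (φ x)]) (hφ.abs.sub hφ)
  have a3 : ∫ x, |φ x| ∂μ' ≤ ∫ x, |φ x| ∂μ :=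
    integral_mono_measure h1 (Eventually.of_forall fun x => abs_nonneg _) hφ.abs
  have a4 : ∫ x, |φ x| ∂μ ≤ ∫ x, |φ x| ∂(ENNReal.ofReal C • μ') :=
    integral_mono_measure h2 (Eventually.of_forall fun x => abs_nonneg _)
      (hφ'.abs.smul_measure ENNReal.ofReal_ne_top)
  rw [integral_smul_measure, ENNReal.toReal_ofReal (by linarith), smul_eq_mul] at a4
  rw [integral_add hφ'.abs hφ', integral_add hφ.abs hφ] at a1
  rw [integral_sub hφ'.abs hφ', integral_sub hφ.abs hφ] at a2
  have a5 : (C - 1) * ∫ x, |φ x| ∂μ' ≤ (C - 1) * ∫ x, |φ x| ∂μ :=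
    mul_le_mul_of_nonneg_left a3 (by linarith)
  rw [abs_le]
  constructor <;> linarith

/-! ### Surface measure and the approximate flux formula in a chart -/

section SurfaceMeasure

variable {N : ℕ} {Ω V O W : Set (EuclideanSpace ℝ (Fin N))} {z n : EuclideanSpace ℝ (Fin N)}
  {ρ : EuclideanSpace ℝ (Fin N) → ℝ} {ε r δ : ℝ} {ζ : EuclideanSpace ℝ (Fin N) → ℝ}
  {Y : EuclideanSpace ℝ (Fin N) → EuclideanSpace ℝ (Fin N)} {c : EuclideanSpace ℝ (Fin N) → ℝ}

theorem isLocallyFiniteMeasure_surfaceMeasure (hΩ : IsOpen Ω) (hs : HasSmoothBoundary Ω) :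
    IsLocallyFiniteMeasure (surfaceMeasure Ω) := by
  refine ⟨fun z => ?_⟩
  by_cases hz : z ∈ frontier Ω
  · obtain ⟨V, ρ, n, r, h⟩ := hs.exists_isBoundaryChart (O := Set.univ) univ_mem hz
      (ε := 1 / 4) (by norm_num)
    obtain ⟨f, hfl, hf⟩ := h.exists_graph hΩ hz le_rfl
    refine ⟨_, (isOpen_chartBox h.norm_normal).mem_nhds
      (mem_chartBox_self h.norm_normal h.radius_pos), ?_⟩
    have h1 := (h.map_graphMap_le_surfaceMeasure hΩ le_rfl hfl hf).2 Set.univ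
    rw [Measure.restrict_apply_univ] at h1
    refine h1.trans_lt ?_
    rw [Measure.smul_apply, smul_eq_mul, Measure.map_apply
      (lipschitzWith_graphMap h.norm_normal hfl).continuous.measurable MeasurableSet.univ,
      Set.preimage_univ, Measure.restrict_apply_univ]
    exact ENNReal.mul_lt_top ENNReal.ofReal_lt_top measure_ball_lt_top
  · refine ⟨(frontier Ω)ᶜ, isClosed_frontier.isOpen_compl.mem_nhds hz, ?_⟩
    rw [surfaceMeasure, Measure.restrict_apply isClosed_frontier.isOpen_compl.measurableSet,
      Set.compl_inter_self, measure_empty]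
    exact ENNReal.zero_lt_top

theorem ae_mem_frontier : ∀ᵐ x ∂(surfaceMeasure Ω), x ∈ frontier Ω :=
  ae_restrict_mem isClosed_frontier.measurableSet

theorem integrable_surfaceMeasure_of_continuousOn {F : Type*} [NormedAddCommGroup F]
    (hΩ : IsOpen Ω) (hs : HasSmoothBoundary Ω)
    {S : Set (EuclideanSpace ℝ (Fin N))} (hS : IsCompact S)
    {q : EuclideanSpace ℝ (Fin N) → F} (hq : ContinuousOn q (frontier Ω ∩ S))
    (h0 : ∀ x ∈ frontier Ω, x ∉ S → q x = 0) : Integrable q (surfaceMeasure Ω) := by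
  have := isLocallyFiniteMeasure_surfaceMeasure hΩ hs
  have hcomp : IsCompact (frontier Ω ∩ S) := hS.inter_left isClosed_frontier
  have h1 : IntegrableOn q (frontier Ω ∩ S) (surfaceMeasure Ω) :=
    hq.integrableOn_compact hcomp
  refine ((integrable_indicator_iff hcomp.measurableSet).2 h1).congr ?_
  filter_upwards [ae_mem_frontier] with x hx
  by_cases hxS : x ∈ S
  · rw [Set.indicator_of_mem (Set.mem_inter hx hxS)]
  · rw [Set.indicator_of_notMem fun h => hxS h.2, h0 x hx hxS]

theorem integrable_mul_norm_surfaceMeasure (hΩ : IsOpen Ω) (hs : HasSmoothBoundary Ω)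
    (hWO : frontier Ω ∩ W ⊆ O) (hYc : ContinuousOn Y (closure Ω ∩ O)) (hζ : Continuous ζ)
    (hζc : HasCompactSupport ζ) (hζW : tsupport ζ ⊆ W) :
    Integrable (fun x => ζ x * inner ℝ (Y x) (outerUnitNormal Ω x)) (surfaceMeasure Ω) ∧
      Integrable (fun x => |ζ x| * ‖Y x‖) (surfaceMeasure Ω) := by
  have hY : ContinuousOn Y (frontier Ω ∩ tsupport ζ) :=
    hYc.mono fun x hx => ⟨frontier_subset_closure hx.1, hWO ⟨hx.1, hζW hx.2⟩⟩
  have h0 : ∀ x, x ∉ tsupport ζ → ζ x = 0 := fun x hx => image_eq_zero_of_notMem_tsupport hx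
  refine ⟨integrable_surfaceMeasure_of_continuousOn hΩ hs hζc ?_ fun x _ hx => by
    rw [h0 x hx, zero_mul], integrable_surfaceMeasure_of_continuousOn hΩ hs hζc ?_ fun x _ hx => by
    rw [h0 x hx, abs_zero, zero_mul]⟩
  · exact hζ.continuousOn.mul (hY.inner
      ((continuousOn_outerUnitNormal hΩ hs).mono Set.inter_subset_left))
  · exact hζ.abs.continuousOn.mul hY.norm

namespace IsBoundaryChart

/-- The numerator minus the denominator is at most (1 + ε) - (1 - ε) = 2ε, and the denominator is at
least 3/4. -/
theorem abs_ratio_sub_one_le (h : IsBoundaryChart Ω O z V ρ n ε r) (hε : ε ≤ 1 / 4)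
    {x : EuclideanSpace ℝ (Fin N)} (hx : x ∈ Metric.closedBall z (2 * r)) :
    |‖gradient ρ x‖ / inner ℝ (gradient ρ x) n - 1| ≤ 4 * ε := by
  have h1 := h.inner_gradient_pos hε hx
  have h2 := h.le_inner_gradient hx
  have h3 := h.norm_gradient_le hx
  have h4 := h.inner_gradient_le (x := x)
  have h5 := h.nonneg
  rw [div_sub_one h1.ne', abs_of_nonneg (div_nonneg (by linarith) h1.le), div_le_iff₀ h1]
  nlinarith

/-- The divergence theorem in a boundary chart, up to an error that is small relative to the
oscillation `ε` of the normal. -/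
theorem abs_integral_sub_flux_le (hΩ : IsOpen Ω) (hsm : HasSmoothBoundary Ω)
    (h : IsBoundaryChart Ω O z V ρ n ε r)
    (hε : ε ≤ 1 / 4) (hz : z ∈ frontier Ω)
    (hY : IntegrableOn Y Ω) (hc : IntegrableOn c Ω) (hYc : ContinuousOn Y (closure Ω ∩ O))
    (hw : ∀ ζ : EuclideanSpace ℝ (Fin N) → ℝ, ContDiff ℝ ∞ ζ → HasCompactSupport ζ →
      tsupport ζ ⊆ Ω ∩ O → ∫ x in Ω, (inner ℝ (Y x) (gradient ζ x) + c x * ζ x) = 0)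
    (hζ : ContDiff ℝ ∞ ζ) (hζc : HasCompactSupport ζ)
    (hs : tsupport ζ ⊆ chartBox z n h.norm_normal r) :
    |(∫ x in Ω, (inner ℝ (Y x) (gradient ζ x) + c x * ζ x)) -
        ∫ x, ζ x * inner ℝ (Y x) (outerUnitNormal Ω x) ∂(surfaceMeasure Ω)| ≤
      (4 * ε + ((1 + 2 * ε) ^ (N - 1) - 1)) * ∫ x, |ζ x| * ‖Y x‖ ∂(surfaceMeasure Ω) := by
  have hn := h.norm_normal
  have hε0 := h.nonneg
  obtain ⟨f, hfl, hf⟩ := h.exists_graph hΩ hz hε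
  obtain ⟨hle, hle'⟩ := h.map_graphMap_le_surfaceMeasure hΩ hε hfl hf
  rw [h.integral_eq_integral_ball hΩ hε hf hY hc hYc hw hζ hζc hs]
  set B := chartBox z n h.norm_normal r with hB
  set ν' := Measure.map (graphMap z n f) (volume.restrict (Metric.ball 0 r)) with hν'
  have hBO : tsupport ζ ⊆ O :=
    hs.trans ((chartBox_subset_closedBall hn).trans fun x hx => (h.closedBall_subset hx).2)
  obtain ⟨hφ, hψ⟩ := integrable_mul_norm_surfaceMeasure hΩ hsm (O := O) (W := O)
    Set.inter_subset_right hYc hζ.continuous hζc hBO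
  set φ : EuclideanSpace ℝ (Fin N) → ℝ := fun x => ζ x * inner ℝ (Y x) (outerUnitNormal Ω x) with hφd
  set A : EuclideanSpace ℝ (Fin N) → ℝ :=
    fun x => ζ x * (inner ℝ (gradient ρ x) (Y x) / inner ℝ (gradient ρ x) n) with hA
  have hBm : MeasurableSet B := (isOpen_chartBox h.norm_normal).measurableSet
  have hmem : ∀ᵐ x ∂((surfaceMeasure Ω).restrict B), x ∈ frontier Ω ∧ x ∈ B := by
    filter_upwards [ae_restrict_mem hBm, ae_restrict_of_ae ae_mem_frontier] with x h1 h2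
    exact ⟨h2, h1⟩
  have hmem' : ∀ᵐ x ∂ν', x ∈ frontier Ω ∧ x ∈ B := ae_mono hle hmem
  have hAm : AEStronglyMeasurable A ν' := by
    have h1 : AEStronglyMeasurable A
        ((Measure.euclideanHausdorffMeasure (N - 1)).restrict (B ∩ frontier Ω)) :=
      ((h.continuousOn_flux_density hε hYc hζ.continuous).mono fun x hx =>
        ⟨frontier_subset_closure hx.2, chartBox_subset_closedBall hn hx.1⟩).aestronglyMeasurable
        (hBm.inter isClosed_frontier.measurableSet)
    rw [← Measure.restrict_restrict hBm] at h1
    exact h1.mono_measure hle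
  have hint : ∫ y in Metric.ball (0 : (ℝ ∙ n)ᗮ) r, A (graphMap z n f y) = ∫ x, A x ∂ν' := by
    rw [integral_map (lipschitzWith_graphMap hn hfl).continuous.aemeasurable hAm]
  -- On the boundary ∇ρ = ‖∇ρ‖ ν, so the chart density differs from the true flux density by the
  -- factor ‖∇ρ‖ / ⟨∇ρ, n⟩, which is close to 1.
  have hAφ : ∀ x ∈ frontier Ω, x ∈ B →
      A x = ‖gradient ρ x‖ / inner ℝ (gradient ρ x) n * φ x := by
    intro x hx hxB
    have hcb := chartBox_subset_closedBall hn hxB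
    have hV := (h.closedBall_subset hcb).1
    have hg := norm_ne_zero_iff.2 (h.isLocalDefiningFunction.gradient_ne_zero x hV)
    have h1 := (h.inner_gradient_pos hε hcb).ne'
    simp only [hA, hφd]
    rw [(h.isLocalDefiningFunction.of_mem hV).outerUnitNormal_eq hΩ hx, real_inner_smul_right,
      real_inner_comm (Y x)]
    field_simp
  have hφB : Integrable φ ((surfaceMeasure Ω).restrict B) := hφ.restrict
  have hφ' : Integrable φ ν' := hφB.mono_measure hle
  have hdiff : ∀ᵐ x ∂ν', |A x - φ x| ≤ 4 * ε * |φ x| := by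
    filter_upwards [hmem'] with x hx
    rw [hAφ x hx.1 hx.2, ← sub_one_mul, abs_mul]
    exact mul_le_mul_of_nonneg_right
      (h.abs_ratio_sub_one_le hε (chartBox_subset_closedBall hn hx.2)) (abs_nonneg _)
  have hAφi : Integrable (fun x => A x - φ x) ν' :=
    (hφ'.abs.const_mul (4 * ε)).mono' (hAm.sub hφ'.aestronglyMeasurable) hdiff
  have e1 : |∫ x, A x ∂ν' - ∫ x, φ x ∂ν'| ≤ 4 * ε * ∫ x, |φ x| ∂ν' := by
    have hAi : Integrable A ν' := (hAφi.add hφ').congr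
      (Eventually.of_forall fun x => sub_add_cancel (A x) (φ x))
    rw [← integral_sub hAi hφ', ← integral_const_mul]
    exact (abs_integral_le_integral_abs).trans
      (integral_mono_ae hAφi.abs (hφ'.abs.const_mul _) hdiff)
  have e2 := abs_integral_sub_integral_le_of_le_smul hle hle'
    (one_le_pow₀ (by linarith)) hφB
  have e3 : ∫ x, |φ x| ∂ν' ≤ ∫ x, |φ x| ∂((surfaceMeasure Ω).restrict B) :=
    integral_mono_measure hle (Eventually.of_forall fun x => abs_nonneg _) hφB.abs
  have e4 : ∫ x, |φ x| ∂((surfaceMeasure Ω).restrict B) ≤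
      ∫ x, |ζ x| * ‖Y x‖ ∂(surfaceMeasure Ω) := by
    refine (setIntegral_le_integral hφ.abs (Eventually.of_forall fun x => abs_nonneg _)).trans ?_
    refine integral_mono hφ.abs hψ fun x => ?_
    simp only [hφd, abs_mul]
    refine mul_le_mul_of_nonneg_left ((abs_real_inner_le_norm _ _).trans ?_) (abs_nonneg _)
    exact mul_le_of_le_one_right (norm_nonneg _) (norm_outerUnitNormal_le x)
  have e5 : ∫ x, φ x ∂((surfaceMeasure Ω).restrict B) = ∫ x, φ x ∂(surfaceMeasure Ω) := by
    refine setIntegral_eq_integral_of_forall_compl_eq_zero fun x hx => ?_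
    simp only [hφd, image_eq_zero_of_notMem_tsupport fun h2 => hx (hs h2), zero_mul]
  rw [hint, ← e5]
  have hC : 0 ≤ (1 + 2 * ε) ^ (N - 1) - 1 := sub_nonneg.2 (one_le_pow₀ (by linarith))
  calc _ = |(∫ x, A x ∂ν' - ∫ x, φ x ∂ν') +
        (∫ x, φ x ∂ν' - ∫ x, φ x ∂((surfaceMeasure Ω).restrict B))| := by congr 1; ring
    _ ≤ _ := abs_add_le _ _
    _ ≤ 4 * ε * ∫ x, |φ x| ∂ν' + ((1 + 2 * ε) ^ (N - 1) - 1) *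
        ∫ x, |φ x| ∂((surfaceMeasure Ω).restrict B) := add_le_add e1 e2
    _ ≤ 4 * ε * (∫ x, |ζ x| * ‖Y x‖ ∂(surfaceMeasure Ω)) + ((1 + 2 * ε) ^ (N - 1) - 1) *
        ∫ x, |ζ x| * ‖Y x‖ ∂(surfaceMeasure Ω) := by
      gcongr
      exact e3.trans e4
    _ = _ := by ring

end IsBoundaryChart

end SurfaceMeasure

/-! ### A finite partition of unity on a compact set -/

section PartitionOfUnity

theorem exists_sum_eq_of_isCompact {E : Type} [NormedAddCommGroup E] [NormedSpace ℝ E]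
    [FiniteDimensional ℝ E] {T : Set E} (hT : IsCompact T) {U : E → Set E}
    (hU : ∀ x ∈ T, IsOpen (U x) ∧ x ∈ U x) :
    ∃ (t : Finset E) (χ : E → E → ℝ), (∀ i ∈ t, i ∈ T ∧ ContDiff ℝ ∞ (χ i) ∧
      tsupport (χ i) ⊆ U i ∧ ∀ x, 0 ≤ χ i x) ∧ ∀ x ∈ T, ∑ i ∈ t, χ i x = 1 := by
  obtain ⟨t, htT, hcov⟩ := hT.elim_nhds_subcover U fun x hx => (hU x hx).1.mem_nhds (hU x hx).2
  obtain ⟨f, hf⟩ := SmoothPartitionOfUnity.exists_isSubordinate (modelWithCornersSelf ℝ E)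
    hT.isClosed (fun i : t => U i) (fun i => (hU i (htT i i.2)).1) (by
      intro x hx
      obtain ⟨i, hi, hxi⟩ := Set.mem_iUnion₂.1 (hcov hx)
      exact Set.mem_iUnion.2 ⟨⟨i, hi⟩, hxi⟩)
  classical
  refine ⟨t, fun i => if h : i ∈ t then f ⟨i, h⟩ else 0, fun i hi => ?_, fun x hx => ?_⟩
  · simp only [dif_pos hi]
    exact ⟨htT i hi, contMDiff_iff_contDiff.1 (f ⟨i, hi⟩).contMDiff, hf ⟨i, hi⟩, f.nonneg _⟩
  · rw [← Finset.sum_coe_sort, ← f.sum_eq_one hx, finsum_eq_sum_of_fintype]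
    exact Finset.sum_congr rfl fun i _ => by simp only [dif_pos i.2]

end PartitionOfUnity

/-! ### The Gauss-Green formula -/

section GaussGreen

variable {N : ℕ} {Ω V O W : Set (EuclideanSpace ℝ (Fin N))} {z n : EuclideanSpace ℝ (Fin N)}
  {ρ : EuclideanSpace ℝ (Fin N) → ℝ} {ε r δ : ℝ} {ζ : EuclideanSpace ℝ (Fin N) → ℝ}
  {Y : EuclideanSpace ℝ (Fin N) → EuclideanSpace ℝ (Fin N)} {c : EuclideanSpace ℝ (Fin N) → ℝ}

/-- The defect in the Gauss-Green formula for the field `Y` with divergence `c`, tested with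
`ζ`. -/
def fluxDefect (Ω : Set (EuclideanSpace ℝ (Fin N)))
    (Y : EuclideanSpace ℝ (Fin N) → EuclideanSpace ℝ (Fin N))
    (c ζ : EuclideanSpace ℝ (Fin N) → ℝ) : ℝ :=
  (∫ x in Ω, (inner ℝ (Y x) (gradient ζ x) + c x * ζ x)) -
    ∫ x, ζ x * inner ℝ (Y x) (outerUnitNormal Ω x) ∂(surfaceMeasure Ω)

theorem fluxDefect_sum (hΩ : IsOpen Ω) (hs : HasSmoothBoundary Ω)
    (hY : IntegrableOn Y Ω) (hc : IntegrableOn c Ω)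
    (hWO : frontier Ω ∩ W ⊆ O) (hYc : ContinuousOn Y (closure Ω ∩ O))
    {ι : Type*} (t : Finset ι) {χ : ι → EuclideanSpace ℝ (Fin N) → ℝ}
    (hχ : ∀ i ∈ t, ContDiff ℝ ∞ (χ i) ∧ HasCompactSupport (χ i) ∧ tsupport (χ i) ⊆ W) :
    fluxDefect Ω Y c (fun x => ∑ i ∈ t, χ i x) = ∑ i ∈ t, fluxDefect Ω Y c (χ i) := by
  simp only [fluxDefect]
  rw [Finset.sum_sub_distrib, ← integral_finsetSum _ fun i hi =>
    integrable_inner_gradient_add_mul hY hc (hχ i hi).1 (hχ i hi).2.1,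
    ← integral_finsetSum _ fun i hi =>
      (integrable_mul_norm_surfaceMeasure hΩ hs hWO hYc (hχ i hi).1.continuous (hχ i hi).2.1
        (hχ i hi).2.2).1]
  congr 1
  · refine integral_congr_ae (Eventually.of_forall fun x => ?_)
    simp only
    rw [Finset.sum_add_distrib, Finset.mul_sum, real_inner_comm, inner_gradient_eq,
      fderiv_fun_sum fun i hi => ((hχ i hi).1.differentiable (by simp)) x,
      _root_.sum_apply]
    congr 1
    exact Finset.sum_congr rfl fun i _ => by rw [real_inner_comm, inner_gradient_eq]
  · simp only [Finset.sum_mul]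

theorem fluxDefect_eq_zero_of_subset_compl_frontier
    (h : tsupport ζ ⊆ (frontier Ω)ᶜ)
    (h0 : ∫ x in Ω, (inner ℝ (Y x) (gradient ζ x) + c x * ζ x) = 0) :
    fluxDefect Ω Y c ζ = 0 := by
  rw [fluxDefect, h0, zero_sub, neg_eq_zero]
  refine integral_eq_zero_of_ae ?_
  filter_upwards [ae_mem_frontier] with x hx
  rw [image_eq_zero_of_notMem_tsupport fun h2 => h h2 hx, zero_mul, Pi.zero_apply]

/-- Each point has a neighbourhood in which the Gauss-Green formula holds up to a small error. -/
theorem exists_open_abs_fluxDefect_le (hΩ : IsOpen Ω) (hsm : HasSmoothBoundary Ω)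
    (hY : IntegrableOn Y Ω) (hc : IntegrableOn c Ω) (hO : IsOpen O) (hW : IsOpen W)
    (hWO : frontier Ω ∩ W ⊆ O) (hYc : ContinuousOn Y (closure Ω ∩ O))
    (hw : ∀ ζ : EuclideanSpace ℝ (Fin N) → ℝ, ContDiff ℝ ∞ ζ → HasCompactSupport ζ →
      tsupport ζ ⊆ Ω ∩ W → ∫ x in Ω, (inner ℝ (Y x) (gradient ζ x) + c x * ζ x) = 0)
    (hε : 0 < ε) (hε' : ε ≤ 1 / 4) {x : EuclideanSpace ℝ (Fin N)} (hx : x ∈ W) :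
    ∃ B, IsOpen B ∧ x ∈ B ∧ ∀ ζ : EuclideanSpace ℝ (Fin N) → ℝ, ContDiff ℝ ∞ ζ →
      HasCompactSupport ζ → tsupport ζ ⊆ B → |fluxDefect Ω Y c ζ| ≤
        (4 * ε + ((1 + 2 * ε) ^ (N - 1) - 1)) * ∫ x, |ζ x| * ‖Y x‖ ∂(surfaceMeasure Ω) := by
  have hnn : ∀ ζ : EuclideanSpace ℝ (Fin N) → ℝ, 0 ≤ (4 * ε + ((1 + 2 * ε) ^ (N - 1) - 1)) *
      ∫ x, |ζ x| * ‖Y x‖ ∂(surfaceMeasure Ω) := by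
    intro ζ
    have hC : 0 ≤ (1 + 2 * ε) ^ (N - 1) - 1 := sub_nonneg.2 (one_le_pow₀ (by linarith))
    have : 0 ≤ ∫ x, |ζ x| * ‖Y x‖ ∂(surfaceMeasure Ω) :=
      integral_nonneg fun x => mul_nonneg (abs_nonneg _) (norm_nonneg _)
    positivity
  -- Inside Ω the weak equation makes the defect zero, and outside the closure both integrals
  -- vanish. Only boundary points need a chart.
  by_cases hxΩ : x ∈ Ω
  · refine ⟨Ω ∩ W, hΩ.inter hW, ⟨hxΩ, hx⟩, fun ζ h1 h2 h3 => ?_⟩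
    rw [fluxDefect_eq_zero_of_subset_compl_frontier (fun y hy h4 => ?_) (hw ζ h1 h2 h3),
      abs_zero]
    · exact hnn ζ
    · rw [hΩ.frontier_eq] at h4
      exact h4.2 (h3 hy).1
  by_cases hxc : x ∈ closure Ω
  swap
  · refine ⟨(closure Ω)ᶜ, isClosed_closure.isOpen_compl, hxc, fun ζ h1 h2 h3 => ?_⟩
    rw [fluxDefect_eq_zero_of_subset_compl_frontier
      (fun y hy h4 => h3 hy (frontier_subset_closure h4)) ?_, abs_zero]
    · exact hnn ζ
    · refine setIntegral_eq_zero_of_forall_eq_zero fun y hy => ?_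
      have : y ∉ tsupport ζ := fun h4 => h3 h4 (subset_closure hy)
      rw [gradient_eq_zero_of_notMem_tsupport this, image_eq_zero_of_notMem_tsupport this]
      simp
  · have hxf : x ∈ frontier Ω := by
      rw [hΩ.frontier_eq]
      exact ⟨hxc, hxΩ⟩
    obtain ⟨V, ρ, n, r, h⟩ := hsm.exists_isBoundaryChart
      ((hO.inter hW).mem_nhds ⟨hWO ⟨hxf, hx⟩, hx⟩) hxf hε
    refine ⟨_, isOpen_chartBox h.norm_normal, mem_chartBox_self h.norm_normal h.radius_pos,
      fun ζ h1 h2 h3 => ?_⟩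
    exact h.abs_integral_sub_flux_le hΩ hsm hε' hxf hY hc
      (hYc.mono (Set.inter_subset_inter_right _ Set.inter_subset_left))
      (fun ζ h1 h2 h3 => hw ζ h1 h2 fun y hy => ⟨(h3 hy).1, (h3 hy).2.2⟩) h1 h2 h3

/-- The **Gauss-Green formula** for a field that is continuous up to the part of the boundary in
`W` and has the weak divergence `c` in the part of `Ω` in `W`. -/
theorem integral_inner_gradient_add_mul_eq (hΩ : IsOpen Ω) (hsm : HasSmoothBoundary Ω)
    (hY : IntegrableOn Y Ω) (hc : IntegrableOn c Ω) (hO : IsOpen O) (hW : IsOpen W)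
    (hWO : frontier Ω ∩ W ⊆ O) (hYc : ContinuousOn Y (closure Ω ∩ O))
    (hw : ∀ ζ : EuclideanSpace ℝ (Fin N) → ℝ, ContDiff ℝ ∞ ζ → HasCompactSupport ζ →
      tsupport ζ ⊆ Ω ∩ W → ∫ x in Ω, (inner ℝ (Y x) (gradient ζ x) + c x * ζ x) = 0)
    (hζ : ContDiff ℝ ∞ ζ) (hζc : HasCompactSupport ζ) (hζW : tsupport ζ ⊆ W) :
    ∫ x in Ω, (inner ℝ (Y x) (gradient ζ x) + c x * ζ x) =
      ∫ x, ζ x * inner ℝ (Y x) (outerUnitNormal Ω x) ∂(surfaceMeasure Ω) := by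
  set I := ∫ x, |ζ x| * ‖Y x‖ ∂(surfaceMeasure Ω) with hI
  -- The local errors add up without loss: the χ_i are nonnegative and sum to 1, so the integrals of
  -- |χ_i ζ| ‖Y‖ sum to I, whatever the number of pieces. Letting ε → 0 removes the defect.
  have key : ∀ ε : ℝ, 0 < ε → ε ≤ 1 / 4 →
      |fluxDefect Ω Y c ζ| ≤ (4 * ε + ((1 + 2 * ε) ^ (N - 1) - 1)) * I := by
    intro ε hε hε'
    have hex := fun x (hx : x ∈ W) =>
      exists_open_abs_fluxDefect_le hΩ hsm hY hc hO hW hWO hYc hw hε hε' hx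
    choose! B hB using hex
    obtain ⟨t, χ, hχ, hsum⟩ := exists_sum_eq_of_isCompact hζc
      (fun x hx => ⟨(hB x (hζW hx)).1, (hB x (hζW hx)).2.1⟩)
    have hd : ∀ i ∈ t, ContDiff ℝ ∞ (fun x => χ i x * ζ x) ∧
        HasCompactSupport (fun x => χ i x * ζ x) ∧ tsupport (fun x => χ i x * ζ x) ⊆ W :=
      fun i hi => ⟨(hχ i hi).2.1.mul hζ, hζc.mul_left,
        (tsupport_mul_subset_right (f := χ i) (g := ζ)).trans hζW⟩
    have heq : ζ = fun x => ∑ i ∈ t, χ i x * ζ x := by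
      funext x
      rw [← Finset.sum_mul]
      by_cases hx : x ∈ tsupport ζ
      · rw [hsum x hx, one_mul]
      · rw [image_eq_zero_of_notMem_tsupport hx, mul_zero]
    have hint := fun i hi => (integrable_mul_norm_surfaceMeasure hΩ hsm hWO hYc
      (hd i hi).1.continuous (hd i hi).2.1 (hd i hi).2.2).2
    calc |fluxDefect Ω Y c ζ| = |fluxDefect Ω Y c (fun x => ∑ i ∈ t, χ i x * ζ x)| := by
          rw [← heq]
      _ = |∑ i ∈ t, fluxDefect Ω Y c (fun x => χ i x * ζ x)| := by
          rw [fluxDefect_sum hΩ hsm hY hc hWO hYc t hd]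
      _ ≤ ∑ i ∈ t, |fluxDefect Ω Y c (fun x => χ i x * ζ x)| := Finset.abs_sum_le_sum_abs _ _
      _ ≤ ∑ i ∈ t, (4 * ε + ((1 + 2 * ε) ^ (N - 1) - 1)) *
          ∫ x, |χ i x * ζ x| * ‖Y x‖ ∂(surfaceMeasure Ω) := by
          refine Finset.sum_le_sum fun i hi => ?_
          exact (hB i (hζW (hχ i hi).1)).2.2 _ (hd i hi).1 (hd i hi).2.1
            ((tsupport_mul_subset_left (f := χ i) (g := ζ)).trans (hχ i hi).2.2.1)
      _ = (4 * ε + ((1 + 2 * ε) ^ (N - 1) - 1)) * I := by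
          rw [← Finset.mul_sum, ← integral_finsetSum _ hint, hI]
          congr 1
          refine integral_congr_ae (Eventually.of_forall fun x => ?_)
          simp only
          rw [← Finset.sum_mul]
          congr 1
          by_cases hx : x ∈ tsupport ζ
          · calc ∑ i ∈ t, |χ i x * ζ x| = ∑ i ∈ t, χ i x * |ζ x| :=
                  Finset.sum_congr rfl fun i hi => by
                    rw [abs_mul, abs_of_nonneg ((hχ i hi).2.2.2 x)]
              _ = |ζ x| := by rw [← Finset.sum_mul, hsum x hx, one_mul]
          · simp [image_eq_zero_of_notMem_tsupport hx]
  have hlim : Tendsto (fun ε : ℝ => (4 * ε + ((1 + 2 * ε) ^ (N - 1) - 1)) * I) (𝓝[>] 0)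
      (𝓝 0) := by
    have : Continuous fun ε : ℝ => (4 * ε + ((1 + 2 * ε) ^ (N - 1) - 1)) * I := by fun_prop
    simpa using (this.tendsto 0).mono_left nhdsWithin_le_nhds
  have h0 : |fluxDefect Ω Y c ζ| ≤ 0 := by
    refine ge_of_tendsto hlim ?_
    have h1 : ∀ᶠ ε in 𝓝[>] (0 : ℝ), 0 < ε := self_mem_nhdsWithin
    have h2 : ∀ᶠ ε in 𝓝[>] (0 : ℝ), ε < 1 / 4 :=
      nhdsWithin_le_nhds (Iio_mem_nhds (by norm_num))
    filter_upwards [h1, h2] with ε h3 h4 using key ε h3 h4.le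
  exact sub_eq_zero.1 (abs_nonpos_iff.1 h0)

end GaussGreen

/-! ### Regularity and bounds of K -/

section C1OnClosure

variable {N : ℕ} {Ω : Set (EuclideanSpace ℝ (Fin N))} {K : EuclideanSpace ℝ (Fin N) → ℝ}

theorem IsC1OnClosure.continuousOn (hK : IsC1OnClosure Ω K) : ContinuousOn K (closure Ω) := by
  obtain ⟨F, hF⟩ := hK
  simpa using hF.continuousOn

theorem IsC1OnClosure.contDiffOn (hΩ : IsOpen Ω) (hK : IsC1OnClosure Ω K) : ContDiffOn ℝ 1 K Ω := by
  obtain ⟨F, hF⟩ := hK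
  have hg : ∀ x ∈ Ω, HasGradientAt K (F x) x := fun x hx => hF.hasGradientAt x ⟨hx, trivial⟩
  rw [show (1 : WithTop ℕ∞) = 0 + 1 from rfl, contDiffOn_succ_iff_fderiv_of_isOpen hΩ]
  refine ⟨fun x hx => (hg x hx).differentiableAt.differentiableWithinAt, by simp,
    contDiffOn_zero.2 ?_⟩
  have h1 : ContinuousOn F Ω :=
    hF.continuousOn_gradient.mono fun x hx => ⟨subset_closure hx, trivial⟩
  refine ((InnerProductSpace.toDual ℝ (EuclideanSpace ℝ (Fin N))).continuous.comp_continuousOn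
    h1).congr fun x hx => ?_
  exact (hasGradientAt_iff_hasFDerivAt.1 (hg x hx)).fderiv

theorem IsC1OnClosure.exists_bound (hΩb : Bornology.IsBounded Ω) (hK : IsC1OnClosure Ω K) :
    ∃ M, ∀ x ∈ Ω, |K x| ≤ M ∧ ‖gradient K x‖ ≤ M := by
  have hc := hK.continuousOn
  obtain ⟨F, hF⟩ := hK
  obtain ⟨M₁, h1⟩ := hΩb.isCompact_closure.exists_bound_of_continuousOn hc
  obtain ⟨M₂, h2⟩ := hΩb.isCompact_closure.exists_bound_of_continuousOn (f := F)
    (by simpa using hF.continuousOn_gradient)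
  refine ⟨max M₁ M₂, fun x hx => ⟨(h1 x (subset_closure hx)).trans (le_max_left _ _), ?_⟩⟩
  rw [(hF.hasGradientAt x ⟨hx, trivial⟩).gradient]
  exact (h2 x (subset_closure hx)).trans (le_max_right _ _)

end C1OnClosure

/-! ### Integrability of the field and of its divergence -/

section FieldIntegrability

variable {N : ℕ} {Ω U : Set (EuclideanSpace ℝ (Fin N))} {a b p : ℝ}
  {K u ζ : EuclideanSpace ℝ (Fin N) → ℝ}
  {g : EuclideanSpace ℝ (Fin N) → EuclideanSpace ℝ (Fin N)}
  {φ : ℕ → EuclideanSpace ℝ (Fin N) → ℝ}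

/-- A factor |x| comes out of every term. In the last one, |x|^{-2a} u g is |x| times the product of
the Hardy density |x|^{-a-1} u and |x|^{-a} g. This factor later compensates the gradient of the
cutoff at the origin. -/
theorem norm_pohozaevField_le {x : EuclideanSpace ℝ (Fin N)} (hx : x ≠ 0) :
    ‖pohozaevField a b p K u g x‖ ≤ ‖x‖ * (3 / 2 * (‖x‖ ^ (-2 * a) * ‖g x‖ ^ 2) +
      |1 / p * (K x * (u x ^ p / ‖x‖ ^ (b * p)))| +
      |((N : ℝ) - 2 - 2 * a) / 2| * (‖‖x‖ ^ (-a - 1) * u x‖ * ‖‖x‖ ^ (-a) • g x‖)) := by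
  have hx' := norm_pos_iff.2 hx
  have hw : 0 ≤ ‖x‖ ^ (-2 * a) := by positivity
  have e1 : ‖(‖x‖ ^ (-2 * a) * inner ℝ x (g x)) • g x‖ ≤ ‖x‖ * (‖x‖ ^ (-2 * a) * ‖g x‖ ^ 2) := by
    rw [norm_smul, norm_mul, Real.norm_of_nonneg hw]
    calc _ ≤ ‖x‖ ^ (-2 * a) * (‖x‖ * ‖g x‖) * ‖g x‖ := by
          gcongr
          exact norm_inner_le_norm x (g x)
      _ = _ := by ring
  have e2 : ‖(1 / 2 * (‖x‖ ^ (-2 * a) * ‖g x‖ ^ 2)) • x‖ =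
      ‖x‖ * (1 / 2 * (‖x‖ ^ (-2 * a) * ‖g x‖ ^ 2)) := by
    rw [norm_smul, Real.norm_of_nonneg (by positivity), mul_comm]
  have e3 : ‖(1 / p * (K x * (u x ^ p / ‖x‖ ^ (b * p)))) • x‖ =
      ‖x‖ * |1 / p * (K x * (u x ^ p / ‖x‖ ^ (b * p)))| := by
    rw [norm_smul, Real.norm_eq_abs, mul_comm]
  have e4 : ‖(((N : ℝ) - 2 - 2 * a) / 2 * (‖x‖ ^ (-2 * a) * u x)) • g x‖ =
      ‖x‖ * (|((N : ℝ) - 2 - 2 * a) / 2| *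
        (‖‖x‖ ^ (-a - 1) * u x‖ * ‖‖x‖ ^ (-a) • g x‖)) := by
    have h1 : ‖x‖ ^ (-2 * a) = ‖x‖ * (‖x‖ ^ (-a - 1) * ‖x‖ ^ (-a)) := by
      rw [Real.rpow_sub_one hx'.ne', norm_rpow_neg_mul_self]
      field_simp
    rw [norm_smul, norm_mul, norm_mul, norm_mul, norm_smul, Real.norm_of_nonneg hw,
      Real.norm_of_nonneg (by positivity : 0 ≤ ‖x‖ ^ (-a - 1)),
      Real.norm_of_nonneg (by positivity : 0 ≤ ‖x‖ ^ (-a)), h1, Real.norm_eq_abs, Real.norm_eq_abs]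
    ring
  rw [pohozaevField]
  refine (norm_add_le _ _).trans ?_
  rw [e4]
  have t1 := norm_add_le ((‖x‖ ^ (-2 * a) * inner ℝ x (g x)) • g x -
    (1 / 2 * (‖x‖ ^ (-2 * a) * ‖g x‖ ^ 2)) • x) ((1 / p * (K x * (u x ^ p / ‖x‖ ^ (b * p)))) • x)
  have t2 := norm_sub_le ((‖x‖ ^ (-2 * a) * inner ℝ x (g x)) • g x)
    ((1 / 2 * (‖x‖ ^ (-2 * a) * ‖g x‖ ^ 2)) • x)
  rw [e3] at t1
  rw [e2] at t2
  linarith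

/-- A function integrable on `Ω` that dominates `pohozaevField` divided by the distance
to the origin. -/
theorem exists_integrableOn_norm_pohozaevField_le (hP : CKNParams N a b p)
    (hu : MemD12On Set.univ a u g φ) (hpos : ∀ᵐ x ∂volume.restrict Ω, 0 < u x) (hΩ : IsOpen Ω)
    (hK : ContDiffOn ℝ 1 K Ω) {M : ℝ} (hM : ∀ x ∈ Ω, |K x| ≤ M) :
    ∃ Q : EuclideanSpace ℝ (Fin N) → ℝ, IntegrableOn Q Ω ∧
      ∀ᵐ x ∂volume.restrict Ω, ‖pohozaevField a b p K u g x‖ ≤ ‖x‖ * Q x := by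
  have hN := hP.pos
  have hp : 0 < p := by linarith [hP.two_lt]
  have hg := hu.memLp_gradient hN hP.two_mul_lt
  have hh := (hu.hardy hN hP.lt).2
  have hKm : AEStronglyMeasurable K (volume.restrict Ω) :=
    hK.continuousOn.aestronglyMeasurable hΩ.measurableSet
  have h1 := (integrable_weighted_sq hg).integrableOn (s := Ω)
  have h2 := integrableOn_potential hN hp (hu.ckn hP).2 hpos hΩ.measurableSet hKm hM
  have h3 : Integrable (fun x => ‖‖x‖ ^ (-a - 1) * u x‖ * ‖‖x‖ ^ (-a) • g x‖) volume :=
    hh.norm.integrable_mul hg.norm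
  refine ⟨_, ((h1.const_mul (3 / 2)).add (h2.const_mul (1 / p)).abs).add
    (h3.integrableOn.const_mul |((N : ℝ) - 2 - 2 * a) / 2|), ?_⟩
  filter_upwards [ae_ne_zero hN _ Measure.absolutelyContinuous_restrict] with x hx
  exact norm_pohozaevField_le hx

theorem aestronglyMeasurable_pohozaevField (hu : AEStronglyMeasurable u volume)
    (hg : AEStronglyMeasurable g volume) (hΩ : IsOpen Ω) (hK : ContinuousOn K Ω) :
    AEStronglyMeasurable (pohozaevField a b p K u g) (volume.restrict Ω) := by
  have hKm : AEStronglyMeasurable K (volume.restrict Ω) :=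
    hK.aestronglyMeasurable hΩ.measurableSet
  have hu' := hu.restrict (s := Ω)
  have hg' := hg.restrict (s := Ω)
  have hid : AEStronglyMeasurable (fun x : EuclideanSpace ℝ (Fin N) => x) (volume.restrict Ω) :=
    continuous_id.aestronglyMeasurable
  have hw : AEStronglyMeasurable (fun x : EuclideanSpace ℝ (Fin N) => ‖x‖ ^ (-2 * a))
      (volume.restrict Ω) := (measurable_norm_rpow _).aestronglyMeasurable
  have hwp : AEStronglyMeasurable (fun x => u x ^ p / ‖x‖ ^ (b * p)) (volume.restrict Ω) :=
    ((hu'.aemeasurable.pow_const p).div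
      (measurable_norm_rpow (b * p)).aemeasurable).aestronglyMeasurable
  exact ((((hw.mul (hid.inner hg')).smul hg').sub
    (((hw.mul (hg'.norm.pow 2)).const_mul (1 / 2)).smul hid)).add
    (((hKm.mul hwp).const_mul (1 / p)).smul hid)).add
    (((hw.mul hu').const_mul (((N : ℝ) - 2 - 2 * a) / 2)).smul hg')

theorem integrableOn_pohozaevField (hP : CKNParams N a b p)
    (hu : MemD12On Set.univ a u g φ) (hpos : ∀ᵐ x ∂volume.restrict Ω, 0 < u x) (hΩ : IsOpen Ω)
    (hΩb : Bornology.IsBounded Ω)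
    (hK : ContDiffOn ℝ 1 K Ω) {M : ℝ} (hM : ∀ x ∈ Ω, |K x| ≤ M) :
    IntegrableOn (pohozaevField a b p K u g) Ω := by
  obtain ⟨Q, hQ, hle⟩ := exists_integrableOn_norm_pohozaevField_le hP hu hpos hΩ hK hM
  obtain ⟨R, hR⟩ := hΩb.exists_norm_le
  refine (hQ.abs.const_mul R).mono' (aestronglyMeasurable_pohozaevField hu.aestronglyMeasurable
    hu.measurable_gradient hΩ hK.continuousOn) ?_
  filter_upwards [hle, ae_restrict_mem hΩ.measurableSet] with x h1 h2
  exact h1.trans ((mul_le_mul_of_nonneg_left (le_abs_self _) (norm_nonneg x)).trans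
    (mul_le_mul_of_nonneg_right (hR x h2) (abs_nonneg _)))

theorem integrableOn_inner_gradient_mul_potential (hP : CKNParams N a b p)
    (hu : MemD12On Set.univ a u g φ) (hpos : ∀ᵐ x ∂volume.restrict Ω, 0 < u x) (hΩ : IsOpen Ω)
    (hΩb : Bornology.IsBounded Ω)
    (hK : ContDiffOn ℝ 1 K Ω) {M : ℝ} (hM : ∀ x ∈ Ω, ‖gradient K x‖ ≤ M) :
    IntegrableOn (fun x => inner ℝ (gradient K x) x * (u x ^ p / ‖x‖ ^ (b * p))) Ω := by
  obtain ⟨R, hR⟩ := hΩb.exists_norm_le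
  have hp : 0 < p := by linarith [hP.two_lt]
  have hgc : ContinuousOn (gradient K) Ω := (LinearIsometryEquiv.continuous _).comp_continuousOn
    (hK.continuousOn_fderiv_of_isOpen hΩ le_rfl)
  refine integrableOn_potential hP.pos hp (hu.ckn hP).2 hpos hΩ.measurableSet
    ((hgc.inner continuousOn_id).aestronglyMeasurable hΩ.measurableSet) (M := M * R) fun x hx => ?_
  exact (abs_real_inner_le_norm _ _).trans (mul_le_mul (hM x hx) (hR x hx) (norm_nonneg _)
    ((norm_nonneg _).trans (hM x hx)))

end FieldIntegrability

/-! ### Continuity and integrability on the boundary -/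

section BoundaryContinuity

variable {N : ℕ} {Ω T : Set (EuclideanSpace ℝ (Fin N))} {a b p : ℝ}
  {K u ζ : EuclideanSpace ℝ (Fin N) → ℝ}
  {g : EuclideanSpace ℝ (Fin N) → EuclideanSpace ℝ (Fin N)}

theorem continuousOn_norm_rpow (h0 : (0 : EuclideanSpace ℝ (Fin N)) ∉ T) (s : ℝ) :
    ContinuousOn (fun x : EuclideanSpace ℝ (Fin N) => ‖x‖ ^ s) T :=
  fun _ hx => (contDiffAt_norm_rpow (n := 0) s fun h => h0 (h ▸ hx)).continuousAt.continuousWithinAt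

theorem continuousOn_potential (h0 : (0 : EuclideanSpace ℝ (Fin N)) ∉ T) (hp : 0 ≤ p)
    (hK : ContinuousOn K T) (hu : ContinuousOn u T) :
    ContinuousOn (fun x => K x * (u x ^ p / ‖x‖ ^ (b * p))) T :=
  hK.mul ((hu.rpow_const fun _ _ => Or.inr hp).div (continuousOn_norm_rpow h0 _) fun _ hx =>
    (Real.rpow_pos_of_pos (norm_pos_iff.2 fun h => h0 (h ▸ hx)) _).ne')

theorem continuousOn_pohozaevField (h0 : (0 : EuclideanSpace ℝ (Fin N)) ∉ T) (hp : 0 ≤ p)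
    (hK : ContinuousOn K T) (hu : ContinuousOn u T) (hg : ContinuousOn g T) :
    ContinuousOn (pohozaevField a b p K u g) T := by
  have hw := continuousOn_norm_rpow h0 (-2 * a)
  have hpot := continuousOn_potential (b := b) h0 hp hK hu
  have hid : ContinuousOn (fun x : EuclideanSpace ℝ (Fin N) => x) T := continuousOn_id
  exact ((((hw.mul (hid.inner hg)).smul hg).sub
    ((continuousOn_const.mul (hw.mul (hg.norm.pow 2))).smul hid)).add
    ((continuousOn_const.mul hpot).smul hid)).add
    ((continuousOn_const.mul (hw.mul hu)).smul hg)

theorem boundaryTermsIntegrable_of_zero_notMem (hΩ : IsOpen Ω) (hs : HasSmoothBoundary Ω)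
    (hΩb : Bornology.IsBounded Ω) (h0 : (0 : EuclideanSpace ℝ (Fin N)) ∉ frontier Ω) (hp : 0 ≤ p)
    (hK : ContinuousOn K (frontier Ω)) (hu : ContinuousOn u (frontier Ω))
    (hg : ContinuousOn g (frontier Ω)) : BoundaryTermsIntegrable Ω a b p K u g := by
  have hS : IsCompact (frontier Ω) :=
    hΩb.isCompact_closure.of_isClosed_subset isClosed_frontier frontier_subset_closure
  have hi : ∀ q : EuclideanSpace ℝ (Fin N) → ℝ, ContinuousOn q (frontier Ω) →
      Integrable q (surfaceMeasure Ω) := fun q hq =>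
    integrable_surfaceMeasure_of_continuousOn hΩ hs hS (hq.mono Set.inter_subset_left)
      fun x hx hx' => absurd hx hx'
  have hw := continuousOn_norm_rpow h0 (-2 * a)
  have hν := continuousOn_outerUnitNormal hΩ hs
  have hpot := continuousOn_potential (b := b) h0 hp hK hu
  have hid : ContinuousOn (fun x : EuclideanSpace ℝ (Fin N) => x) (frontier Ω) := continuousOn_id
  exact ⟨hi _ (hpot.mul (hid.inner hν)), hi _ ((hw.mul hu).mul (hg.inner hν)),
    hi _ ((hw.mul (hg.norm.pow 2)).mul (hid.inner hν)),
    hi _ ((hw.mul (hid.inner hg)).mul (hg.inner hν))⟩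

theorem surfaceMeasure_singleton (hN : 2 ≤ N) (x : EuclideanSpace ℝ (Fin N)) :
    surfaceMeasure Ω {x} = 0 := by
  have hd : 0 < N - 1 := by omega
  have := Measure.nullSingletonClass_hausdorff (EuclideanSpace ℝ (Fin N)) (d := ((N - 1 : ℕ) : ℝ))
    (by exact_mod_cast hd)
  refine le_antisymm ((Measure.restrict_apply_le _ _).trans ?_) zero_le
  rw [Measure.euclideanHausdorffMeasure_def, Measure.smul_apply, measure_singleton, smul_zero]

end BoundaryContinuity

/-! ### Removal of the origin and the flux identity -/

section FluxThroughBoundary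

variable {N : ℕ} {Ω : Set (EuclideanSpace ℝ (Fin N))} {a b p : ℝ}
  {K u : EuclideanSpace ℝ (Fin N) → ℝ}
  {g : EuclideanSpace ℝ (Fin N) → EuclideanSpace ℝ (Fin N)}
  {φ : ℕ → EuclideanSpace ℝ (Fin N) → ℝ}

theorem gradient_originCutoff_eventually_eq_zero {x : EuclideanSpace ℝ (Fin N)} (hx : x ≠ 0)
    {ε : ℕ → ℝ} (hε : ∀ n, 0 < ε n) (h0 : Tendsto ε atTop (𝓝 0)) :
    ∀ᶠ n in atTop, gradient (originCutoff (ε n)) x = 0 := by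
  have hx' : 0 < ‖x‖ / 2 := by
    have := norm_pos_iff.2 hx
    positivity
  filter_upwards [h0.eventually (gt_mem_nhds hx')] with n hn
  have h1 : originCutoff (ε n) =ᶠ[𝓝 x] fun _ => 1 := by
    filter_upwards [(isOpen_lt continuous_const continuous_norm).mem_nhds
      (show 2 * ε n < ‖x‖ by linarith)] with y hy
    exact originCutoff_eq_one (hε n) (le_of_lt hy)
  rw [gradient, h1.fderiv_eq]
  simp

/-- The divergence theorem for `pohozaevField` in the whole domain. -/
theorem IsPositiveWeakSolution.integral_pohozaevSource_eq (hP : CKNParams N a b p)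
    (hu : MemD12On Set.univ a u g φ) (hsol : IsPositiveWeakSolution Ω a b p K u g)
    (hΩ : IsOpen Ω) (hΩb : Bornology.IsBounded Ω) (hs : HasSmoothBoundary Ω)
    (hK : IsC1OnClosure Ω K) (hbd : IsC1NearBoundary Ω u g)
    (hint : Integrable (fun x => inner ℝ (pohozaevField a b p K u g x) (outerUnitNormal Ω x))
      (surfaceMeasure Ω)) :
    ∫ x in Ω, pohozaevSource b p K u x =
      ∫ x, inner ℝ (pohozaevField a b p K u g x) (outerUnitNormal Ω x) ∂(surfaceMeasure Ω) := by
  have hN := hP.pos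
  have hp : 0 < p := by linarith [hP.two_lt]
  obtain ⟨M, hM⟩ := hK.exists_bound hΩb
  have hKd := hK.contDiffOn hΩ
  have hM1 := fun x hx => (hM x hx).1
  obtain ⟨U, hU, hUf, hUc⟩ := hbd
  have hY := integrableOn_pohozaevField hP hu hsol.pos hΩ hΩb hKd hM1
  obtain ⟨Q, hQ, hYQ⟩ := exists_integrableOn_norm_pohozaevField_le hP hu hsol.pos hΩ hKd hM1
  have hc : IntegrableOn (pohozaevSource b p K u) Ω :=
    (integrableOn_inner_gradient_mul_potential hP hu hsol.pos hΩ hΩb hKd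
      fun x hx => (hM x hx).2).const_mul (1 / p)
  set Y := pohozaevField a b p K u g with hYd
  set c := pohozaevSource b p K u with hcd
  have hYc : ContinuousOn Y (closure Ω ∩ (U ∩ {0}ᶜ)) := by
    have hsub : closure Ω ∩ (U ∩ {0}ᶜ) ⊆ closure Ω ∩ U := fun x hx => ⟨hx.1, hx.2.1⟩
    exact continuousOn_pohozaevField (fun h => h.2.2 rfl) hp.le
      (hK.continuousOn.mono Set.inter_subset_left) (hUc.continuousOn.mono hsub)
      (hUc.continuousOn_gradient.mono hsub)
  -- χ only provides compact support: it is 1 near the closure of Ω and disappears from all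
  -- integrals.
  obtain ⟨χ, hχ, hχc, -, hχ1, hχI⟩ := exists_contDiff_eventuallyEq_one hΩb.isCompact_closure
    isOpen_univ (Set.subset_univ (closure Ω))
  set ε : ℕ → ℝ := fun k => 1 / ((k : ℝ) + 1) with hεd
  have hε : ∀ k, 0 < ε k := fun k => by positivity
  have hε0 : Tendsto ε atTop (𝓝 0) := tendsto_one_div_add_atTop_nhds_zero_nat
  have hcut : ∀ k, ContDiff ℝ ∞ (originCutoff (ε k) : EuclideanSpace ℝ (Fin N) → ℝ) := fun k =>
    contDiff_originCutoff (ε k)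
  have gauss : ∀ k, ∫ x in Ω, (inner ℝ (Y x) (gradient (originCutoff (ε k)) x) +
      c x * originCutoff (ε k) x) =
      ∫ x, originCutoff (ε k) x * inner ℝ (Y x) (outerUnitNormal Ω x) ∂(surfaceMeasure Ω) := by
    intro k
    -- Gauss-Green is used in the punctured space, where the weak divergence of Y is known and Y is
    -- continuous up to the boundary.
    have h1 := integral_inner_gradient_add_mul_eq (W := {0}ᶜ)
      (ζ := fun x => χ x * originCutoff (ε k) x) hΩ hs hY hc
      (hU.inter isOpen_compl_singleton) isOpen_compl_singleton
      (fun x hx => ⟨hUf ⟨hx.1, hx.2⟩, hx.2⟩) hYc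
      (fun ζ h2 h3 h4 => hsol.integral_inner_pohozaevField hP hu hΩ hKd hM1 h2 h3
        (fun h5 => (h4 h5).2 rfl) fun x hx => (h4 hx).1)
      (hχ.mul (hcut k)) hχc.mul_right
      (fun x hx h2 => zero_notMem_tsupport_originCutoff (hε k)
        (h2 ▸ tsupport_mul_subset_right (f := χ) (g := originCutoff (ε k)) hx))
    have e1 : ∫ x in Ω, (inner ℝ (Y x) (gradient (fun x => χ x * originCutoff (ε k) x) x) +
        c x * (χ x * originCutoff (ε k) x)) = ∫ x in Ω,
        (inner ℝ (Y x) (gradient (originCutoff (ε k)) x) + c x * originCutoff (ε k) x) := by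
      refine setIntegral_congr_fun hΩ.measurableSet fun x hx => ?_
      have h2 := hχ1 x (subset_closure hx)
      have h3 : (fun x => χ x * originCutoff (ε k) x) =ᶠ[𝓝 x] originCutoff (ε k) := by
        filter_upwards [h2] with y hy
        rw [hy, one_mul]
      rw [gradient, gradient, h3.fderiv_eq, h2.eq_of_nhds, one_mul]
    have e2 : ∫ x, χ x * originCutoff (ε k) x * inner ℝ (Y x) (outerUnitNormal Ω x)
        ∂(surfaceMeasure Ω) = ∫ x, originCutoff (ε k) x * inner ℝ (Y x) (outerUnitNormal Ω x)
        ∂(surfaceMeasure Ω) := by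
      refine integral_congr_ae ?_
      filter_upwards [ae_mem_frontier] with x hx
      rw [(hχ1 x (frontier_subset_closure hx)).eq_of_nhds, one_mul]
    rw [← e1, ← e2]
    exact h1
  have lim1 : Tendsto (fun k => ∫ x in Ω, (inner ℝ (Y x) (gradient (originCutoff (ε k)) x) +
      c x * originCutoff (ε k) x)) atTop (𝓝 (∫ x in Ω, c x)) := by
    obtain ⟨C, hC0, hC⟩ := exists_norm_fderiv_originCutoff_le (EuclideanSpace ℝ (Fin N))
    -- |⟨Y, ∇cutoff⟩| ≤ |x| |Q| |∇cutoff| ≤ C |Q| uniformly in k, while at each x ≠ 0 the gradient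
    -- of the cutoff is eventually zero.
    refine tendsto_integral_of_dominated_convergence (fun x => C * |Q x| + |c x|) (fun k => ?_)
      ((hQ.abs.const_mul C).add hc.abs) (fun k => ?_) ?_
    · have hgc := continuous_gradient ((hcut k).of_le (by exact_mod_cast le_top) :
        ContDiff ℝ 1 (originCutoff (ε k) : EuclideanSpace ℝ (Fin N) → ℝ))
      exact (hY.aestronglyMeasurable.inner hgc.aestronglyMeasurable).add
        (hc.aestronglyMeasurable.mul (hcut k).continuous.aestronglyMeasurable)
    · filter_upwards [hYQ] with x hx
      refine (norm_add_le _ _).trans (add_le_add ?_ ?_)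
      · have h1 := hC (ε k) (hε k) x
        rw [← norm_gradient_eq] at h1
        calc _ ≤ ‖Y x‖ * ‖gradient (originCutoff (ε k)) x‖ := norm_inner_le_norm _ _
          _ ≤ (‖x‖ * |Q x|) * ‖gradient (originCutoff (ε k)) x‖ := by
            gcongr
            exact hx.trans (mul_le_mul_of_nonneg_left (le_abs_self _) (norm_nonneg x))
          _ = (‖gradient (originCutoff (ε k)) x‖ * ‖x‖) * |Q x| := by ring
          _ ≤ C * |Q x| := by gcongr
      · rw [norm_mul, Real.norm_eq_abs]
        refine mul_le_of_le_one_right (abs_nonneg _) ?_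
        rw [Real.norm_of_nonneg (originCutoff_nonneg _ _)]
        exact originCutoff_le_one _ _
    · filter_upwards [ae_ne_zero hN _ Measure.absolutelyContinuous_restrict] with x hx
      refine tendsto_nhds_of_eventually_eq ?_
      filter_upwards [gradient_originCutoff_eventually_eq_zero hx hε hε0,
        tendsto_originCutoff hx hε hε0] with k h1 h2
      rw [h1, h2, inner_zero_right, zero_add, mul_one]
  have lim2 : Tendsto (fun k => ∫ x, originCutoff (ε k) x * inner ℝ (Y x) (outerUnitNormal Ω x)
      ∂(surfaceMeasure Ω)) atTop
      (𝓝 (∫ x, inner ℝ (Y x) (outerUnitNormal Ω x) ∂(surfaceMeasure Ω))) := by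
    refine tendsto_integral_of_dominated_convergence
      (fun x => ‖inner ℝ (Y x) (outerUnitNormal Ω x)‖) (fun k => ?_) hint.norm (fun k => ?_) ?_
    · exact (hcut k).continuous.aestronglyMeasurable.mul hint.aestronglyMeasurable
    · refine Eventually.of_forall fun x => ?_
      rw [norm_mul, Real.norm_of_nonneg (originCutoff_nonneg _ _)]
      exact mul_le_of_le_one_left (norm_nonneg _) (originCutoff_le_one _ _)
    -- Points carry no surface measure because N - 1 > 0, so an origin on the boundary contributes
    -- nothing.
    · have h0 : ∀ᵐ x ∂(surfaceMeasure Ω), x ≠ (0 : EuclideanSpace ℝ (Fin N)) :=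
        compl_mem_ae_iff.2 (surfaceMeasure_singleton (by have := hP.three_le; omega) 0)
      filter_upwards [h0] with x hx
      refine tendsto_nhds_of_eventually_eq ?_
      filter_upwards [tendsto_originCutoff hx hε hε0] with k h2
      rw [h2, one_mul]
  simp only [gauss] at lim1
  exact tendsto_nhds_unique lim1 lim2

theorem inner_pohozaevField (x v : EuclideanSpace ℝ (Fin N)) :
    inner ℝ (pohozaevField a b p K u g x) v =
      ‖x‖ ^ (-2 * a) * inner ℝ x (g x) * inner ℝ (g x) v -
        1 / 2 * (‖x‖ ^ (-2 * a) * ‖g x‖ ^ 2 * inner ℝ x v) +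
        (1 / p * (K x * (u x ^ p / ‖x‖ ^ (b * p)) * inner ℝ x v) +
        ((N : ℝ) - 2 - 2 * a) / 2 * (‖x‖ ^ (-2 * a) * u x * inner ℝ (g x) v)) := by
  rw [pohozaevField]
  simp only [inner_add_left, inner_sub_left, real_inner_smul_left]
  ring

theorem BoundaryTermsIntegrable.integral_inner_pohozaevField
    (h : BoundaryTermsIntegrable Ω a b p K u g) :
    Integrable (fun x => inner ℝ (pohozaevField a b p K u g x) (outerUnitNormal Ω x))
      (surfaceMeasure Ω) ∧
    ∫ x, inner ℝ (pohozaevField a b p K u g x) (outerUnitNormal Ω x) ∂(surfaceMeasure Ω) =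
      (∫ x, ‖x‖ ^ (-2 * a) * inner ℝ x (g x) * inner ℝ (g x) (outerUnitNormal Ω x)
        ∂(surfaceMeasure Ω)) -
      1 / 2 * (∫ x, ‖x‖ ^ (-2 * a) * ‖g x‖ ^ 2 * inner ℝ x (outerUnitNormal Ω x)
        ∂(surfaceMeasure Ω)) +
      (1 / p * (∫ x, K x * (u x ^ p / ‖x‖ ^ (b * p)) * inner ℝ x (outerUnitNormal Ω x)
        ∂(surfaceMeasure Ω)) +
      ((N : ℝ) - 2 - 2 * a) / 2 * ∫ x, ‖x‖ ^ (-2 * a) * u x * inner ℝ (g x) (outerUnitNormal Ω x)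
        ∂(surfaceMeasure Ω)) := by
  have h1 := h.radial.sub (h.energy.const_mul (1 / 2))
  have h2 := (h.potential.const_mul (1 / p)).add (h.flux.const_mul (((N : ℝ) - 2 - 2 * a) / 2))
  simp only [inner_pohozaevField]
  refine ⟨h1.add h2, ?_⟩
  have e := integral_add h1 h2
  simp only [Pi.add_apply, Pi.sub_apply] at e
  rw [e, integral_sub h.radial (h.energy.const_mul (1 / 2)),
    integral_add (h.potential.const_mul (1 / p)) (h.flux.const_mul (((N : ℝ) - 2 - 2 * a) / 2)),
    integral_const_mul, integral_const_mul, integral_const_mul]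

end FluxThroughBoundary

end

/-! ### The Pohozaev identity -/

theorem theorem2p1 (N : ℕ) (hN : 3 ≤ N) (a b p : ℝ)
    (ha : a < ((N : ℝ) - 2) / 2) (hab : a ≤ b) (hba : b < a + 1)
    (hp : p = 2 * (N : ℝ) / ((N : ℝ) - 2 * (1 + a - b)))
    (Ω : Set (EuclideanSpace ℝ (Fin N)))
    (hΩo : IsOpen Ω) (hΩc : IsConnected Ω) (hΩb : Bornology.IsBounded Ω)
    (hΩs : HasSmoothBoundary Ω)
    (K : EuclideanSpace ℝ (Fin N) → ℝ) (hK : IsC1OnClosure Ω K)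
    (u : EuclideanSpace ℝ (Fin N) → ℝ)
    (g : EuclideanSpace ℝ (Fin N) → EuclideanSpace ℝ (Fin N))
    (hu : MemD12 a u g)
    (hsol : IsPositiveWeakSolution Ω a b p K u g)
    (hbd : IsC1NearBoundary Ω u g)
    (hbd0 : (0 : EuclideanSpace ℝ (Fin N)) ∈ frontier Ω →
      BoundaryTermsIntegrable Ω a b p K u g) :
    IntegrableOn (fun x => inner ℝ (gradient K x) x * (u x ^ p / ‖x‖ ^ (b * p))) Ω volume ∧
    BoundaryTermsIntegrable Ω a b p K u g ∧
    1 / p * (∫ x in Ω, inner ℝ (gradient K x) x * (u x ^ p / ‖x‖ ^ (b * p)))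
      - 1 / p * (∫ x, K x * (u x ^ p / ‖x‖ ^ (b * p)) * inner ℝ x (outerUnitNormal Ω x)
          ∂(surfaceMeasure Ω))
      = ((N : ℝ) - 2 - 2 * a) / 2 *
          (∫ x, ‖x‖ ^ (-2 * a) * u x * inner ℝ (g x) (outerUnitNormal Ω x) ∂(surfaceMeasure Ω))
        - 1 / 2 *
          (∫ x, ‖x‖ ^ (-2 * a) * ‖g x‖ ^ 2 * inner ℝ x (outerUnitNormal Ω x) ∂(surfaceMeasure Ω))
        + ∫ x, ‖x‖ ^ (-2 * a) * inner ℝ x (g x) * inner ℝ (g x) (outerUnitNormal Ω x)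
            ∂(surfaceMeasure Ω) := by
  have hP : CKNParams N a b p := ⟨hN, by linarith, hab, hba, hp⟩
  have hp0 : 0 ≤ p := by linarith [hP.two_lt]
  obtain ⟨φ, hφ⟩ := hu.exists_memD12On
  obtain ⟨M, hM⟩ := hK.exists_bound hΩb
  -- If 0 is not on the boundary, all four densities are continuous on a compact set of locally
  -- finite surface measure; otherwise integrability is assumed.
  have hB : BoundaryTermsIntegrable Ω a b p K u g := by
    by_cases h0 : (0 : EuclideanSpace ℝ (Fin N)) ∈ frontier Ω
    · exact hbd0 h0
    · obtain ⟨U, -, hUf, hUc⟩ := hbd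
      have hsub : frontier Ω ⊆ closure Ω ∩ U := fun x hx =>
        ⟨frontier_subset_closure hx, hUf ⟨hx, fun h => h0 (h ▸ hx)⟩⟩
      exact boundaryTermsIntegrable_of_zero_notMem hΩo hΩs hΩb h0 hp0
        (hK.continuousOn.mono frontier_subset_closure) (hUc.continuousOn.mono hsub)
        (hUc.continuousOn_gradient.mono hsub)
  refine ⟨integrableOn_inner_gradient_mul_potential hP hφ hsol.pos hΩo hΩb (hK.contDiffOn hΩo)
    fun x hx => (hM x hx).2, hB, ?_⟩
  obtain ⟨h1, h2⟩ := hB.integral_inner_pohozaevField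
  have h3 := hsol.integral_pohozaevSource_eq hP hφ hΩo hΩb hΩs hK hbd h1
  simp only [pohozaevSource] at h3
  rw [h2, integral_const_mul] at h3
  linarith
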